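/- Let $n\ge 3$. For a prime $l$ let $G=\mathrm{GL}_n(\mathbb{Q}_l)$, with $T$ its diagonal torus, $U$ its upper triangular unipotent subgroup, $B=TU$, and $I_0\subseteq \mathrm{GL}_n(\mathbb{Z}_l)$ the Iwahori subgroup of matrices that are upper triangular modulo $l$. Let $\delta(t)=\prod_{i<j}|t_i/t_j|_l$. For an unramified character $\chi$ of $T$ let $\phi_1^{\chi}\colon G\to\mathbb{C}$ be the function with $\phi_1^{\chi}(tuk)=\chi(t)\delta(t)^{1/2}$ for $t\in T$, $u\in U$, $k\in I_0$, and $\phi_1^{\chi}=0$ off $BI_0$. For a permutation matrix $w$ put $U_w=w^{-1}U^{\top}w\cap U$, with the product measure of its free entries (so that $U_w(\mathbb{Z}_l)$ has volume $1$), and $[\mathcal{A}_w^{\chi}f](x)=\int_{U_w(\mathbb{Q}_l)}f(wux)\,du$. For $d_1,\dots,d_r\ge 1$ with $d_1+\dots+d_r=n$ let $$w_{d_1,\dots,d_r}=\begin{pmatrix} & & \mathbf{1}_{d_1}\\ & \iddots & \\ \mathbf{1}_{d_r} & & \end{pmatrix}.$$ For $c\in(\mathbb{Q}_l^{\times})^{n-1}$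 put $c^{\ast}=\mathrm{diag}\big(\tfrac1{c_{n-1}},\tfrac{c_{n-1}}{c_{n-2}},\dots,\tfrac{c_2}{c_1},c_1\big)$, and for $\mathbf{s}\in\mathbb{C}^{r-1}$ let $\chi^{\rm ad}_{\mathbf{s}}$ be the unramified character with $$\chi^{\rm ad}_{\mathbf{s}}(c^{\ast})=\prod_{i=1}^{r-1}|c_{n-d_1-\dots-d_i}|_l^{-s_i};$$ this determines it on the diagonal matrices of determinant $1$, and any unramified extension to $T$ is allowed. There is a constant $C$ depending only on $n$ such that for every prime $l$, every $w=w_{d_1,\dots,d_r}$, every tuple $\boldsymbol{\epsilon}$ of positive reals and every $\mathbf{s}\in\mathbb{C}^{r-1}$ with $\mathrm{Re}(s_i)=1+\epsilon_i$ for all $i$, the integral that defines $[\mathcal{A}_w^{\chi^{\rm ad}_{\mathbf{s}}}\phi_1^{\chi^{\rm ad}_{\mathbf{s}}}](\mathbf{1}_n)$ converges absolutely and $$\big|[\mathcal{A}_w^{\chi^{\rm ad}_{\mathbf{s}}}\phi_1^{\chi^{\rm ad}_{\mathbf{s}}}](\mathbf{1}_n)\big|\le C\, l^{-\frac{n(r-1)}{2}}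 .$$ -/

import Mathlib

open MeasureTheory

namespace IwahoriGL

/-! ### Haar measure on the `p`-adic numbers -/

section Measure

variable (p : ℕ) [Fact p.Prime]

noncomputable instance instMeasurableSpacePadic : MeasurableSpace ℚ_[p] := borel _

instance instBorelSpacePadic : BorelSpace ℚ_[p] := ⟨rfl⟩

/-- `ℤ_p`, as a compact subset of `ℚ_p` with non-empty interior. -/
def unitBall : TopologicalSpace.PositiveCompacts ℚ_[p] where
  carrier := Metric.closedBall 0 1
  isCompact' := isCompact_closedBall 0 1
  interior_nonempty' :=
    ⟨0, Metric.ball_subset_interior_closedBall (Metric.mem_ball_self one_pos)⟩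

/-- The Haar measure on `ℚ_p` that gives `ℤ_p` volume `1`. -/
noncomputable def padicHaar : Measure ℚ_[p] := Measure.addHaarMeasure (unitBall p)

end Measure

/-! ### Subgroups of `GL_n(ℚ_p)` and the Weyl group -/

section Groups

variable {n : ℕ} {p : ℕ} [Fact p.Prime]

/-- The diagonal torus `T(ℚ_p)` in coordinates. -/
abbrev Torus (n p : ℕ) [Fact p.Prime] : Type := Fin n → ℚ_[p]ˣ

/-- `diag(t_1, …, t_n)`. -/
noncomputable def torusElt (t : Torus n p) : GL (Fin n) ℚ_[p] :=
  Units.map (Matrix.diagonalRingHom (Fin n) ℚ_[p]).toMonoidHom (MulEquiv.piUnits.symm t)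

/-- `U(ℚ_p)`: upper triangular unipotent matrices. -/
def unipotent (n p : ℕ) [Fact p.Prime] : Set (GL (Fin n) ℚ_[p]) :=
  {u | (u : Matrix (Fin n) (Fin n) ℚ_[p]).IsUpperTriangular ∧
    ∀ i, (u : Matrix (Fin n) (Fin n) ℚ_[p]) i i = 1}

/-- `U^⊤(ℚ_p)`: transposes of elements of `U(ℚ_p)`. -/
def unipotentTranspose (n p : ℕ) [Fact p.Prime] : Set (GL (Fin n) ℚ_[p]) :=
  {v | ∃ u ∈ unipotent n p,
    (v : Matrix (Fin n) (Fin n) ℚ_[p]) = (u : Matrix (Fin n) (Fin n) ℚ_[p]).transpose}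

/-- The maximal compact subgroup `GL_n(ℤ_p)`. -/
noncomputable def maxCompact (n p : ℕ) [Fact p.Prime] : Subgroup (GL (Fin n) ℚ_[p]) :=
  (Matrix.GeneralLinearGroup.map (n := Fin n) (PadicInt.Coe.ringHom (p := p))).range

/-- The Iwahori subgroup `I_0`: elements of `GL_n(ℤ_p)` that are upper triangular modulo `p`. -/
def iwahori (n p : ℕ) [Fact p.Prime] : Set (GL (Fin n) ℚ_[p]) :=
  {g | ∃ k : GL (Fin n) ℤ_[p],
    Matrix.GeneralLinearGroup.map (n := Fin n) (PadicInt.Coe.ringHom (p := p)) k = g ∧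
    ∀ i j : Fin n, j < i → (p : ℤ_[p]) ∣ (k : Matrix (Fin n) (Fin n) ℤ_[p]) i j}

/-- The permutation matrix of `w`, whose `(i, j)` entry is `1` if `i = w j` and `0` otherwise. -/
noncomputable def weylElt (p : ℕ) [Fact p.Prime] (w : Equiv.Perm (Fin n)) : GL (Fin n) ℚ_[p] :=
  (Matrix.permMatrixHom (n := Fin n) (R := ℚ_[p])).toHomUnits w

/-- `R(w)`, the positive roots `α_{i,j}`, `i < j`, that `w` makes negative. -/
abbrev PosToNeg (w : Equiv.Perm (Fin n)) : Type :=
  {a : Fin n × Fin n // a.1 < a.2 ∧ w a.2 < w a.1}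

/-- The group `U_w = w⁻¹ U^⊤ w ∩ U`. -/
def unipotentOf (p : ℕ) [Fact p.Prime] (w : Equiv.Perm (Fin n)) : Set (GL (Fin n) ℚ_[p]) :=
  {u | weylElt p w * u * (weylElt p w)⁻¹ ∈ unipotentTranspose n p} ∩ unipotent n p

/-- The unipotent matrix with the entries `z` at the positions in `R(w)` and zeros at the other
positions off the diagonal. -/
noncomputable def unipotentMatrix (w : Equiv.Perm (Fin n)) (z : PosToNeg w → ℚ_[p]) :
    Matrix (Fin n) (Fin n) ℚ_[p] :=
  Matrix.of fun i j =>
    if h : i < j ∧ w j < w i then z ⟨(i, j), h⟩ else if i = j then 1 else 0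

theorem unipotentMatrix_upper (w : Equiv.Perm (Fin n)) (z : PosToNeg w → ℚ_[p]) :
    (unipotentMatrix w z).IsUpperTriangular := by
  intro i j hij
  have hij' : j < i := hij
  simp [unipotentMatrix, hij'.not_gt, hij'.ne']

theorem unipotentMatrix_diag (w : Equiv.Perm (Fin n)) (z : PosToNeg w → ℚ_[p]) (i : Fin n) :
    unipotentMatrix w z i i = 1 := by
  simp [unipotentMatrix]

theorem det_unipotentMatrix (w : Equiv.Perm (Fin n)) (z : PosToNeg w → ℚ_[p]) :
    (unipotentMatrix w z).det = 1 := by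
  rw [Matrix.det_of_isUpperTriangular (unipotentMatrix_upper w z)]
  simp [unipotentMatrix_diag]

/-- The coordinates `(ℚ_p)^{R(w)} → U_w(ℚ_p)`. -/
noncomputable def unipotentCoord (w : Equiv.Perm (Fin n)) (z : PosToNeg w → ℚ_[p]) :
    GL (Fin n) ℚ_[p] :=
  Matrix.GeneralLinearGroup.mkOfDetNeZero (unipotentMatrix w z)
    (by rw [det_unipotentMatrix]; exact one_ne_zero)

theorem weylElt_apply (w : Equiv.Perm (Fin n)) (i j : Fin n) :
    (weylElt p w : Matrix (Fin n) (Fin n) ℚ_[p]) i j = if i = w j then 1 else 0 := by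
  have h : j = w.symm i ↔ i = w j := by rw [Equiv.eq_symm_apply, eq_comm]
  simp [weylElt, Matrix.permMatrixHom, PEquiv.toMatrix_apply, Equiv.toPEquiv_apply,
    Equiv.Perm.inv_def, eq_comm, ← h]

theorem conj_weylElt_apply (w : Equiv.Perm (Fin n)) (u : GL (Fin n) ℚ_[p]) (i j : Fin n) :
    (weylElt p w * u * (weylElt p w)⁻¹ : GL (Fin n) ℚ_[p]) i j =
      (u : Matrix (Fin n) (Fin n) ℚ_[p]) (w.symm i) (w.symm j) := by
  have hinv : (weylElt p w)⁻¹ = weylElt p w⁻¹ := by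
    simp [weylElt]
  rw [hinv]
  have h : ∀ a : Fin n, i = w a ↔ a = w.symm i := fun a => by
    rw [Equiv.eq_symm_apply, eq_comm]
  have hmul : ∀ A B : GL (Fin n) ℚ_[p],
      ((A * B : GL (Fin n) ℚ_[p]) : Matrix (Fin n) (Fin n) ℚ_[p]) = A.val * B.val :=
    fun A B => rfl
  simp only [hmul, Matrix.mul_apply, weylElt_apply, h, Equiv.Perm.inv_def]
  simp

/-- The coordinates parametrize exactly the group `U_w(ℚ_p)`. -/
theorem range_unipotentCoord (w : Equiv.Perm (Fin n)) :
    Set.range (unipotentCoord (p := p) w) = unipotentOf p w := by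
  have hco : ∀ z : PosToNeg w → ℚ_[p],
      (unipotentCoord w z : Matrix (Fin n) (Fin n) ℚ_[p]) = unipotentMatrix w z := fun z => rfl
  have hlow : ∀ u : GL (Fin n) ℚ_[p], u ∈ unipotent n p →
      (weylElt p w * u * (weylElt p w)⁻¹ ∈ unipotentTranspose n p ↔
        ∀ i j : Fin n, i < j → w i < w j → (u : Matrix (Fin n) (Fin n) ℚ_[p]) i j = 0) := by
    intro u hu
    constructor
    · rintro ⟨v, hv, hvu⟩ i j hij hw
      have h1 := congrFun (congrFun hvu (w i)) (w j)
      rw [conj_weylElt_apply, Matrix.transpose_apply, hv.1 (show w i < w j from hw)] at h1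
      simpa using h1
    · intro h
      let M : Matrix (Fin n) (Fin n) ℚ_[p] :=
        ((weylElt p w * u * (weylElt p w)⁻¹ : GL (Fin n) ℚ_[p]) :
          Matrix (Fin n) (Fin n) ℚ_[p]).transpose
      have hM : M.det ≠ 0 := by
        rw [Matrix.det_transpose]
        exact ((Matrix.isUnit_iff_isUnit_det _).mp (Units.isUnit _)).ne_zero
      have hval : ((Matrix.GeneralLinearGroup.mkOfDetNeZero M hM : GL (Fin n) ℚ_[p]) :
          Matrix (Fin n) (Fin n) ℚ_[p]) = M := rfl
      refine ⟨Matrix.GeneralLinearGroup.mkOfDetNeZero M hM, ⟨?_, ?_⟩, ?_⟩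
      · intro i j hij
        have hij' : j < i := hij
        rw [hval]
        change (weylElt p w * u * (weylElt p w)⁻¹ : GL (Fin n) ℚ_[p]) j i = 0
        rw [conj_weylElt_apply]
        rcases lt_trichotomy (w.symm j) (w.symm i) with h1 | h1 | h1
        · exact h _ _ h1 (by simpa using hij')
        · exact absurd (w.symm.injective h1) hij'.ne
        · exact hu.1 h1
      · intro i
        rw [hval]
        change (weylElt p w * u * (weylElt p w)⁻¹ : GL (Fin n) ℚ_[p]) i i = 1
        rw [conj_weylElt_apply]
        exact hu.2 _
      · rw [hval, Matrix.transpose_transpose]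
  ext u
  constructor
  · rintro ⟨z, rfl⟩
    have hu : unipotentCoord w z ∈ unipotent n p :=
      ⟨unipotentMatrix_upper w z, unipotentMatrix_diag w z⟩
    refine ⟨(hlow _ hu).mpr ?_, hu⟩
    intro i j hij hw
    rw [hco]
    simp [unipotentMatrix, hw.not_gt, hij.ne]
  · rintro ⟨h1, hu⟩
    have h2 := (hlow u hu).mp h1
    refine ⟨fun a => (u : Matrix (Fin n) (Fin n) ℚ_[p]) a.1.1 a.1.2, ?_⟩
    apply Units.ext
    ext i j
    rw [hco]
    simp only [unipotentMatrix, Matrix.of_apply]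
    split_ifs with h3 h4
    · rfl
    · rw [h4]; exact (hu.2 j).symm
    · rcases lt_or_gt_of_ne h4 with h5 | h5
      · refine (h2 i j h5 ?_).symm
        have h6 : ¬ w j < w i := fun h => h3 ⟨h5, h⟩
        exact lt_of_le_of_ne (not_lt.mp h6) (fun h => h4 (w.injective h))
      · exact (hu.1 h5).symm

end Groups

/-! ### Unramified characters, standard basis vectors and intertwining operators -/

section Principal

variable {n : ℕ} {p : ℕ} [Fact p.Prime]

/-- A character of `T(ℚ_p)` is unramified if it is trivial on `T(ℤ_p)`. -/
def IsUnramified (χ : Torus n p →* ℂˣ) : Prop :=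
  ∀ t : Torus n p, (∀ i, ‖(t i : ℚ_[p])‖ = 1) → χ t = 1

/-- The modulus character `δ(t) = ∏_{i < j} |t_i / t_j|` of the Borel subgroup, on the torus. -/
noncomputable def modulus (t : Torus n p) : ℝ :=
  ∏ a : {a : Fin n × Fin n // a.1 < a.2}, ‖(t a.1.1 : ℚ_[p])‖ / ‖(t a.1.2 : ℚ_[p])‖

/-- `[χ δ^{1/2}](t)`. -/
noncomputable def twist (χ : Torus n p →* ℂˣ) (t : Torus n p) : ℂ :=
  (χ t : ℂ) * ((modulus t ^ (1 / 2 : ℝ) : ℝ) : ℂ)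

open Classical in
/-- The standard basis vector `φ_w^χ` of the Iwahori-fixed vectors in the principal series of `χ`:
its value at `g = t u w k`, with `t ∈ T`, `u ∈ U` and `k ∈ I_0`, is `[χ δ^{1/2}](t)`, and it
vanishes off `B w I_0`. For unramified `χ` the value does not depend on the decomposition that is
chosen; see `basisVector_apply`. -/
noncomputable def basisVector (χ : Torus n p →* ℂˣ) (w : Equiv.Perm (Fin n))
    (g : GL (Fin n) ℚ_[p]) : ℂ :=
  if h : ∃ t : Torus n p, ∃ u ∈ unipotent n p, ∃ k ∈ iwahori n p,
      g = torusElt t * u * weylElt p w * k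
  then twist χ h.choose else 0

/-- The measure on `U_w(ℚ_p)` in coordinates: the product of the measures on `ℚ_p`. -/
noncomputable def unipotentMeasure (p : ℕ) [Fact p.Prime] (w : Equiv.Perm (Fin n)) :
    Measure (PosToNeg w → ℚ_[p]) :=
  Measure.pi fun _ => padicHaar p

/-- The function on `U_w(ℚ_p)` whose integral is `[𝒜_w f](x)`. -/
noncomputable def intertwiningIntegrand (w : Equiv.Perm (Fin n)) (f : GL (Fin n) ℚ_[p] → ℂ)
    (x : GL (Fin n) ℚ_[p]) (z : PosToNeg w → ℚ_[p]) : ℂ :=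
  f (weylElt p w * unipotentCoord w z * x)

/-- The intertwining operator, `[𝒜_w f](x) = ∫_{U_w(ℚ_p)} f(w u x) du`. -/
noncomputable def intertwining (w : Equiv.Perm (Fin n)) (f : GL (Fin n) ℚ_[p] → ℂ)
    (x : GL (Fin n) ℚ_[p]) : ℂ :=
  ∫ z, intertwiningIntegrand w f x z ∂(unipotentMeasure p w)

theorem torusElt_apply (t : Torus n p) (i j : Fin n) :
    (torusElt t : Matrix (Fin n) (Fin n) ℚ_[p]) i j = if i = j then (t i : ℚ_[p]) else 0 := by
  change Matrix.diagonal (fun k => ((t k : ℚ_[p]))) i j = _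
  rw [Matrix.diagonal_apply]

theorem norm_torus_le {t t' : Torus n p} {u u' : GL (Fin n) ℚ_[p]} (hu : u ∈ unipotent n p)
    (hu' : u' ∈ unipotent n p) {b : GL (Fin n) ℚ_[p]} (hb : b ∈ maxCompact n p)
    (h : torusElt t * u = torusElt t' * u' * b) (i : Fin n) :
    ‖(t i : ℚ_[p])‖ ≤ ‖(t' i : ℚ_[p])‖ := by
  have hdiag : ∀ (t : Torus n p) (u : GL (Fin n) ℚ_[p]) (i j : Fin n),
      (torusElt t * u : GL (Fin n) ℚ_[p]) i j =
        (t i : ℚ_[p]) * (u : Matrix (Fin n) (Fin n) ℚ_[p]) i j := by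
    intro t u i j
    change ((torusElt t).val * u.val) i j = _
    simp [Matrix.mul_apply, torusElt_apply]
  have hup : ∀ (t : Torus n p) (u : GL (Fin n) ℚ_[p]), u ∈ unipotent n p →
      ((torusElt t * u : GL (Fin n) ℚ_[p]) : Matrix (Fin n) (Fin n) ℚ_[p]).IsUpperTriangular := by
    intro t u hu i j hij
    rw [hdiag, hu.1 hij, mul_zero]
  have hbu : (b : Matrix (Fin n) (Fin n) ℚ_[p]).IsUpperTriangular := by
    have hb' : b = (torusElt t' * u')⁻¹ * (torusElt t * u) := by rw [h]; group
    have hinv : (((torusElt t' * u')⁻¹ : GL (Fin n) ℚ_[p]) :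
        Matrix (Fin n) (Fin n) ℚ_[p]).IsUpperTriangular := by
      rw [Matrix.coe_units_inv]
      have := (Units.isUnit (torusElt t' * u')).invertible
      exact Matrix.blockTriangular_inv_of_blockTriangular (hup t' u' hu')
    rw [hb']
    exact Matrix.BlockTriangular.mul hinv (hup t u hu)
  have hent : (torusElt t * u : GL (Fin n) ℚ_[p]) i i =
      (t' i : ℚ_[p]) * (b : Matrix (Fin n) (Fin n) ℚ_[p]) i i := by
    rw [h]
    change ((torusElt t' * u').val * b.val) i i = _
    rw [Matrix.mul_apply, Finset.sum_eq_single i]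
    · rw [hdiag, hu'.2, mul_one]
    · intro j _ hj
      rcases lt_or_gt_of_ne hj with hj | hj
      · rw [hup t' u' hu' hj, zero_mul]
      · rw [hbu hj, mul_zero]
    · simp
  rw [hdiag, hu.2, mul_one] at hent
  obtain ⟨k, rfl⟩ := hb
  rw [hent, norm_mul]
  refine mul_le_of_le_one_right (norm_nonneg _) ?_
  exact (k.val i i).norm_le_one

theorem weylElt_mem_maxCompact (w : Equiv.Perm (Fin n)) : weylElt p w ∈ maxCompact n p := by
  refine ⟨(Matrix.permMatrixHom (n := Fin n) (R := ℤ_[p])).toHomUnits w, ?_⟩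
  apply Units.ext
  ext i j
  change PadicInt.Coe.ringHom ((w⁻¹).permMatrix ℤ_[p] i j) = (w⁻¹).permMatrix ℚ_[p] i j
  simp only [Equiv.Perm.permMatrix, PEquiv.toMatrix_apply]
  split_ifs <;> simp

/-- The vector `φ_w^χ` takes the prescribed values, for every decomposition. -/
theorem basisVector_apply (χ : Torus n p →* ℂˣ) (hχ : IsUnramified χ) (w : Equiv.Perm (Fin n))
    (t : Torus n p) {u k : GL (Fin n) ℚ_[p]} (hu : u ∈ unipotent n p) (hk : k ∈ iwahori n p) :
    basisVector χ w (torusElt t * u * weylElt p w * k) = twist χ t := by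
  have hex : ∃ t' : Torus n p, ∃ u' ∈ unipotent n p, ∃ k' ∈ iwahori n p,
      torusElt t * u * weylElt p w * k = torusElt t' * u' * weylElt p w * k' :=
    ⟨t, u, hu, k, hk, rfl⟩
  rw [basisVector, dif_pos hex]
  obtain ⟨u', hu', k', hk', h⟩ := hex.choose_spec
  generalize hex.choose = t' at h
  have hK : ∀ k ∈ iwahori n p, k ∈ maxCompact n p := fun k ⟨a, ha, _⟩ => ⟨a, ha⟩
  have hw := weylElt_mem_maxCompact (p := p) w
  have hn : ∀ i, ‖(t i : ℚ_[p])‖ = ‖(t' i : ℚ_[p])‖ := fun i => le_antisymm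
    (norm_torus_le hu hu' (b := weylElt p w * k' * k⁻¹ * (weylElt p w)⁻¹)
      (mul_mem (mul_mem (mul_mem hw (hK _ hk')) (inv_mem (hK _ hk))) (inv_mem hw))
      (by simpa [mul_assoc] using congrArg (fun x => x * k⁻¹ * (weylElt p w)⁻¹) h) i)
    (norm_torus_le hu' hu (b := weylElt p w * k * k'⁻¹ * (weylElt p w)⁻¹)
      (mul_mem (mul_mem (mul_mem hw (hK _ hk)) (inv_mem (hK _ hk'))) (inv_mem hw))
      (by simpa [mul_assoc] using congrArg (fun x => x * k'⁻¹ * (weylElt p w)⁻¹) h.symm) i)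
  have hχt : χ t' = χ t := by
    rw [← div_eq_one, ← map_div]
    refine hχ _ fun i => ?_
    have h0 : ‖(t i : ℚ_[p])‖ ≠ 0 := norm_ne_zero_iff.mpr (t i).ne_zero
    simp [Pi.div_apply, ← hn i, h0]
  simp only [twist, modulus, hχt, hn]

end Principal

/-! ### Admissible Weyl elements and the characters attached to them -/

section Admissible

variable {n : ℕ} {p : ℕ} [Fact p.Prime]

/-- The column of the matrix `w_{d_1, …, d_r}` with a `1` in row `a`: the `i`-th diagonal block
of rows (from the top) meets the `i`-th block of columns from the right. -/
def admissibleCol (d : Composition n) (a : Fin n) : Fin n :=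
  ⟨n - d.sizeUpTo (d.index a + 1) + (a - d.sizeUpTo (d.index a)), by
    have h1 := d.lt_sizeUpTo_index_succ a
    have h2 := d.sizeUpTo_index_le a
    have h3 := d.sizeUpTo_le (d.index a + 1)
    simp only [Fin.val_succ] at h1
    omega⟩

theorem admissibleCol_injective (d : Composition n) : Function.Injective (admissibleCol d) := by
  have key : ∀ a : Fin n, n - d.sizeUpTo (d.index a + 1) ≤ (admissibleCol d a : ℕ) ∧
      (admissibleCol d a : ℕ) < n - d.sizeUpTo (d.index a) := by
    intro a
    have h1 := d.lt_sizeUpTo_index_succ a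
    have h2 := d.sizeUpTo_index_le a
    have h3 := d.sizeUpTo_le (d.index a + 1)
    simp only [Fin.val_succ] at h1
    simp only [admissibleCol]
    omega
  have lt_imp : ∀ a b : Fin n, d.index a < d.index b → admissibleCol d a ≠ admissibleCol d b := by
    intro a b hab h
    have ha := key a
    have hb := key b
    rw [h] at ha
    have hmono : d.sizeUpTo (d.index a + 1) ≤ d.sizeUpTo (d.index b) :=
      d.monotone_sizeUpTo hab
    omega
  intro a b h
  rcases lt_trichotomy (d.index a) (d.index b) with h1 | h1 | h1
  · exact absurd h (lt_imp a b h1)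
  · have ha := d.sizeUpTo_index_le a
    have hb := d.sizeUpTo_index_le b
    have h2 := congrArg Fin.val h
    simp only [admissibleCol, h1] at h2
    rw [h1] at ha
    ext
    omega
  · exact absurd h.symm (lt_imp b a h1)

/-- The admissible Weyl element `w_{d_1, …, d_r}`, whose permutation matrix has the identity
blocks `1_{d_1}, …, 1_{d_r}` on the block antidiagonal, from the top right to the bottom left. -/
noncomputable def admissibleWeyl (d : Composition n) : Equiv.Perm (Fin n) :=
  (Equiv.ofBijective (admissibleCol d)
    (Finite.injective_iff_bijective.mp (admissibleCol_injective d))).symm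

/-- `c_k`, with the convention `c_0 = c_n = 1`. -/
noncomputable def modulusEntry (c : Fin (n - 1) → ℚ_[p]ˣ) (k : ℕ) : ℚ_[p]ˣ :=
  if h : 1 ≤ k ∧ k ≤ n - 1 then c ⟨k - 1, by omega⟩ else 1

/-- `c^* = diag(1 / c_{n-1}, c_{n-1} / c_{n-2}, …, c_2 / c_1, c_1)`. -/
noncomputable def starTorus (c : Fin (n - 1) → ℚ_[p]ˣ) : Torus n p :=
  fun i => modulusEntry c (n - i) / modulusEntry c (n - i - 1)

/-- `χ` restricts on the determinant one torus to the character `χ_s^{ad}`: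
`χ(c^*) = ∏_{i=1}^{r-1} |c_{n - d_1 - … - d_i}|^{-s_i}`. -/
def IsAdmissibleCharacter (d : Composition n) (s : Fin (d.length - 1) → ℂ)
    (χ : Torus n p →* ℂˣ) : Prop :=
  ∀ c : Fin (n - 1) → ℚ_[p]ˣ,
    (χ (starTorus c) : ℂ) =
      ∏ i : Fin (d.length - 1),
        ((‖(modulusEntry c (n - d.sizeUpTo (i + 1)) : ℚ_[p])‖ : ℝ) : ℂ) ^ (-s i)

theorem prod_starTorus (c : Fin (n - 1) → ℚ_[p]ˣ) (k : ℕ) (hk : k ≤ n) :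
    ∏ a : Fin n, (if n - k ≤ (a : ℕ) then starTorus c a else 1) = modulusEntry c k := by
  simp only [starTorus]
  rw [Fin.prod_univ_eq_prod_range
    (fun a => if n - k ≤ a then modulusEntry c (n - a) / modulusEntry c (n - a - 1) else 1) n,
    ← Finset.prod_range_reflect]
  have h0 : modulusEntry c 0 = 1 := by simp [modulusEntry]
  have hstep : ∀ m ≤ k, ∏ a ∈ Finset.range m,
      (if n - k ≤ n - 1 - a then modulusEntry c (n - (n - 1 - a)) /
        modulusEntry c (n - (n - 1 - a) - 1) else 1) = modulusEntry c m := by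
    intro m hm
    induction m with
    | zero => simp [h0]
    | succ m ih =>
      rw [Finset.prod_range_succ, ih (by omega), if_pos (by omega),
        show n - (n - 1 - m) = m + 1 by omega]
      simp
  rw [← hstep k le_rfl]
  refine (Finset.prod_subset (Finset.range_subset_range.mpr hk) ?_).symm
  intro a ha hak
  simp only [Finset.mem_range] at ha hak
  rw [if_neg (by omega)]

/-- Unramified characters of `T(ℚ_p)` that restrict to `χ_s^{ad}` exist. -/
theorem exists_admissibleCharacter (d : Composition n) (s : Fin (d.length - 1) → ℂ) :
    ∃ χ : Torus n p →* ℂˣ, IsUnramified χ ∧ IsAdmissibleCharacter d s χ := by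
  let nc : ℂ → ℚ_[p]ˣ →* ℂ := fun z =>
    { toFun := fun x => ((‖(x : ℚ_[p])‖ : ℝ) : ℂ) ^ z
      map_one' := by simp
      map_mul' := fun x y => by
        rw [Units.val_mul, norm_mul, Complex.ofReal_mul,
          Complex.mul_cpow_ofReal_nonneg (norm_nonneg _) (norm_nonneg _)] }
  let tail : ℕ → Torus n p →* ℚ_[p]ˣ := fun k =>
    { toFun := fun t => ∏ a : Fin n, (if n - k ≤ (a : ℕ) then t a else 1)
      map_one' := by simp
      map_mul' := fun x y => by
        rw [← Finset.prod_mul_distrib]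
        refine Finset.prod_congr rfl fun a _ => ?_
        split_ifs <;> simp }
  let χ : Torus n p →* ℂ :=
    ∏ i : Fin (d.length - 1), (nc (-s i)).comp (tail (n - d.sizeUpTo (i + 1)))
  have hχ : ∀ t, χ t = ∏ i : Fin (d.length - 1),
      ((‖((tail (n - d.sizeUpTo (i + 1)) t : ℚ_[p]ˣ) : ℚ_[p])‖ : ℝ) : ℂ) ^ (-s i) := by
    intro t
    simp only [χ, MonoidHom.finsetProd_apply]
    rfl
  refine ⟨χ.toHomUnits, fun t ht => ?_, fun c => ?_⟩
  · apply Units.ext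
    rw [MonoidHom.coe_toHomUnits, hχ, Units.val_one]
    refine Finset.prod_eq_one fun i _ => ?_
    have h1 : ‖((tail (n - d.sizeUpTo (i + 1)) t : ℚ_[p]ˣ) : ℚ_[p])‖ = 1 := by
      change ‖((∏ a : Fin n, (if n - (n - d.sizeUpTo (i + 1)) ≤ (a : ℕ) then t a else 1) :
        ℚ_[p]ˣ) : ℚ_[p])‖ = 1
      rw [Units.coe_prod, norm_prod]
      refine Finset.prod_eq_one fun a _ => ?_
      split_ifs
      · exact ht a
      · simp
    rw [h1]
    simp
  · rw [MonoidHom.coe_toHomUnits, hχ]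
    refine Finset.prod_congr rfl fun i _ => ?_
    have h1 : tail (n - d.sizeUpTo (i + 1)) (starTorus c) =
        modulusEntry c (n - d.sizeUpTo (i + 1)) := prod_starTorus c _ (by omega)
    rw [h1]

end Admissible

end IwahoriGL

/-! Put $v=wuw^{-1}$, so that $wu=vw$. As $u$ runs through $U_w$, $v$ runs through the lower
unipotent matrices for the block decomposition $(d_1,\dots,d_r)$, and
$w\in\mathrm{GL}_n(\mathbb{Z}_l)$. Let $\mathrm{bl}(a)\in\{0,\dots,r-1\}$ be the block of the index
$a$. On $g=bk$, with $b$ upper triangular, $k\in I_0$ and $|\det g|=1$, the absolute value of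
$\phi_1^\chi$ is $\prod_i|b_{ii}|^{e_i}$. The character enters only through
$e_a-e_b\ge(b-a)+(\mathrm{bl}(b)-\mathrm{bl}(a))$ for $\mathrm{bl}(a)<\mathrm{bl}(b)$, which holds
because $\mathrm{Re}(s_i)\ge1$; so the bound is uniform in $\mathbf s$. It remains to bound the
integral of `absVector e (v * k)` over $v$, for every $k\in\mathrm{GL}_n(\mathbb{Z}_l)$: the
induction needs all $k$, not only $k=w$.

`lintegral_absVector_le` is an induction that removes the last row $(x,1)$ of $v$. An explicit
Iwasawa decomposition (`exists_row_reduction`) gives a matrix $\kappa\in\mathrm{GL}_n(\mathbb{Z}_l)$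
with last row $t^{-1}(x,1)$, where $|t|=\max(1,|x|)$. The other rows absorb what remains by a
substitution $M\mapsto GMH$. Its Jacobian and the torus part combine to a product of one-variable
kernels in the coordinates of $x$ (`row_weight_identity`). The integrand vanishes unless the last
row of $\kappa k$ is $(0,\dots,0,\text{unit})$ modulo $l$; then the Schur complement of $\kappa k$
is integral and invertible of size $n-1$, and the induction applies.

The saving comes from this vanishing condition: $t^{-1}(x,1)$ must be, modulo $l$, a unit multiple
of the last row of $k^{-1}$. Take the coordinates of $x$ in an order that puts later blocks first. A
coordinate that does not raise the running maximum is confined to one small ball, which gives a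
factor $l^{-1}$. A coordinate $a$ that raises it gives $O(l^{-\beta_a})$ with
$\beta_a\ge\mathrm{bl}(\text{last})-\mathrm{bl}(a)$, and at least $\mathrm{bl}(a)$ coordinates come
after it. Counting from the last raise, the row saves $l^{-\mathrm{bl}(\text{last})}$
(`lintegral_rowCongr_le`), and all rows together save $l^{-\sum_a\mathrm{bl}(a)}$.

The contragredient $g\mapsto$ ($g^{-1}$ reflected in the antidiagonal) reverses the blocks and gives
$l^{-\sum_a(r-1-\mathrm{bl}(a))}$ (`lintegral_absVector_le_rev`). The two exponents add up to
$n(r-1)$, so the better one is at least $n(r-1)/2$. -/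

open MeasureTheory
open scoped NNReal ENNReal Pointwise Topology

namespace IwahoriGL

/-! ### Scaling of the Haar measure on the p-adic numbers -/

section HaarScaling

variable (p : ℕ) [Fact p.Prime]

instance isAddHaarMeasure_padicHaar : (padicHaar p).IsAddHaarMeasure := by
  unfold padicHaar; infer_instance

theorem padicHaar_closedBall_one : padicHaar p (Metric.closedBall 0 1) = 1 :=
  Measure.addHaarMeasure_self (K₀ := unitBall p)

theorem padic_norm_lt_one_iff (x : ℚ_[p]) : ‖x‖ < 1 ↔ ‖x‖ ≤ (p : ℝ)⁻¹ := by
  have := Padic.norm_lt_pow_iff_norm_le_pow_sub_one x 0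
  simpa using this

/-- The closed unit ball is the disjoint union of $p$ translates of the open one, one for each
residue class. -/
theorem padicHaar_ball_one : padicHaar p (Metric.ball 0 1) = (p : ℝ≥0∞)⁻¹ := by
  have hp : (p : ℝ≥0∞) ≠ 0 := by exact_mod_cast (Fact.out : p.Prime).ne_zero
  have hU : Metric.closedBall (0 : ℚ_[p]) 1 =
      ⋃ i ∈ Finset.range p, Metric.ball (i : ℚ_[p]) 1 := by
    ext x
    simp only [Metric.mem_closedBall, sub_zero, Set.mem_iUnion, Metric.mem_ball,
      dist_eq_norm, Finset.mem_range, exists_prop]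
    constructor
    · intro hx
      obtain ⟨X, rfl⟩ : ∃ X : ℤ_[p], (X : ℚ_[p]) = x := ⟨⟨x, hx⟩, rfl⟩
      obtain ⟨i, hi, hx'⟩ := PadicInt.exists_mem_range X
      refine ⟨i, hi, ?_⟩
      rw [IsLocalRing.mem_maximalIdeal, PadicInt.mem_nonunits] at hx'
      rw [PadicInt.norm_def, PadicInt.coe_sub, PadicInt.coe_natCast] at hx'
      exact hx'
    · rintro ⟨i, -, hx⟩
      calc ‖x‖ = ‖(x - i) + i‖ := by ring_nf
        _ ≤ max ‖x - i‖ ‖(i : ℚ_[p])‖ := Padic.nonarchimedean _ _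
        _ ≤ 1 := max_le hx.le (by simpa using Padic.norm_int_le_one (p := p) i)
  have hd : Set.PairwiseDisjoint (Finset.range p : Set ℕ)
      (fun i : ℕ => Metric.ball (i : ℚ_[p]) 1) := by
    intro i hi j hj hij
    rw [Function.onFun, Set.disjoint_left]
    intro x hx hx'
    rw [Metric.mem_ball, dist_eq_norm] at hx hx'
    have h1 : ‖((i - j : ℤ) : ℚ_[p])‖ < 1 := by
      have : ((i - j : ℤ) : ℚ_[p]) = (x - j) + (-(x - i)) := by push_cast; ring
      rw [this]
      refine (Padic.nonarchimedean _ _).trans_lt (max_lt hx' (by rwa [norm_neg]))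
    rw [Padic.norm_intCast_lt_one_iff] at h1
    simp only [Finset.coe_range, Set.mem_Iio] at hi hj
    apply hij
    have := Int.eq_zero_of_abs_lt_dvd h1 (by rw [abs_lt]; constructor <;> omega)
    omega
  have h := padicHaar_closedBall_one p
  rw [hU, measure_biUnion_finset hd (fun _ _ => measurableSet_ball)] at h
  have hb : ∀ i : ℕ, padicHaar p (Metric.ball (i : ℚ_[p]) 1) =
      padicHaar p (Metric.ball 0 1) := fun i => by
    rw [Measure.addHaar_ball_center]
  simp only [hb, Finset.sum_const, Finset.card_range, nsmul_eq_mul] at h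
  exact ENNReal.eq_inv_of_mul_eq_one_left (by rwa [mul_comm])

/-- Each $x$ is a power of $p$ times a unit. Units preserve $\mathbb{Z}_p$, and $p$ carries it onto
the open unit ball, of measure $1/p$. -/
theorem distribHaarChar_padic (x : ℚ_[p]ˣ) : distribHaarChar ℚ_[p] x = ‖(x : ℚ_[p])‖₊ := by
  have hunit : ∀ u : ℚ_[p]ˣ, ‖(u : ℚ_[p])‖ = 1 → distribHaarChar ℚ_[p] u = 1 := by
    intro u hu
    apply distribHaarChar_eq_of_measure_smul_eq_mul (μ := padicHaar p)
      (s := Metric.closedBall 0 1) <;> simp only [padicHaar_closedBall_one]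
    · exact one_ne_zero
    · exact ENNReal.one_ne_top
    · have : u • Metric.closedBall (0 : ℚ_[p]) 1 = Metric.closedBall 0 1 := by
        ext y
        rw [Set.mem_smul_set_iff_inv_smul_mem]
        simp [Units.smul_def, hu]
      rw [this, padicHaar_closedBall_one]; simp
  have hp0 : (p : ℚ_[p]) ≠ 0 := by exact_mod_cast (Fact.out : p.Prime).ne_zero
  have hpp : distribHaarChar ℚ_[p] (Units.mk0 (p : ℚ_[p]) hp0) = (p : ℝ≥0)⁻¹ := by
    apply distribHaarChar_eq_of_measure_smul_eq_mul (μ := padicHaar p)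
      (s := Metric.closedBall 0 1) <;> simp only [padicHaar_closedBall_one]
    · exact one_ne_zero
    · exact ENNReal.one_ne_top
    · have : Units.mk0 (p : ℚ_[p]) hp0 • Metric.closedBall (0 : ℚ_[p]) 1 = Metric.ball 0 1 := by
        ext y
        have hp1 : (0 : ℝ) < p := by exact_mod_cast (Fact.out : p.Prime).pos
        rw [Set.mem_smul_set_iff_inv_smul_mem]
        simp [Units.smul_def, padic_norm_lt_one_iff]
        rw [← one_div, le_div_iff₀ hp1, mul_comm]
      rw [this, padicHaar_ball_one, ENNReal.coe_inv (by exact_mod_cast (Fact.out : p.Prime).ne_zero)]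
      simp
  obtain ⟨k, hk⟩ : ∃ k : ℤ, ‖(x : ℚ_[p])‖ = (p : ℝ) ^ (-k) :=
    ⟨_, Padic.norm_eq_zpow_neg_valuation x.ne_zero⟩
  have hx : x = Units.mk0 (p : ℚ_[p]) hp0 ^ k * (x * (Units.mk0 (p : ℚ_[p]) hp0 ^ k)⁻¹) := by
    rw [mul_comm x, mul_inv_cancel_left]
  have hp1 : (0 : ℝ) < p := by exact_mod_cast (Fact.out : p.Prime).pos
  rw [hx, map_mul, map_zpow, hpp, hunit, mul_one]
  · ext
    rw [← hx]
    simp [hk]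
  · simp [hk, inv_mul_cancel₀ (zpow_ne_zero k hp1.ne')]

theorem lintegral_affine {c : ℚ_[p]} (hc : c ≠ 0) (g : ℚ_[p]) {F : ℚ_[p] → ℝ≥0∞}
    (hF : Measurable F) :
    ∫⁻ y, F (c * y + g) ∂padicHaar p = (‖c‖₊⁻¹ : ℝ≥0) * ∫⁻ y, F y ∂padicHaar p := by
  have hmap : (padicHaar p).map (fun y => c * y) = (‖c‖₊⁻¹ : ℝ≥0) • padicHaar p := by
    ext s hs
    rw [Measure.map_apply (by fun_prop) hs]
    have h := distribHaarChar_mul (padicHaar p) (Units.mk0 c hc)⁻¹ s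
    rw [map_inv, distribHaarChar_padic] at h
    rw [Measure.smul_apply, ENNReal.smul_def, smul_eq_mul]
    rw [Units.val_mk0] at h
    rw [h]
    congr 1
    ext y
    rw [Set.mem_smul_set_iff_inv_smul_mem]
    simp [Units.smul_def]
  calc ∫⁻ y, F (c * y + g) ∂padicHaar p
      = ∫⁻ y, F (y + g) ∂((padicHaar p).map (fun y => c * y)) := by
        rw [lintegral_map (by fun_prop) (by fun_prop)]
    _ = (‖c‖₊⁻¹ : ℝ≥0) * ∫⁻ y, F (y + g) ∂padicHaar p := by
        rw [hmap, lintegral_smul_measure]; rfl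
    _ = _ := by rw [lintegral_add_right_eq_self]

theorem padicHaar_ball (c : ℚ_[p]) {t : ℚ_[p]} (ht : t ≠ 0) :
    padicHaar p (Metric.ball c ‖t‖) = (‖t‖₊ : ℝ≥0) * (p : ℝ≥0∞)⁻¹ := by
  have h := lintegral_affine p (inv_ne_zero ht) (-(t⁻¹ * c))
    (F := (Metric.ball (0 : ℚ_[p]) 1).indicator 1) (by
      exact measurable_one.indicator measurableSet_ball)
  have h2 : ∀ y, (Metric.ball (0 : ℚ_[p]) 1).indicator (1 : ℚ_[p] → ℝ≥0∞)
      (t⁻¹ * y + -(t⁻¹ * c)) = (Metric.ball c ‖t‖).indicator 1 y := by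
    intro y
    have h0 : 0 < ‖t‖ := norm_pos_iff.mpr ht
    have : y ∈ Metric.ball c ‖t‖ ↔ (t⁻¹ * y + -(t⁻¹ * c)) ∈ Metric.ball (0 : ℚ_[p]) 1 := by
      rw [← sub_eq_add_neg, ← mul_sub]
      simp [dist_eq_norm, inv_mul_lt_iff₀ h0]
    by_cases hy : y ∈ Metric.ball c ‖t‖
    · rw [Set.indicator_of_mem hy, Set.indicator_of_mem (this.mp hy)]; rfl
    · rw [Set.indicator_of_notMem hy, Set.indicator_of_notMem (fun h => hy (this.mpr h))]
  simp only [h2] at h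
  rw [lintegral_indicator_one measurableSet_ball, lintegral_indicator_one measurableSet_ball,
    padicHaar_ball_one] at h
  rw [h]; simp

end HaarScaling

/-! ### Triangular changes of variables -/

section Triangular

variable {p : ℕ} [Fact p.Prime] {ι : Type*} [Fintype ι]

/-- An affine change of one coordinate, with a shift that depends on the other coordinates. -/
theorem lintegral_update_affine [DecidableEq ι] (i : ι) {c : ℚ_[p]} (hc : c ≠ 0)
    {g : (ι → ℚ_[p]) → ℚ_[p]} (hg : Measurable g) (hgi : ∀ z y, g (Function.update z i y) = g z)
    {F : (ι → ℚ_[p]) → ℝ≥0∞} (hF : Measurable F) :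
    ∫⁻ z, F (Function.update z i (c * z i + g z)) ∂Measure.pi (fun _ => padicHaar p) =
      (‖c‖₊⁻¹ : ℝ≥0) * ∫⁻ z, F z ∂Measure.pi (fun _ => padicHaar p) := by
  have hm : Measurable fun z : ι → ℚ_[p] => Function.update z i (c * z i + g z) := by
    refine measurable_pi_lambda _ fun j => ?_
    rcases eq_or_ne j i with rfl | hj
    · simp only [Function.update_self]; fun_prop
    · simp only [Function.update_of_ne hj]; fun_prop
  have hins : (Finset.univ : Finset ι) = insert i (Finset.univ.erase i) := by simp
  rw [lintegral_eq_lmarginal_univ 0, lintegral_eq_lmarginal_univ 0, hins,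
    lmarginal_insert' (fun z => F (Function.update z i (c * z i + g z))) (hF.comp hm) (by simp), lmarginal_insert' _ hF (by simp),
    ← smul_eq_mul]
  have h : ∀ x : ι → ℚ_[p],
      ∫⁻ y, F (Function.update (Function.update x i y) i
        (c * Function.update x i y i + g (Function.update x i y))) ∂padicHaar p =
      (‖c‖₊⁻¹ : ℝ≥0) * ∫⁻ y, F (Function.update x i y) ∂padicHaar p := by
    intro x
    simp only [Function.update_self, Function.update_idem, hgi]
    exact lintegral_affine p hc (g x) (F := fun y => F (Function.update x i y))
      (hF.comp (measurable_update x))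
  simp only [h]
  have hm2 : Measurable fun x : ι → ℚ_[p] => ∫⁻ y, F (Function.update x i y) ∂padicHaar p := by
    have := hF.lmarginal (fun _ : ι => padicHaar p) (s := {i})
    simpa [lmarginal_singleton] using this
  simp only [lmarginal]
  rw [lintegral_const_mul]
  · rfl
  · exact hm2.comp measurable_updateFinset

/-- Change of variables along a triangular map. -/
theorem lintegral_triangular (rank : ι → ℕ) {c : ι → ℚ_[p]} (hc : ∀ i, c i ≠ 0)
    {f : ι → (ι → ℚ_[p]) → ℚ_[p]} (hf : ∀ i, Measurable (f i))
    (hdep : ∀ i z z', (∀ j, rank j < rank i → z j = z' j) → f i z = f i z')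
    {F : (ι → ℚ_[p]) → ℝ≥0∞} (hF : Measurable F) :
    ∫⁻ z, F (fun i => c i * z i + f i z) ∂Measure.pi (fun _ => padicHaar p) =
      ((∏ i, ‖c i‖₊)⁻¹ : ℝ≥0) * ∫⁻ z, F z ∂Measure.pi (fun _ => padicHaar p) := by
  classical
  have key : ∀ s : Finset ι, ∀ F : (ι → ℚ_[p]) → ℝ≥0∞, Measurable F →
      ∫⁻ z, F (fun i => if i ∈ s then c i * z i + f i z else z i)
        ∂Measure.pi (fun _ => padicHaar p) =
      ((∏ i ∈ s, ‖c i‖₊)⁻¹ : ℝ≥0) * ∫⁻ z, F z ∂Measure.pi (fun _ => padicHaar p) := by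
    intro s
    -- The inserted index has the least rank, so its shift involves none of the coordinates that
    -- have already been changed.
    induction s using Finset.induction_on_min_value rank with
    | empty => intro F hF; simp
    | insert a s ha hs ih =>
      intro F hF
      have hgi : ∀ z y, f a (Function.update z a y) = f a z := fun z y =>
        hdep a _ _ fun j hj => Function.update_of_ne (by rintro rfl; exact lt_irrefl _ hj) _ _
      have hm : Measurable fun z : ι → ℚ_[p] => Function.update z a (c a * z a + f a z) := by
        refine measurable_pi_lambda _ fun j => ?_
        rcases eq_or_ne j a with rfl | hj
        · simp only [Function.update_self]; have := hf j; fun_prop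
        · simp only [Function.update_of_ne hj]; fun_prop
      have h1 := ih (fun z => F (Function.update z a (c a * z a + f a z))) (hF.comp hm)
      rw [lintegral_update_affine a (hc a) (hf a) hgi hF, ← mul_assoc, ← ENNReal.coe_mul] at h1
      rw [Finset.prod_insert ha, mul_inv, mul_comm (‖c a‖₊⁻¹), ← h1]
      refine lintegral_congr fun z => ?_
      congr 1
      funext j
      have hfa : f a (fun i => if i ∈ s then c i * z i + f i z else z i) = f a z :=
        hdep a _ _ fun j hj => if_neg fun hjs => absurd (hs j hjs) (not_le.mpr hj)
      rcases eq_or_ne j a with rfl | hj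
      · simp [ha, hfa]
      · simp [hj]
  simpa using key Finset.univ F hF

end Triangular

/-! ### The one-variable kernel and its integrals -/

section RowKernel

variable {p : ℕ} [Fact p.Prime]

/-- The one-variable kernel `M^β / max(M, |y|)^{1+β}`. -/
noncomputable def rowKernel (M : ℝ≥0) (β : ℝ) (y : ℚ_[p]) : ℝ≥0 :=
  M ^ β * (max M ‖y‖₊) ^ (-(1 + β))

theorem measurable_rowKernel {X : Type*} [MeasurableSpace X] {M : X → ℝ≥0} (hM : Measurable M)
    (β : ℝ) {y : X → ℚ_[p]} (hy : Measurable y) : Measurable fun x => rowKernel (M x) β (y x) := by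
  unfold rowKernel
  fun_prop

theorem rowKernel_of_le {M : ℝ≥0} (hM : 0 < M) (β : ℝ) {y : ℚ_[p]} (hy : ‖y‖₊ ≤ M) :
    rowKernel M β y = M⁻¹ := by
  rw [rowKernel, max_eq_left hy, ← NNReal.rpow_add hM.ne', ← NNReal.rpow_neg_one]
  congr 1; ring

theorem rowKernel_scale (t : ℚ_[p]) (ht : t ≠ 0) (β : ℝ) (y : ℚ_[p]) :
    rowKernel ‖t‖₊ β y = ‖t‖₊⁻¹ * rowKernel 1 β (t⁻¹ * y) := by
  have h0 : (0 : ℝ≥0) < ‖t‖₊ := by simpa [pos_iff_ne_zero] using ht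
  have hm : max ‖t‖₊ ‖y‖₊ = ‖t‖₊ * max 1 ‖t⁻¹ * y‖₊ := by
    rw [mul_max, nnnorm_mul, nnnorm_inv, mul_one, mul_inv_cancel_left₀ h0.ne']
  rw [rowKernel, rowKernel, hm, NNReal.mul_rpow, ← mul_assoc, ← NNReal.rpow_add h0.ne',
    NNReal.one_rpow, one_mul, ← NNReal.rpow_neg_one]
  congr 2; ring

variable (p) in
theorem prime_two_le_real : (2 : ℝ≥0) ≤ p := by
  exact_mod_cast (Fact.out : p.Prime).two_le

/-- The shell $|z|=p^{k+1}$ lies in the open ball of radius $p^{k+2}$, of measure $p^{k+1}$, so it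
contributes at most $p^{-\beta(k+1)}$. Since $p^{-\beta}\le1/2$, the geometric series is at most
$2p^{-\beta}$. -/
theorem lintegral_rowKernel_one_tail {β : ℝ} (hβ : 1 ≤ β) :
    ∫⁻ z : ℚ_[p], {z : ℚ_[p] | 1 < ‖z‖₊}.indicator (fun z => (rowKernel 1 β z : ℝ≥0∞)) z
      ∂padicHaar p ≤ 2 * ((p : ℝ≥0) ^ (-β) : ℝ≥0) := by
  set q : ℝ≥0 := (p : ℝ≥0) ^ (-β) with hq
  have hp2 := prime_two_le_real p
  have hp0 : (0 : ℝ≥0) < p := by linarith [show (0 : ℝ≥0) < 2 by norm_num]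
  have hpq : (p : ℚ_[p]) ≠ 0 := by exact_mod_cast (Fact.out : p.Prime).ne_zero
  have hq2 : q ≤ 2⁻¹ := by
    calc q ≤ (p : ℝ≥0) ^ (-1 : ℝ) :=
          NNReal.rpow_le_rpow_of_exponent_le (by linarith [show (1 : ℝ≥0) ≤ 2 by norm_num])
            (by linarith)
      _ = (p : ℝ≥0)⁻¹ := NNReal.rpow_neg_one _
      _ ≤ 2⁻¹ := by gcongr
  let t : ℕ → ℚ_[p] := fun k => ((p : ℚ_[p])⁻¹) ^ (k + 2)
  have ht0 : ∀ k, t k ≠ 0 := fun k => pow_ne_zero _ (inv_ne_zero hpq)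
  have htn : ∀ k, ‖t k‖₊ = (p : ℝ≥0) ^ (k + 2) := fun k => by
    ext; simp [t]
  have hpt : ∀ z : ℚ_[p],
      {z : ℚ_[p] | 1 < ‖z‖₊}.indicator (fun z => (rowKernel 1 β z : ℝ≥0∞)) z ≤
      ∑' k : ℕ, (Metric.ball (0 : ℚ_[p]) ‖t k‖).indicator
        (fun _ => (((p : ℝ≥0)⁻¹ ^ (k + 1) * q ^ (k + 1) : ℝ≥0) : ℝ≥0∞)) z := by
    intro z
    by_cases hz : 1 < ‖z‖₊
    · rw [Set.indicator_of_mem (by exact hz)]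
      have hz0 : z ≠ 0 := by rintro rfl; simp at hz
      have hv := Padic.norm_eq_zpow_neg_valuation hz0
      have hp1 : (1 : ℝ) < p := by exact_mod_cast (Fact.out : p.Prime).one_lt
      have hv2 : 0 < -z.valuation := by
        have : (1 : ℝ) < ‖z‖ := hz
        rw [hv] at this
        exact (one_lt_zpow_iff_right₀ hp1).mp this
      obtain ⟨k, hk⟩ : ∃ k : ℕ, -z.valuation = ((k + 1 : ℕ) : ℤ) :=
        ⟨(-z.valuation - 1).toNat, by omega⟩
      rw [hk, zpow_natCast] at hv
      have hv' : ‖z‖₊ = (p : ℝ≥0) ^ (k + 1) := by ext; simpa using hv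
      refine le_trans (le_of_eq ?_) (ENNReal.le_tsum k)
      rw [Set.indicator_of_mem]
      · congr 1
        rw [rowKernel, max_eq_right hz.le, hv', NNReal.one_rpow, one_mul, hq,
          ← NNReal.rpow_natCast, ← NNReal.rpow_natCast, ← NNReal.rpow_natCast,
          ← NNReal.rpow_neg_one, ← NNReal.rpow_mul, ← NNReal.rpow_mul, ← NNReal.rpow_mul,
          ← NNReal.rpow_add hp0.ne']
        congr 1; ring
      · rw [mem_ball_zero_iff, hv, ← coe_nnnorm, htn]
        push_cast
        exact pow_lt_pow_right₀ hp1 (by omega)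
    · rw [Set.indicator_of_notMem (by exact hz)]; exact zero_le
  calc _ ≤ ∫⁻ z : ℚ_[p], ∑' k : ℕ, (Metric.ball (0 : ℚ_[p]) ‖t k‖).indicator
        (fun _ => (((p : ℝ≥0)⁻¹ ^ (k + 1) * q ^ (k + 1) : ℝ≥0) : ℝ≥0∞)) z ∂padicHaar p :=
        lintegral_mono hpt
    _ = ∑' k : ℕ, ((q ^ (k + 1) : ℝ≥0) : ℝ≥0∞) := by
        rw [lintegral_tsum fun k => (measurable_const.indicator measurableSet_ball).aemeasurable]
        refine tsum_congr fun k => ?_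
        rw [lintegral_indicator_const measurableSet_ball, padicHaar_ball p 0 (ht0 k), htn,
          show (p : ℝ≥0∞) = ((p : ℝ≥0) : ℝ≥0∞) by simp, ← ENNReal.coe_inv hp0.ne',
          ← ENNReal.coe_mul, ← ENNReal.coe_mul]
        congr 1
        rw [inv_pow]
        field_simp
        ring
    _ ≤ ∑' k : ℕ, (q : ℝ≥0∞) * ((2 : ℝ≥0∞)⁻¹) ^ k := by
        refine ENNReal.tsum_le_tsum fun k => ?_
        rw [show (2 : ℝ≥0∞)⁻¹ = ((2⁻¹ : ℝ≥0) : ℝ≥0∞) by simp, ← ENNReal.coe_pow,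
          ← ENNReal.coe_mul, ENNReal.coe_le_coe, pow_succ']
        gcongr
    _ = 2 * (q : ℝ≥0∞) := by
        rw [ENNReal.tsum_mul_left, ENNReal.tsum_geometric, ENNReal.one_sub_inv_two, inv_inv,
          mul_comm]

/-- The kernel is homogeneous of degree $-1$ in $(M,y)$, so the substitution $y=tz$ reduces to
$M=1$. -/
theorem lintegral_rowKernel_tail {t : ℚ_[p]} (ht : t ≠ 0) {β : ℝ} (hβ : 1 ≤ β) :
    ∫⁻ y : ℚ_[p], {y : ℚ_[p] | ‖t‖₊ < ‖y‖₊}.indicator (fun y => (rowKernel ‖t‖₊ β y : ℝ≥0∞)) y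
      ∂padicHaar p ≤ 2 * ((p : ℝ≥0) ^ (-β) : ℝ≥0) := by
  have h0 : (0 : ℝ≥0) < ‖t‖₊ := by simpa [pos_iff_ne_zero] using ht
  refine le_trans (le_of_eq ?_) (lintegral_rowKernel_one_tail hβ)
  have hmeas : Measurable fun z : ℚ_[p] =>
      {z : ℚ_[p] | 1 < ‖z‖₊}.indicator (fun z => (rowKernel 1 β z : ℝ≥0∞)) z :=
    (measurable_rowKernel measurable_const β measurable_id).coe_nnreal_ennreal.indicator
      (measurableSet_lt measurable_const measurable_nnnorm)
  have h := lintegral_affine p (inv_ne_zero ht) 0 hmeas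
  rw [nnnorm_inv, inv_inv] at h
  have h2 : ∫⁻ z : ℚ_[p], {z : ℚ_[p] | 1 < ‖z‖₊}.indicator
      (fun z => (rowKernel 1 β z : ℝ≥0∞)) z ∂padicHaar p = (‖t‖₊⁻¹ : ℝ≥0) *
      ∫⁻ y, {z : ℚ_[p] | 1 < ‖z‖₊}.indicator
        (fun z => (rowKernel 1 β z : ℝ≥0∞)) (t⁻¹ * y + 0) ∂padicHaar p := by
    rw [h, ← mul_assoc, ← ENNReal.coe_mul, inv_mul_cancel₀ h0.ne', ENNReal.coe_one, one_mul]
  have hmeas' : Measurable fun y : ℚ_[p] => {z : ℚ_[p] | 1 < ‖z‖₊}.indicator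
      (fun z => (rowKernel 1 β z : ℝ≥0∞)) (t⁻¹ * y + 0) := hmeas.comp (by fun_prop)
  rw [h2, ← lintegral_const_mul _ hmeas']
  refine lintegral_congr fun y => ?_
  rw [add_zero]
  have hiff : 1 < ‖t⁻¹ * y‖₊ ↔ ‖t‖₊ < ‖y‖₊ := by
    rw [nnnorm_mul, nnnorm_inv, lt_inv_mul_iff₀ h0, mul_one]
  by_cases hy : ‖t‖₊ < ‖y‖₊
  · rw [Set.indicator_of_mem (by exact hy), Set.indicator_of_mem (by exact hiff.mpr hy),
      rowKernel_scale t ht, ENNReal.coe_mul]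
  · rw [Set.indicator_of_notMem (by exact hy),
      Set.indicator_of_notMem (by exact fun h => hy (hiff.mp h)), mul_zero]

/-- Where $|y|\le|t|$ the kernel is the constant $|t|^{-1}$, and the open ball of radius $|t|$ has
measure $|t|/p$. This is the source of each saved factor $p^{-1}$. -/
theorem lintegral_rowKernel_ball {t : ℚ_[p]} (ht : t ≠ 0) (β : ℝ) (c : ℚ_[p]) :
    ∫⁻ y : ℚ_[p], {y : ℚ_[p] | ‖y‖₊ ≤ ‖t‖₊ ∧ ‖y - c‖₊ < ‖t‖₊}.indicator
      (fun y => (rowKernel ‖t‖₊ β y : ℝ≥0∞)) y ∂padicHaar p ≤ (p : ℝ≥0∞)⁻¹ := by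
  have h0 : (0 : ℝ≥0) < ‖t‖₊ := by simpa [pos_iff_ne_zero] using ht
  calc _ ≤ ∫⁻ y : ℚ_[p], (Metric.ball c ‖t‖).indicator
        (fun _ => ((‖t‖₊⁻¹ : ℝ≥0) : ℝ≥0∞)) y ∂padicHaar p := by
        refine lintegral_mono fun y => ?_
        by_cases hy : ‖y‖₊ ≤ ‖t‖₊ ∧ ‖y - c‖₊ < ‖t‖₊
        · rw [Set.indicator_of_mem (by exact hy), Set.indicator_of_mem
            (by rw [Metric.mem_ball, dist_eq_norm]; exact hy.2), rowKernel_of_le h0 β hy.1]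
        · rw [Set.indicator_of_notMem (by exact hy)]; exact zero_le
    _ = (p : ℝ≥0∞)⁻¹ := by
        rw [lintegral_indicator_const measurableSet_ball, padicHaar_ball p c ht, ← mul_assoc,
          ← ENNReal.coe_mul, inv_mul_cancel₀ h0.ne', ENNReal.coe_one, one_mul]

/-- The region $|y|\le|t|$ contributes at most $1$, the tail at most $2p^{-\beta}\le2$. -/
theorem lintegral_rowKernel {t : ℚ_[p]} (ht : t ≠ 0) {β : ℝ} (hβ : 1 ≤ β) :
    ∫⁻ y : ℚ_[p], (rowKernel ‖t‖₊ β y : ℝ≥0∞) ∂padicHaar p ≤ 3 := by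
  have h0 : (0 : ℝ≥0) < ‖t‖₊ := by simpa [pos_iff_ne_zero] using ht
  have hp2 := prime_two_le_real p
  have hp0 : (0 : ℝ≥0) < p := by linarith [show (0 : ℝ≥0) < 2 by norm_num]
  have hpq : (p : ℚ_[p]) ≠ 0 := by exact_mod_cast (Fact.out : p.Prime).ne_zero
  -- The open ball of radius $|t/p|$ is the closed ball of radius $|t|$.
  set s : ℚ_[p] := t * (p : ℚ_[p])⁻¹
  have hs : ‖s‖₊ = ‖t‖₊ * p := by ext; simp [s]
  have hs0 : s ≠ 0 := mul_ne_zero ht (inv_ne_zero hpq)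
  have hpt : ∀ y : ℚ_[p], (rowKernel ‖t‖₊ β y : ℝ≥0∞) ≤
      (Metric.ball (0 : ℚ_[p]) ‖s‖).indicator (fun _ => ((‖t‖₊⁻¹ : ℝ≥0) : ℝ≥0∞)) y +
      {y : ℚ_[p] | ‖t‖₊ < ‖y‖₊}.indicator (fun y => (rowKernel ‖t‖₊ β y : ℝ≥0∞)) y := by
    intro y
    by_cases hy : ‖t‖₊ < ‖y‖₊
    · rw [Set.indicator_of_mem (s := {y : ℚ_[p] | ‖t‖₊ < ‖y‖₊}) hy]
      exact le_add_self
    · rw [Set.indicator_of_mem, rowKernel_of_le h0 β (not_lt.mp hy)]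
      · exact le_self_add
      · rw [mem_ball_zero_iff, ← coe_nnnorm, ← coe_nnnorm, NNReal.coe_lt_coe, hs]
        refine (not_lt.mp hy).trans_lt (lt_mul_of_one_lt_right h0 ?_)
        exact lt_of_lt_of_le (by norm_num) hp2
  refine (lintegral_mono hpt).trans ?_
  rw [lintegral_add_left (measurable_const.indicator measurableSet_ball),
    lintegral_indicator_const measurableSet_ball, padicHaar_ball p 0 hs0, hs,
    show (p : ℝ≥0∞) = ((p : ℝ≥0) : ℝ≥0∞) by simp, ← ENNReal.coe_inv hp0.ne',
    ← ENNReal.coe_mul, ← ENNReal.coe_mul]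
  have h1 : ‖t‖₊⁻¹ * (‖t‖₊ * (p : ℝ≥0) * (p : ℝ≥0)⁻¹) = 1 := by field_simp
  rw [h1, show (3 : ℝ≥0∞) = ((1 : ℝ≥0) : ℝ≥0∞) + 2 * 1 by norm_num]
  gcongr
  refine (lintegral_rowKernel_tail ht hβ).trans ?_
  gcongr
  rw [← ENNReal.coe_one, ENNReal.coe_le_coe]
  exact NNReal.rpow_le_one_of_one_le_of_nonpos (le_trans (by norm_num) hp2) (by linarith)

end RowKernel

/-! ### The saving in the integral over one row -/

section RowIntegral

variable {p : ℕ} [Fact p.Prime] {ι : Type*}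

/-- The maximum of `1` and the norms of the coordinates in `s`. -/
noncomputable def maxNorm (s : Finset ι) (x : ι → ℚ_[p]) : ℝ≥0 :=
  1 ⊔ s.sup fun j => ‖x j‖₊

theorem one_le_maxNorm (s : Finset ι) (x : ι → ℚ_[p]) : 1 ≤ maxNorm s x := le_sup_left

theorem maxNorm_pos (s : Finset ι) (x : ι → ℚ_[p]) : 0 < maxNorm s x :=
  lt_of_lt_of_le one_pos (one_le_maxNorm s x)

theorem nnnorm_le_maxNorm {s : Finset ι} (x : ι → ℚ_[p]) {j : ι} (hj : j ∈ s) :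
    ‖x j‖₊ ≤ maxNorm s x :=
  (Finset.le_sup (f := fun j => ‖x j‖₊) hj).trans le_sup_right

theorem maxNorm_insert [DecidableEq ι] (s : Finset ι) (a : ι) (x : ι → ℚ_[p]) :
    maxNorm (insert a s) x = max (maxNorm s x) ‖x a‖₊ := by
  rw [maxNorm, maxNorm, Finset.sup_insert]
  exact (sup_left_comm _ _ _).trans (sup_comm _ _)

theorem maxNorm_congr {s : Finset ι} {x x' : ι → ℚ_[p]} (h : ∀ j ∈ s, x j = x' j) :
    maxNorm s x = maxNorm s x' := by
  rw [maxNorm, maxNorm]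
  congr 1
  exact Finset.sup_congr rfl fun j hj => by rw [h j hj]

theorem maxNorm_attained (s : Finset ι) (x : ι → ℚ_[p]) :
    maxNorm s x = 1 ∨ ∃ j ∈ s, maxNorm s x = ‖x j‖₊ := by
  rcases s.eq_empty_or_nonempty with rfl | hs
  · left; simp [maxNorm]
  · obtain ⟨j, hj, h⟩ := s.exists_mem_eq_sup hs (fun j => ‖x j‖₊)
    rw [maxNorm, h]
    rcases le_total (1 : ℝ≥0) ‖x j‖₊ with h1 | h1
    · exact Or.inr ⟨j, hj, sup_eq_right.mpr h1⟩
    · exact Or.inl (sup_eq_left.mpr h1)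

/-- Running maxima are norms of elements, so the kernel estimates, which scale by some $t$, apply to
them. -/
theorem exists_nnnorm_eq_maxNorm (s : Finset ι) (x : ι → ℚ_[p]) :
    ∃ t : ℚ_[p], t ≠ 0 ∧ ‖t‖₊ = maxNorm s x := by
  rcases maxNorm_attained s x with h | ⟨j, -, h⟩
  · exact ⟨1, one_ne_zero, by simp [h]⟩
  · refine ⟨x j, ?_, h.symm⟩
    have := maxNorm_pos s x
    rw [h] at this
    simpa [pos_iff_ne_zero] using this

theorem measurable_maxNorm (s : Finset ι) : Measurable (maxNorm (p := p) s) := by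
  classical
  induction s using Finset.induction_on with
  | empty =>
    have : maxNorm (p := p) (∅ : Finset ι) = fun _ => 1 := by funext x; simp [maxNorm]
    rw [this]
    exact measurable_const
  | insert a s _ ih =>
    have : maxNorm (p := p) (insert a s) = fun x => max (maxNorm s x) ‖x a‖₊ :=
      funext fun x => maxNorm_insert s a x
    rw [this]
    fun_prop

/-- The weight of a row vector, for the order of the coordinates given by `key`. -/
noncomputable def rowWeight (key : ι → ℕ) (β : ι → ℝ) (s : Finset ι) (x : ι → ℚ_[p]) : ℝ≥0 :=
  ∏ a ∈ s, rowKernel (maxNorm (s.filter fun c => key c < key a) x) (β a) (x a)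

theorem measurable_rowWeight (key : ι → ℕ) (β : ι → ℝ) (s : Finset ι) :
    Measurable (rowWeight (p := p) key β s) :=
  Finset.measurable_prod _ fun a _ =>
    measurable_rowKernel (measurable_maxNorm _) _ (measurable_pi_apply a)

/-- The coordinate with the largest key enters no other factor. The coordinates can therefore be
integrated one by one, starting from the largest key. -/
theorem rowWeight_insert [DecidableEq ι] {key : ι → ℕ} (hkey : Function.Injective key)
    (β : ι → ℝ) {s : Finset ι} {a : ι} (ha : a ∉ s) (hs : ∀ c ∈ s, key c ≤ key a)
    (x : ι → ℚ_[p]) (y : ℚ_[p]) :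
    rowWeight key β (insert a s) (Function.update x a y) =
      rowWeight key β s x * rowKernel (maxNorm s x) (β a) y := by
  have hlt : ∀ c ∈ s, key c < key a := fun c hc =>
    lt_of_le_of_ne (hs c hc) fun h => ha (hkey h ▸ hc)
  have hup : ∀ c ∈ s, Function.update x a y c = x c := fun c hc =>
    Function.update_of_ne (by rintro rfl; exact ha hc) _ _
  rw [rowWeight, Finset.prod_insert ha, mul_comm, rowWeight]
  congr 1
  · refine Finset.prod_congr rfl fun c hc => ?_
    rw [hup c hc, Finset.filter_insert, if_neg (not_lt.mpr (hs c hc))]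
    congr 1
    exact maxNorm_congr fun j hj => hup j (Finset.mem_of_mem_filter j hj)
  · rw [Finset.filter_insert, if_neg (lt_irrefl _), Finset.filter_true_of_mem hlt,
      Function.update_self, maxNorm_congr hup]

/-- The vector `(x, 1)` is congruent to a multiple of the vector `(ρ, ρ₀)`, relative to its
norm. -/
def RowCongr (ρ : ι → ℚ_[p]) (ρ₀ : ℚ_[p]) (s : Finset ι) (x : ι → ℚ_[p]) : Prop :=
  (∀ i ∈ s, ∀ j ∈ s, ‖x i * ρ j - x j * ρ i‖₊ < maxNorm s x) ∧
  (∀ i ∈ s, ‖x i * ρ₀ - ρ i‖₊ < maxNorm s x) ∧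
  (∀ i ∈ s, ‖x i‖₊ = maxNorm s x → ‖ρ i‖₊ = 1) ∧ (maxNorm s x = 1 → ‖ρ₀‖₊ = 1)

theorem measurableSet_rowCongr [Countable ι] (ρ : ι → ℚ_[p]) (ρ₀ : ℚ_[p]) (s : Finset ι) :
    MeasurableSet {x | RowCongr ρ ρ₀ s x} := by
  have hM := measurable_maxNorm (p := p) s
  simp only [RowCongr, Set.ofPred_and, Set.ofPred_forall]
  refine MeasurableSet.inter ?_ (MeasurableSet.inter ?_ (MeasurableSet.inter ?_ ?_))
  · exact MeasurableSet.iInter fun i => MeasurableSet.iInter fun _ => MeasurableSet.iInter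
      fun j => MeasurableSet.iInter fun _ => measurableSet_lt (by fun_prop) hM
  · exact MeasurableSet.iInter fun i => MeasurableSet.iInter fun _ =>
      measurableSet_lt (by fun_prop) hM
  · refine MeasurableSet.iInter fun i => MeasurableSet.iInter fun _ => ?_
    by_cases h : ‖ρ i‖₊ = 1
    · simp [h]
    · simp only [h, imp_false]
      exact (measurableSet_eq_fun (by fun_prop) hM).compl
  · by_cases h : ‖ρ₀‖₊ = 1
    · simp [h]
    · simp only [h, imp_false]
      exact (measurableSet_eq_fun hM measurable_const).compl

/-- If the last coordinate does not increase the norm, then the congruence confines it to a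
ball. -/
theorem RowCongr.restrict [DecidableEq ι] {ρ : ι → ℚ_[p]} {ρ₀ : ℚ_[p]} {s : Finset ι} {a : ι}
    (x : ι → ℚ_[p]) :
    ∃ c : ℚ_[p], ∀ y, (∀ j ∈ s, Function.update x a y j = x j) → ‖y‖₊ ≤ maxNorm s x →
      RowCongr ρ ρ₀ (insert a s) (Function.update x a y) →
      RowCongr ρ ρ₀ s x ∧ ‖y - c‖₊ < maxNorm s x := by
  have hcanc : ∀ u v r : ℚ_[p], ‖r‖₊ = 1 → ‖u - v * r⁻¹‖₊ = ‖u * r - v‖₊ := by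
    intro u v r hr
    have hr0 : r ≠ 0 := by rintro rfl; simp at hr
    rw [← mul_one ‖u - v * r⁻¹‖₊, ← hr, ← nnnorm_mul, sub_mul, inv_mul_cancel_right₀ hr0]
  have key : ∀ y, (∀ j ∈ s, Function.update x a y j = x j) → ‖y‖₊ ≤ maxNorm s x →
      RowCongr ρ ρ₀ (insert a s) (Function.update x a y) → RowCongr ρ ρ₀ s x ∧
      (∀ j ∈ s, ‖y * ρ j - x j * ρ a‖₊ < maxNorm s x) ∧ ‖y * ρ₀ - ρ a‖₊ < maxNorm s x := by
    intro y hup hy h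
    have hM : maxNorm (insert a s) (Function.update x a y) = maxNorm s x := by
      rw [maxNorm_insert, Function.update_self, maxNorm_congr hup, max_eq_left hy]
    rw [RowCongr, hM] at h
    obtain ⟨h1, h2, h3, h4⟩ := h
    refine ⟨⟨fun i hi j hj => ?_, fun i hi => ?_, fun i hi => ?_, h4⟩, fun j hj => ?_, ?_⟩
    · simpa [hup i hi, hup j hj] using
        h1 i (Finset.mem_insert_of_mem hi) j (Finset.mem_insert_of_mem hj)
    · simpa [hup i hi] using h2 i (Finset.mem_insert_of_mem hi)
    · simpa [hup i hi] using h3 i (Finset.mem_insert_of_mem hi)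
    · simpa [hup j hj] using h1 a (Finset.mem_insert_self a s) j (Finset.mem_insert_of_mem hj)
    · simpa using h2 a (Finset.mem_insert_self a s)
  -- The vector $(x,1)$ has a pivot of maximal norm: the entry $1$ or some $x_i$. The entry of
  -- $(\rho,\rho_0)$ at this place is a unit, and the minor formed with the pivot determines $y$ up
  -- to an error smaller than the maximum.
  rcases maxNorm_attained s x with h | ⟨i, hi, h⟩
  · refine ⟨ρ a * ρ₀⁻¹, fun y hup hy hc => ?_⟩
    obtain ⟨h1, -, h3⟩ := key y hup hy hc
    exact ⟨h1, by rwa [hcanc _ _ _ (h1.2.2.2 h)]⟩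
  · refine ⟨x i * ρ a * (ρ i)⁻¹, fun y hup hy hc => ?_⟩
    obtain ⟨h1, h2, -⟩ := key y hup hy hc
    exact ⟨h1, by rw [hcanc _ _ _ (h1.2.2.1 i hi h.symm)]; exact h2 i hi⟩

/-- The integral of the weight over one more coordinate. -/
theorem lintegral_rowWeight_insert [DecidableEq ι] {key : ι → ℕ} (hkey : Function.Injective key)
    {β : ι → ℝ} {s : Finset ι} {a : ι} (ha : a ∉ s) (hs : ∀ c ∈ s, key c ≤ key a)
    (hβ : 1 ≤ β a) (x : ι → ℚ_[p]) :
    ∫⁻ y, (rowWeight key β (insert a s) (Function.update x a y) : ℝ≥0∞) ∂padicHaar p ≤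
      3 * rowWeight key β s x := by
  obtain ⟨t, ht, htM⟩ := exists_nnnorm_eq_maxNorm s x
  simp only [rowWeight_insert hkey β ha hs, ENNReal.coe_mul]
  have hker : Measurable fun y : ℚ_[p] => (rowKernel (maxNorm s x) (β a) y : ℝ≥0∞) :=
    (measurable_rowKernel measurable_const _ measurable_id).coe_nnreal_ennreal
  rw [lintegral_const_mul _ hker, mul_comm, ← htM]
  gcongr
  exact lintegral_rowKernel ht hβ

open Classical in
/-- The integral over one more coordinate of the weight on the vectors with the congruence. -/
theorem lintegral_rowCongr_insert {key : ι → ℕ} (hkey : Function.Injective key)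
    {β : ι → ℝ} {s : Finset ι} {a : ι} (ha : a ∉ s) (hs : ∀ c ∈ s, key c ≤ key a)
    (hβ : 1 ≤ β a) (ρ : ι → ℚ_[p]) (ρ₀ : ℚ_[p]) (x : ι → ℚ_[p]) :
    ∫⁻ y, (if RowCongr ρ ρ₀ (insert a s) (Function.update x a y) then
      (rowWeight key β (insert a s) (Function.update x a y) : ℝ≥0∞) else 0) ∂padicHaar p ≤
      2 * ((p : ℝ≥0) ^ (-β a) : ℝ≥0) * rowWeight key β s x +
        (p : ℝ≥0∞)⁻¹ * (if RowCongr ρ ρ₀ s x then (rowWeight key β s x : ℝ≥0∞) else 0) := by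
  obtain ⟨t, ht, htM⟩ := exists_nnnorm_eq_maxNorm s x
  obtain ⟨c, hc⟩ := RowCongr.restrict (ρ := ρ) (ρ₀ := ρ₀) (s := s) (a := a) x
  have hup : ∀ y, ∀ j ∈ s, Function.update x a y j = x j := fun y j hj =>
    Function.update_of_ne (by rintro rfl; exact ha hj) _ _
  simp only [rowWeight_insert hkey β ha hs, ENNReal.coe_mul]
  have hker : Measurable fun y : ℚ_[p] => (rowKernel ‖t‖₊ (β a) y : ℝ≥0∞) :=
    (measurable_rowKernel measurable_const _ measurable_id).coe_nnreal_ennreal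
  have hm1 : Measurable fun y => {y : ℚ_[p] | ‖t‖₊ < ‖y‖₊}.indicator
      (fun y => (rowKernel ‖t‖₊ (β a) y : ℝ≥0∞)) y :=
    hker.indicator (measurableSet_lt measurable_const measurable_nnnorm)
  have hm2 : Measurable fun y => {y : ℚ_[p] | ‖y‖₊ ≤ ‖t‖₊ ∧ ‖y - c‖₊ < ‖t‖₊}.indicator
      (fun y => (rowKernel ‖t‖₊ (β a) y : ℝ≥0∞)) y :=
    hker.indicator ((measurableSet_le measurable_nnnorm measurable_const).inter
      (measurableSet_lt (by fun_prop) measurable_const))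
  calc _ ≤ ∫⁻ y, ((rowWeight key β s x : ℝ≥0∞) * {y : ℚ_[p] | ‖t‖₊ < ‖y‖₊}.indicator
          (fun y => (rowKernel ‖t‖₊ (β a) y : ℝ≥0∞)) y +
        (if RowCongr ρ ρ₀ s x then (rowWeight key β s x : ℝ≥0∞) else 0) *
          {y : ℚ_[p] | ‖y‖₊ ≤ ‖t‖₊ ∧ ‖y - c‖₊ < ‖t‖₊}.indicator
          (fun y => (rowKernel ‖t‖₊ (β a) y : ℝ≥0∞)) y) ∂padicHaar p := by
        refine lintegral_mono fun y => ?_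
        dsimp only
        split_ifs with h1 h2 h2
        · by_cases hy : ‖t‖₊ < ‖y‖₊
          · rw [Set.indicator_of_mem (s := {y : ℚ_[p] | ‖t‖₊ < ‖y‖₊}) hy, htM]
            exact le_self_add
          · have hy' := not_lt.mp hy
            rw [htM] at hy'
            rw [Set.indicator_of_mem (s := {y : ℚ_[p] | ‖y‖₊ ≤ ‖t‖₊ ∧ ‖y - c‖₊ < ‖t‖₊})
              ⟨not_lt.mp hy, by rw [htM]; exact (hc y (hup y) hy' h1).2⟩, htM]
            exact le_add_self
        · by_cases hy : ‖t‖₊ < ‖y‖₊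
          · rw [Set.indicator_of_mem (s := {y : ℚ_[p] | ‖t‖₊ < ‖y‖₊}) hy, htM]
            exact le_self_add
          · have hy' := not_lt.mp hy
            rw [htM] at hy'
            exact absurd (hc y (hup y) hy' h1).1 h2
        · exact zero_le
        · exact zero_le
    _ ≤ _ := by
        rw [lintegral_add_left (hm1.const_mul _), lintegral_const_mul _ hm1,
          lintegral_const_mul _ hm2]
        refine add_le_add ?_ ?_
        · rw [mul_comm]; gcongr; exact lintegral_rowKernel_tail ht hβ
        · rw [mul_comm]; gcongr; exact lintegral_rowKernel_ball ht _ c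

theorem lmarginal_rowWeight_le [DecidableEq ι] {key : ι → ℕ} (hkey : Function.Injective key)
    {β : ι → ℝ} (hβ : ∀ a, 1 ≤ β a) (s : Finset ι) (x : ι → ℚ_[p]) :
    (∫⋯∫⁻_s, (fun x => (rowWeight key β s x : ℝ≥0∞)) ∂fun _ => padicHaar p) x ≤ 3 ^ s.card := by
  induction s using Finset.induction_on_max_value key generalizing x with
  | empty => simp [rowWeight]
  | insert a s ha hs ih =>
    rw [lmarginal_insert' (fun x => (rowWeight key β (insert a s) x : ℝ≥0∞))
      (measurable_rowWeight _ _ _).coe_nnreal_ennreal ha, Finset.card_insert_of_notMem ha]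
    refine (lmarginal_mono (fun x => lintegral_rowWeight_insert hkey ha hs (hβ a) x) x).trans ?_
    have h := ih x
    rw [lmarginal] at h ⊢
    rw [lintegral_const_mul, pow_succ']
    · gcongr
    · exact (measurable_rowWeight _ _ _).coe_nnreal_ennreal.comp measurable_updateFinset

-- The coordinate with the largest key is integrated first. If it exceeds the running maximum, the
-- factor $p^{-\beta_a}$ already suffices, since no coordinate comes later and so $\beta_a\ge k$.
-- Otherwise it lies in a ball that contributes $p^{-1}$, and the remaining coordinates owe only
-- $k-1$. Removing the coordinate lowers both $k$ and the number of later coordinates by one, so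
-- `hkβ` is inherited.
open Classical in
theorem lmarginal_rowCongr_le [Countable ι] {key : ι → ℕ} (hkey : Function.Injective key)
    {β : ι → ℝ} (hβ : ∀ a, 1 ≤ β a) (ρ : ι → ℚ_[p]) (ρ₀ : ℚ_[p]) (s : Finset ι)
    (k : ℕ) (hk : k ≤ s.card)
    (hkβ : ∀ a ∈ s, (k : ℝ) ≤ β a + (s.filter fun c => key a < key c).card) (x : ι → ℚ_[p]) :
    (∫⋯∫⁻_s, (fun x => if RowCongr ρ ρ₀ s x then (rowWeight key β s x : ℝ≥0∞) else 0)
      ∂fun _ => padicHaar p) x ≤ 3 ^ s.card * ((p : ℝ≥0∞)⁻¹) ^ k := by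
  have hmeas : ∀ s : Finset ι, Measurable fun x : ι → ℚ_[p] =>
      if RowCongr ρ ρ₀ s x then (rowWeight key β s x : ℝ≥0∞) else 0 := fun s =>
    Measurable.ite (measurableSet_rowCongr ρ ρ₀ s)
      (measurable_rowWeight _ _ _).coe_nnreal_ennreal measurable_const
  have hp2 := prime_two_le_real p
  have hp1 : (1 : ℝ≥0) ≤ p := le_trans (by norm_num) hp2
  have hp0 : (0 : ℝ≥0) < p := lt_of_lt_of_le one_pos hp1
  induction s using Finset.induction_on_max_value key generalizing x k with
  | empty =>
    obtain rfl : k = 0 := by simpa using hk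
    simp only [lmarginal_empty, rowWeight, Finset.prod_empty]
    split_ifs <;> simp
  | insert a s ha hs ih =>
    -- For $k=0$ no saving is required and the congruence can be dropped.
    rcases k with _ | k
    · rw [pow_zero, mul_one]
      refine le_trans (lmarginal_mono (fun x => ?_) x) (lmarginal_rowWeight_le hkey hβ _ x)
      dsimp only
      split_ifs
      · exact le_rfl
      · exact zero_le
    · have hlt : ∀ c ∈ s, key c < key a := fun c hc =>
        lt_of_le_of_ne (hs c hc) fun h => ha (hkey h ▸ hc)
      rw [Finset.card_insert_of_notMem ha] at hk ⊢
      have hih := ih k (by omega) (fun c hc => by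
        have := hkβ c (Finset.mem_insert_of_mem hc)
        rw [Finset.filter_insert, if_pos (hlt c hc), Finset.card_insert_of_notMem
          (fun h => ha (Finset.mem_of_mem_filter _ h))] at this
        push_cast at this
        linarith) x
      have hka : ((k + 1 : ℕ) : ℝ) ≤ β a := by
        have := hkβ a (Finset.mem_insert_self a s)
        rw [Finset.filter_insert, if_neg (lt_irrefl _), Finset.filter_false_of_mem
          (fun c hc => not_lt.mpr (hs c hc))] at this
        simpa using this
      have hpk : (((p : ℝ≥0) ^ (-β a) : ℝ≥0) : ℝ≥0∞) ≤ ((p : ℝ≥0∞)⁻¹) ^ (k + 1) := by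
        have : (p : ℝ≥0) ^ (-β a) ≤ ((p : ℝ≥0)⁻¹) ^ (k + 1) := by
          rw [inv_pow, ← NNReal.rpow_natCast, ← NNReal.rpow_neg]
          exact NNReal.rpow_le_rpow_of_exponent_le hp1 (by linarith)
        refine (ENNReal.coe_le_coe.mpr this).trans (le_of_eq ?_)
        rw [ENNReal.coe_pow, ENNReal.coe_inv hp0.ne']
        simp
      have hW := lmarginal_rowWeight_le (p := p) hkey hβ s x
      rw [lmarginal_insert' _ (hmeas (insert a s)) ha]
      refine (lmarginal_mono
        (fun x => lintegral_rowCongr_insert hkey ha hs (hβ a) ρ ρ₀ x) x).trans ?_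
      rw [lmarginal] at hih hW ⊢
      rw [lintegral_add_left, lintegral_const_mul, lintegral_const_mul]
      -- The constants $2$ of the tail and $1$ of the ball add up to the new factor $3$.
      · calc _ ≤ 2 * ((p : ℝ≥0∞)⁻¹) ^ (k + 1) * 3 ^ s.card +
            (p : ℝ≥0∞)⁻¹ * (3 ^ s.card * ((p : ℝ≥0∞)⁻¹) ^ k) := by gcongr
          _ = _ := by ring
      · exact (hmeas s).comp measurable_updateFinset
      · exact (measurable_rowWeight _ _ _).coe_nnreal_ennreal.comp measurable_updateFinset
      · exact ((measurable_rowWeight _ _ _).coe_nnreal_ennreal.comp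
          measurable_updateFinset).const_mul _

open Classical in
/-- The saving in the integral over a row. -/
theorem lintegral_rowCongr_le [Fintype ι] {key : ι → ℕ} (hkey : Function.Injective key)
    {β : ι → ℝ} (hβ : ∀ a, 1 ≤ β a) (ρ : ι → ℚ_[p]) (ρ₀ : ℚ_[p]) (k : ℕ)
    (hk : k ≤ Fintype.card ι)
    (hkβ : ∀ a, (k : ℝ) ≤ β a + (Finset.univ.filter fun c => key a < key c).card) :
    ∫⁻ x, (if RowCongr ρ ρ₀ Finset.univ x then (rowWeight key β Finset.univ x : ℝ≥0∞) else 0)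
      ∂Measure.pi (fun _ => padicHaar p) ≤ 3 ^ Fintype.card ι * ((p : ℝ≥0∞)⁻¹) ^ k := by
  rw [lintegral_eq_lmarginal_univ 0]
  exact lmarginal_rowCongr_le hkey hβ ρ ρ₀ Finset.univ k hk (fun a _ => hkβ a) 0

end RowIntegral

/-! ### Iwahori invariance and the absolute value of the basis vector -/

section Iwasawa

variable {p : ℕ} [Fact p.Prime] {n : ℕ}

/-- Matrices with `p`-integral entries. -/
def HasIntegralEntries (k : Matrix (Fin n) (Fin n) ℚ_[p]) : Prop := ∀ i j, ‖k i j‖ ≤ 1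

/-- Matrices with `p`-integral entries that are upper triangular modulo `p`. -/
def HasIwahoriEntries (k : Matrix (Fin n) (Fin n) ℚ_[p]) : Prop :=
  (∀ i j, ‖k i j‖ ≤ 1) ∧ ∀ i j, j < i → ‖k i j‖ < 1

/-- Membership in the maximal compact subgroup, for matrices. -/
def IsMaxCompactMatrix (k : Matrix (Fin n) (Fin n) ℚ_[p]) : Prop :=
  HasIntegralEntries k ∧ ∃ k', HasIntegralEntries k' ∧ k * k' = 1

/-- Membership in the Iwahori subgroup, for matrices. -/
def IsIwahoriMatrix (k : Matrix (Fin n) (Fin n) ℚ_[p]) : Prop :=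
  HasIwahoriEntries k ∧ ∃ k', HasIwahoriEntries k' ∧ k * k' = 1

theorem norm_sum_le_of_forall_le {ι : Type*} (s : Finset ι) (f : ι → ℚ_[p]) {r : ℝ} (hr : 0 ≤ r)
    (h : ∀ i ∈ s, ‖f i‖ ≤ r) : ‖∑ i ∈ s, f i‖ ≤ r :=
  IsUltrametricDist.norm_sum_le_of_forall_le_of_nonneg hr h

theorem norm_sum_lt_of_forall_lt {ι : Type*} (s : Finset ι) (f : ι → ℚ_[p]) {r : ℝ} (hr : 0 < r)
    (h : ∀ i ∈ s, ‖f i‖ < r) : ‖∑ i ∈ s, f i‖ < r := by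
  classical
  induction s using Finset.induction_on with
  | empty => simpa
  | insert a s ha ih =>
    rw [Finset.sum_insert ha]
    exact (Padic.nonarchimedean _ _).trans_lt (max_lt (h a (Finset.mem_insert_self a s))
      (ih fun i hi => h i (Finset.mem_insert_of_mem hi)))

theorem HasIntegralEntries.mul {k m : Matrix (Fin n) (Fin n) ℚ_[p]} (hk : HasIntegralEntries k)
    (hm : HasIntegralEntries m) : HasIntegralEntries (k * m) := fun i j => by
  rw [Matrix.mul_apply]
  refine norm_sum_le_of_forall_le _ _ zero_le_one fun a _ => ?_
  rw [norm_mul]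
  exact mul_le_one₀ (hk i a) (norm_nonneg _) (hm a j)

theorem HasIwahoriEntries.mul {k m : Matrix (Fin n) (Fin n) ℚ_[p]} (hk : HasIwahoriEntries k)
    (hm : HasIwahoriEntries m) : HasIwahoriEntries (k * m) := by
  refine ⟨HasIntegralEntries.mul hk.1 hm.1, fun i j hij => ?_⟩
  rw [Matrix.mul_apply]
  refine norm_sum_lt_of_forall_lt _ _ zero_lt_one fun a _ => ?_
  rw [norm_mul]
  rcases lt_or_ge a i with ha | ha
  · exact mul_lt_one_of_nonneg_of_lt_one_left (norm_nonneg _) (hk.2 i a ha) (hm.1 a j)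
  · exact mul_lt_one_of_nonneg_of_lt_one_right (hk.1 i a) (norm_nonneg _)
      (hm.2 a j (hij.trans_le ha))

theorem IsMaxCompactMatrix.mul {k m : Matrix (Fin n) (Fin n) ℚ_[p]} (hk : IsMaxCompactMatrix k)
    (hm : IsMaxCompactMatrix m) : IsMaxCompactMatrix (k * m) := by
  obtain ⟨hk, k', hk', hkk⟩ := hk
  obtain ⟨hm, m', hm', hmm⟩ := hm
  refine ⟨hk.mul hm, m' * k', hm'.mul hk', ?_⟩
  rw [mul_assoc, ← mul_assoc m, hmm, one_mul, hkk]

theorem IsIwahoriMatrix.mul {k m : Matrix (Fin n) (Fin n) ℚ_[p]} (hk : IsIwahoriMatrix k)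
    (hm : IsIwahoriMatrix m) : IsIwahoriMatrix (k * m) := by
  obtain ⟨hk, k', hk', hkk⟩ := hk
  obtain ⟨hm, m', hm', hmm⟩ := hm
  refine ⟨hk.mul hm, m' * k', hm'.mul hk', ?_⟩
  rw [mul_assoc, ← mul_assoc m, hmm, one_mul, hkk]

theorem norm_eq_one_of_mul_add {a b c : ℚ_[p]} (ha : ‖a‖ ≤ 1) (hb : ‖b‖ ≤ 1) (hc : ‖c‖ < 1)
    (h : a * b + c = 1) : ‖a‖ = 1 := by
  have h1 : ‖a * b‖ = 1 := by
    have : a * b = 1 + -c := by rw [← h]; ring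
    rw [this, Padic.add_eq_max_of_ne, norm_one, norm_neg, max_eq_left hc.le]
    rw [norm_one, norm_neg]; exact hc.ne'
  rw [norm_mul] at h1
  refine le_antisymm ha ?_
  rw [← h1]
  exact mul_le_of_le_one_right (norm_nonneg _) hb

/-- Modulo $p$ both $k$ and its inverse are upper triangular, so their diagonal entries multiply to
$1$. -/
theorem IsIwahoriMatrix.norm_diag {k : Matrix (Fin n) (Fin n) ℚ_[p]} (hk : IsIwahoriMatrix k)
    (i : Fin n) : ‖k i i‖ = 1 := by
  obtain ⟨hk, k', hk', hkk⟩ := hk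
  have h := congrFun (congrFun hkk i) i
  rw [Matrix.mul_apply, Matrix.one_apply_eq, ← Finset.add_sum_erase _ _ (Finset.mem_univ i)] at h
  refine norm_eq_one_of_mul_add (hk.1 i i) (hk'.1 i i) ?_ h
  refine norm_sum_lt_of_forall_lt _ _ zero_lt_one fun a ha => ?_
  rw [norm_mul]
  rcases lt_or_gt_of_ne (Finset.ne_of_mem_erase ha) with ha | ha
  · exact mul_lt_one_of_nonneg_of_lt_one_left (norm_nonneg _) (hk.2 i a ha) (hk'.1 a i)
  · exact mul_lt_one_of_nonneg_of_lt_one_right (hk.1 i a) (norm_nonneg _) (hk'.2 a i ha)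

/-- The absolute value of the function `g ↦ [χ δ^{1/2}](t)`, for `g = t u k` with `k` in the Iwahori
subgroup, where `|[χ δ^{1/2}](t)| = ∏ |t_i|^{λ_i}`. -/
noncomputable def absVector (e : Fin n → ℝ) (g : Matrix (Fin n) (Fin n) ℚ_[p]) : ℝ≥0∞ :=
  ⨆ (b : Matrix (Fin n) (Fin n) ℚ_[p]) (k : Matrix (Fin n) (Fin n) ℚ_[p])
    (_ : b.IsUpperTriangular ∧ (∀ i, b i i ≠ 0) ∧ IsIwahoriMatrix k ∧ g = b * k),
    ((∏ i, ‖b i i‖₊ ^ e i : ℝ≥0) : ℝ≥0∞)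

/-- Being a supremum over all decompositions, `absVector` is $0$ where there is none, and an upper
bound is checked on each decomposition separately. Independence of the decomposition is never
needed. -/
theorem absVector_le {e : Fin n → ℝ} {g : Matrix (Fin n) (Fin n) ℚ_[p]} {X : ℝ≥0∞}
    (h : ∀ b k : Matrix (Fin n) (Fin n) ℚ_[p], b.IsUpperTriangular → (∀ i, b i i ≠ 0) →
      IsIwahoriMatrix k → g = b * k → ((∏ i, ‖b i i‖₊ ^ e i : ℝ≥0) : ℝ≥0∞) ≤ X) :
    absVector e g ≤ X :=
  iSup_le fun b => iSup_le fun k => iSup_le fun hbk => h b k hbk.1 hbk.2.1 hbk.2.2.1 hbk.2.2.2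

theorem le_absVector (e : Fin n → ℝ) {b k : Matrix (Fin n) (Fin n) ℚ_[p]}
    (hb : b.IsUpperTriangular) (hb0 : ∀ i, b i i ≠ 0) (hk : IsIwahoriMatrix k) :
    ((∏ i, ‖b i i‖₊ ^ e i : ℝ≥0) : ℝ≥0∞) ≤ absVector e (b * k) :=
  le_iSup_of_le b (le_iSup_of_le k (le_iSup_of_le ⟨hb, hb0, hk, rfl⟩ le_rfl))

theorem absVector_le_mul_right (e : Fin n → ℝ) (g : Matrix (Fin n) (Fin n) ℚ_[p])
    {m : Matrix (Fin n) (Fin n) ℚ_[p]} (hm : IsIwahoriMatrix m) :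
    absVector e g ≤ absVector e (g * m) :=
  absVector_le fun b k hb hb0 hk hg => by
    rw [hg, mul_assoc]
    exact le_absVector e hb hb0 (hk.mul hm)

theorem isUpperTriangular_mul_diag {a b : Matrix (Fin n) (Fin n) ℚ_[p]} (ha : a.IsUpperTriangular)
    (hb : b.IsUpperTriangular) (i : Fin n) : (a * b) i i = a i i * b i i := by
  rw [Matrix.mul_apply, Finset.sum_eq_single i]
  · intro j _ hj
    rcases lt_or_gt_of_ne hj with hj | hj
    · rw [ha hj, zero_mul]
    · rw [hb hj, mul_zero]
  · simp

/-- If $cg=bk$, then $g=(c^{-1}b)k$, and diagonal entries of upper triangular matrices multiply. -/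
theorem absVector_mul_left (e : Fin n → ℝ) {c c' : Matrix (Fin n) (Fin n) ℚ_[p]}
    (hc : c.IsUpperTriangular) (hc' : c'.IsUpperTriangular) (hcc : c' * c = 1)
    (g : Matrix (Fin n) (Fin n) ℚ_[p]) :
    absVector e (c * g) ≤ ((∏ i, ‖c i i‖₊ ^ e i : ℝ≥0) : ℝ≥0∞) * absVector e g := by
  refine absVector_le fun b k hb hb0 hk hg => ?_
  have hd : ∀ i, c' i i * c i i = 1 := fun i => by
    rw [← isUpperTriangular_mul_diag hc' hc, hcc, Matrix.one_apply_eq]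
  have hg' : g = (c' * b) * k := by rw [mul_assoc, ← hg, ← mul_assoc, hcc, one_mul]
  have hprod : (∏ i, ‖b i i‖₊ ^ e i : ℝ≥0) =
      (∏ i, ‖c i i‖₊ ^ e i) * ∏ i, ‖(c' * b) i i‖₊ ^ e i := by
    rw [← Finset.prod_mul_distrib]
    refine Finset.prod_congr rfl fun i _ => ?_
    rw [← NNReal.mul_rpow, ← nnnorm_mul, isUpperTriangular_mul_diag hc' hb, ← mul_assoc,
      mul_comm (c i i), hd, one_mul]
  rw [hprod, ENNReal.coe_mul]
  gcongr
  rw [hg']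
  refine le_absVector e (Matrix.BlockTriangular.mul hc' hb) (fun i => ?_) hk
  rw [isUpperTriangular_mul_diag hc' hb]
  exact mul_ne_zero (left_ne_zero_of_mul_eq_one (hd i)) (hb0 i)

theorem eventually_hasIwahoriEntries {X : Type*} [TopologicalSpace X] {x₀ : X}
    {m : X → Matrix (Fin n) (Fin n) ℚ_[p]} (hm : ContinuousAt m x₀) (h1 : m x₀ = 1) :
    ∀ᶠ x in 𝓝 x₀, HasIwahoriEntries (m x) := by
  have h : ∀ i j, ∀ᶠ x in 𝓝 x₀, ‖m x i j - (1 : Matrix (Fin n) (Fin n) ℚ_[p]) i j‖ < 1 := by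
    intro i j
    have hij : Continuous fun M : Matrix (Fin n) (Fin n) ℚ_[p] => M i j :=
      continuous_id.matrix_elem i j
    have hc : ContinuousAt (fun x => m x i j) x₀ := hij.continuousAt.comp hm
    have := hc.tendsto.eventually (Metric.ball_mem_nhds _ one_pos)
    simpa [h1, dist_eq_norm] using this
  filter_upwards [Filter.eventually_all.mpr fun i => Filter.eventually_all.mpr (h i)] with x hx
  refine ⟨fun i j => ?_, fun i j hij => ?_⟩
  · rw [← sub_add_cancel (m x i j) ((1 : Matrix (Fin n) (Fin n) ℚ_[p]) i j)]
    refine (Padic.nonarchimedean _ _).trans (max_le (hx i j).le ?_)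
    rw [Matrix.one_apply]; split_ifs <;> simp
  · simpa [Matrix.one_apply_ne hij.ne'] using hx i j

/-- Functions that are invariant under the Iwahori subgroup are locally constant along continuous
families of matrices. -/
theorem isLocallyConstant_of_iwahori_invariant {X Y : Type*} [TopologicalSpace X]
    {F : Matrix (Fin n) (Fin n) ℚ_[p] → Y} {v v' : X → Matrix (Fin n) (Fin n) ℚ_[p]}
    (hF : ∀ x m, IsIwahoriMatrix m → F (v x * m) = F (v x))
    (hv : Continuous v) (hv' : Continuous v') (hvv : ∀ x, v x * v' x = 1) :
    IsLocallyConstant fun x => F (v x) := by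
  rw [IsLocallyConstant.iff_eventually_eq]
  intro x₀
  have hvv' : ∀ x, v' x * v x = 1 := fun x => mul_eq_one_comm.mp (hvv x)
  -- Near $x_0$ both $v(x_0)^{-1}v(x)$ and its inverse are close to $1$, hence in the Iwahori
  -- subgroup.
  have h1 : ContinuousAt (fun x => v' x₀ * v x) x₀ := by fun_prop
  have h2 : ContinuousAt (fun x => v' x * v x₀) x₀ := by fun_prop
  filter_upwards [eventually_hasIwahoriEntries h1 (hvv' x₀),
    eventually_hasIwahoriEntries h2 (hvv' x₀)] with x hx hx'
  have hm : IsIwahoriMatrix (v' x₀ * v x) := by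
    refine ⟨hx, _, hx', ?_⟩
    rw [mul_assoc, ← mul_assoc (v x), hvv, one_mul, hvv']
  rw [← hF x₀ _ hm, ← mul_assoc, hvv, one_mul]

theorem IsIwahoriMatrix.inv {k : Matrix (Fin n) (Fin n) ℚ_[p]} (hk : IsIwahoriMatrix k) :
    ∃ k', IsIwahoriMatrix k' ∧ k * k' = 1 := by
  obtain ⟨hk, k', hk', hkk⟩ := hk
  exact ⟨k', ⟨hk', k, hk, mul_eq_one_comm.mp hkk⟩, hkk⟩

theorem absVector_mul_right (e : Fin n → ℝ) (g : Matrix (Fin n) (Fin n) ℚ_[p])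
    {m : Matrix (Fin n) (Fin n) ℚ_[p]} (hm : IsIwahoriMatrix m) :
    absVector e (g * m) = absVector e g := by
  refine le_antisymm ?_ (absVector_le_mul_right e g hm)
  obtain ⟨m', hm', hmm⟩ := hm.inv
  refine (absVector_le_mul_right e (g * m) hm').trans (le_of_eq ?_)
  rw [mul_assoc, hmm, mul_one]

end Iwasawa

/-! ### Schur complements and the removal of the last row -/

section Schur

variable {p : ℕ} [Fact p.Prime] {n : ℕ}

/-- The block matrix with the blocks `a`, `c`, `r`, `d`. -/
def bordered (a : Matrix (Fin n) (Fin n) ℚ_[p]) (c r : Fin n → ℚ_[p]) (d : ℚ_[p]) :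
    Matrix (Fin (n + 1)) (Fin (n + 1)) ℚ_[p] :=
  Matrix.of (Fin.snoc (α := fun _ => Fin (n + 1) → ℚ_[p])
    (fun i => Fin.snoc (α := fun _ => ℚ_[p]) (a i) (c i)) (Fin.snoc (α := fun _ => ℚ_[p]) r d))

@[simp] theorem bordered_castSucc_castSucc (a : Matrix (Fin n) (Fin n) ℚ_[p]) (c r : Fin n → ℚ_[p])
    (d : ℚ_[p]) (i j : Fin n) : bordered a c r d i.castSucc j.castSucc = a i j := by
  simp [bordered]

@[simp] theorem bordered_castSucc_last (a : Matrix (Fin n) (Fin n) ℚ_[p]) (c r : Fin n → ℚ_[p])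
    (d : ℚ_[p]) (i : Fin n) : bordered a c r d i.castSucc (Fin.last n) = c i := by
  simp [bordered]

@[simp] theorem bordered_last_castSucc (a : Matrix (Fin n) (Fin n) ℚ_[p]) (c r : Fin n → ℚ_[p])
    (d : ℚ_[p]) (j : Fin n) : bordered a c r d (Fin.last n) j.castSucc = r j := by
  simp [bordered]

@[simp] theorem bordered_last_last (a : Matrix (Fin n) (Fin n) ℚ_[p]) (c r : Fin n → ℚ_[p])
    (d : ℚ_[p]) : bordered a c r d (Fin.last n) (Fin.last n) = d := by
  simp [bordered]

theorem bordered_mul (a a' : Matrix (Fin n) (Fin n) ℚ_[p]) (c c' r r' : Fin n → ℚ_[p])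
    (d d' : ℚ_[p]) : bordered a c r d * bordered a' c' r' d' =
      bordered (a * a' + Matrix.vecMulVec c r') (a.mulVec c' + d' • c) (a'.vecMul r + d • r')
        (r ⬝ᵥ c' + d * d') := by
  ext i j
  refine Fin.lastCases ?_ (fun i => ?_) i <;> refine Fin.lastCases ?_ (fun j => ?_) j <;>
    simp [Matrix.mul_apply, Fin.sum_univ_castSucc, Matrix.vecMulVec_apply, Matrix.mulVec,
      Matrix.vecMul, dotProduct, mul_comm]

/-- The Schur complement of the last diagonal entry. -/
noncomputable def schur (k : Matrix (Fin (n + 1)) (Fin (n + 1)) ℚ_[p]) :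
    Matrix (Fin n) (Fin n) ℚ_[p] :=
  Matrix.of fun i j => k i.castSucc j.castSucc -
    k i.castSucc (Fin.last n) * k (Fin.last n) j.castSucc / k (Fin.last n) (Fin.last n)

/-- Block inversion: the upper left corner of the inverse is the inverse of the Schur complement.
Integrality of the inverse thus passes to the Schur complement. -/
theorem schur_mul {k k' : Matrix (Fin (n + 1)) (Fin (n + 1)) ℚ_[p]} (hk : k * k' = 1)
    (h0 : k (Fin.last n) (Fin.last n) ≠ 0) :
    schur k * k'.submatrix Fin.castSucc Fin.castSucc = 1 := by
  ext i j
  have h1 := congrFun (congrFun hk i.castSucc) j.castSucc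
  have h2 := congrFun (congrFun hk (Fin.last n)) j.castSucc
  rw [Matrix.mul_apply, Fin.sum_univ_castSucc] at h1 h2
  rw [Matrix.one_apply_ne (Fin.castSucc_lt_last j).ne'] at h2
  have h3 : (1 : Matrix (Fin (n + 1)) (Fin (n + 1)) ℚ_[p]) i.castSucc j.castSucc =
      (1 : Matrix (Fin n) (Fin n) ℚ_[p]) i j := by simp [Matrix.one_apply]
  rw [h3] at h1
  rw [Matrix.mul_apply, ← h1]
  simp only [schur, Matrix.of_apply, Matrix.submatrix_apply, sub_mul, Finset.sum_sub_distrib]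
  have h4 : ∑ x : Fin n, k i.castSucc (Fin.last n) * k (Fin.last n) x.castSucc /
      k (Fin.last n) (Fin.last n) * k' x.castSucc j.castSucc =
      k i.castSucc (Fin.last n) / k (Fin.last n) (Fin.last n) *
        ∑ x : Fin n, k (Fin.last n) x.castSucc * k' x.castSucc j.castSucc := by
    rw [Finset.mul_sum]
    refine Finset.sum_congr rfl fun x _ => by ring
  rw [h4, eq_neg_of_add_eq_zero_left h2]
  field_simp
  ring

theorem IsMaxCompactMatrix.schur {k : Matrix (Fin (n + 1)) (Fin (n + 1)) ℚ_[p]}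
    (hk : IsMaxCompactMatrix k) (h1 : ‖k (Fin.last n) (Fin.last n)‖ = 1) :
    IsMaxCompactMatrix (IwahoriGL.schur k) := by
  obtain ⟨hk, k', hk', hkk⟩ := hk
  refine ⟨fun i j => ?_, _, fun i j => hk' _ _, schur_mul hkk (by rintro h; simp [h] at h1)⟩
  rw [IwahoriGL.schur, Matrix.of_apply, sub_eq_add_neg]
  refine (Padic.nonarchimedean _ _).trans (max_le (hk _ _) ?_)
  rw [norm_neg, norm_div, h1, div_one, norm_mul]
  exact mul_le_one₀ (hk _ _) (norm_nonneg _) (hk _ _)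

theorem IsIwahoriMatrix.schur {k : Matrix (Fin (n + 1)) (Fin (n + 1)) ℚ_[p]}
    (hk : IsIwahoriMatrix k) : IsIwahoriMatrix (IwahoriGL.schur k) := by
  have h1 := hk.norm_diag (Fin.last n)
  obtain ⟨hk, k', hk', hkk⟩ := hk
  refine ⟨⟨fun i j => ?_, fun i j hij => ?_⟩, _, ⟨fun i j => hk'.1 _ _, fun i j hij =>
    hk'.2 _ _ (Fin.castSucc_lt_castSucc_iff.mpr hij)⟩,
    schur_mul hkk (by rintro h; simp [h] at h1)⟩
  · rw [IwahoriGL.schur, Matrix.of_apply, sub_eq_add_neg]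
    refine (Padic.nonarchimedean _ _).trans (max_le (hk.1 _ _) ?_)
    rw [norm_neg, norm_div, h1, div_one, norm_mul]
    exact mul_le_one₀ (hk.1 _ _) (norm_nonneg _) (hk.1 _ _)
  · rw [IwahoriGL.schur, Matrix.of_apply, sub_eq_add_neg]
    refine (Padic.nonarchimedean _ _).trans_lt
      (max_lt (hk.2 _ _ (Fin.castSucc_lt_castSucc_iff.mpr hij)) ?_)
    rw [norm_neg, norm_div, h1, div_one, norm_mul]
    exact mul_lt_one_of_nonneg_of_lt_one_right (hk.1 _ _) (norm_nonneg _)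
      (hk.2 _ _ (Fin.castSucc_lt_last j))

/-- A row that vanishes modulo $p$ cannot pair to $1$ with an integral column. -/
theorem IsMaxCompactMatrix.exists_norm_row {k : Matrix (Fin n) (Fin n) ℚ_[p]}
    (hk : IsMaxCompactMatrix k) (i : Fin n) : ∃ j, 1 ≤ ‖k i j‖ := by
  obtain ⟨hk, k', hk', hkk⟩ := hk
  by_contra! h
  have h1 := congrFun (congrFun hkk i) i
  rw [Matrix.mul_apply, Matrix.one_apply_eq] at h1
  have : ‖∑ j, k i j * k' j i‖ < 1 := norm_sum_lt_of_forall_lt _ _ one_pos fun j _ => by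
    rw [norm_mul]
    exact mul_lt_one_of_nonneg_of_lt_one_left (norm_nonneg _) (h j) (hk' j i)
  rw [h1, norm_one] at this
  exact lt_irrefl _ this

/-- The Schur complement arises by subtracting from column $j$ the last column times the ratio of
the last-row entries. By `hrow` these ratios agree for $m$ and $k$, so the same column operation is
applied to both sides of `h`. -/
theorem mul_schur_eq {P b₁ : Matrix (Fin n) (Fin n) ℚ_[p]} {y : Fin n → ℚ_[p]} {t : ℚ_[p]}
    {b k m : Matrix (Fin (n + 1)) (Fin (n + 1)) ℚ_[p]}
    (hb₁ : ∀ i j, b₁ i j = b i.castSucc j.castSucc)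
    (h : bordered P y 0 t * m = b * k)
    (hm0 : m (Fin.last n) (Fin.last n) ≠ 0) (hk0 : k (Fin.last n) (Fin.last n) ≠ 0)
    (hrow : ∀ j : Fin n, m (Fin.last n) j.castSucc / m (Fin.last n) (Fin.last n) =
      k (Fin.last n) j.castSucc / k (Fin.last n) (Fin.last n)) :
    P * schur m = b₁ * schur k := by
  ext i j
  have h1 := congrFun (congrFun h i.castSucc) j.castSucc
  have h2 := congrFun (congrFun h i.castSucc) (Fin.last n)
  simp only [Matrix.mul_apply, Fin.sum_univ_castSucc, bordered_castSucc_castSucc,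
    bordered_castSucc_last] at h1 h2
  have hs : ∀ (A : Fin n → ℚ_[p]) (m : Matrix (Fin (n + 1)) (Fin (n + 1)) ℚ_[p]),
      ∑ x, A x * schur m x j = ∑ x, A x * m x.castSucc j.castSucc -
        (∑ x, A x * m x.castSucc (Fin.last n)) *
          (m (Fin.last n) j.castSucc / m (Fin.last n) (Fin.last n)) := by
    intro A m
    rw [Finset.sum_mul, ← Finset.sum_sub_distrib]
    refine Finset.sum_congr rfl fun x _ => ?_
    rw [schur, Matrix.of_apply]; ring
  rw [Matrix.mul_apply, Matrix.mul_apply, hs, hs, hrow, eq_sub_of_add_eq h1, eq_sub_of_add_eq h2]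
  have h3 : m (Fin.last n) j.castSucc = m (Fin.last n) (Fin.last n) *
      (k (Fin.last n) j.castSucc / k (Fin.last n) (Fin.last n)) := by
    rw [← hrow]; field_simp
  simp only [hb₁]
  rw [h3]
  field_simp
  ring

open Classical in
/-- The reduction from `n + 1` to `n` along the last row. -/
theorem absVector_bordered_le (e : Fin (n + 1) → ℝ) (P : Matrix (Fin n) (Fin n) ℚ_[p])
    (y : Fin n → ℚ_[p]) {t : ℚ_[p]} (ht : t ≠ 0)
    {m : Matrix (Fin (n + 1)) (Fin (n + 1)) ℚ_[p]} (hm : IsMaxCompactMatrix m) :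
    absVector e (bordered P y 0 t * m) ≤
      if (∀ j : Fin n, ‖m (Fin.last n) j.castSucc‖ < 1) ∧ ‖m (Fin.last n) (Fin.last n)‖ = 1
      then ((‖t‖₊ ^ e (Fin.last n) : ℝ≥0) : ℝ≥0∞) *
        absVector (fun i => e i.castSucc) (P * schur m) else 0 := by
  refine absVector_le fun b k hb hb0 hk h => ?_
  have hrow : ∀ j, t * m (Fin.last n) j = b (Fin.last n) (Fin.last n) * k (Fin.last n) j := by
    intro j
    have h1 := congrFun (congrFun h (Fin.last n)) j
    simp only [Matrix.mul_apply, Fin.sum_univ_castSucc, bordered_last_castSucc,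
      bordered_last_last] at h1
    have h2 : ∀ x : Fin n, b (Fin.last n) x.castSucc = 0 := fun x => hb (Fin.castSucc_lt_last x)
    simpa [h2] using h1
  set β := b (Fin.last n) (Fin.last n) with hβ
  have hkll := hk.norm_diag (Fin.last n)
  have ht0 : 0 < ‖t‖ := norm_pos_iff.mpr ht
  have hn : ∀ j, ‖t‖ * ‖m (Fin.last n) j‖ = ‖β‖ * ‖k (Fin.last n) j‖ := fun j => by
    rw [← norm_mul, ← norm_mul, hrow]
  -- The last rows of $m$ and $k$ are proportional and both are primitive, so $|\beta|=|t|$. The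
  -- last row of $m$ then inherits the shape $(0,\dots,0,\text{unit})$ modulo $p$ from that of $k$.
  have hle : ‖β‖ ≤ ‖t‖ := by
    have := hn (Fin.last n)
    rw [hkll, mul_one] at this
    rw [← this]
    exact mul_le_of_le_one_right ht0.le (hm.1 _ _)
  have hge : ‖t‖ ≤ ‖β‖ := by
    obtain ⟨j, hj⟩ := hm.exists_norm_row (Fin.last n)
    calc ‖t‖ ≤ ‖t‖ * ‖m (Fin.last n) j‖ := le_mul_of_one_le_right ht0.le hj
      _ = ‖β‖ * ‖k (Fin.last n) j‖ := hn j
      _ ≤ ‖β‖ := mul_le_of_le_one_right (norm_nonneg _) (hk.1.1 _ _)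
  have hβt : ‖β‖ = ‖t‖ := le_antisymm hle hge
  have hmk : ∀ j, ‖m (Fin.last n) j‖ = ‖k (Fin.last n) j‖ := fun j => by
    have := hn j
    rw [hβt] at this
    exact mul_left_cancel₀ ht0.ne' this
  rw [if_pos ⟨fun j => by rw [hmk]; exact hk.1.2 _ _ (Fin.castSucc_lt_last j),
    by rw [hmk, hkll]⟩]
  have hm0 : m (Fin.last n) (Fin.last n) ≠ 0 := by
    rw [← norm_ne_zero_iff, hmk, hkll]; exact one_ne_zero
  have hk0 : k (Fin.last n) (Fin.last n) ≠ 0 := by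
    rw [← norm_ne_zero_iff, hkll]; exact one_ne_zero
  have hP : P * schur m = b.submatrix Fin.castSucc Fin.castSucc * schur k := by
    refine mul_schur_eq (fun _ _ => rfl) h hm0 hk0 fun j => ?_
    rw [div_eq_div_iff hm0 hk0]
    have h1 := hrow j.castSucc
    have h2 := hrow (Fin.last n)
    have hβ0 : β ≠ 0 := hb0 _
    refine mul_left_cancel₀ (mul_ne_zero ht hβ0) ?_
    linear_combination (β * k (Fin.last n) (Fin.last n)) * h1 -
      (β * k (Fin.last n) j.castSucc) * h2
  rw [hP, Fin.prod_univ_castSucc, mul_comm, ENNReal.coe_mul]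
  refine mul_le_mul' (le_of_eq ?_) ?_
  · congr 2
    ext
    exact hβt
  · exact le_absVector (b := b.submatrix Fin.castSucc Fin.castSucc) (fun i => e i.castSucc)
      (fun i j hij => hb (Fin.castSucc_lt_castSucc_iff.mpr hij)) (fun i => hb0 _) hk.schur

end Schur

/-! ### Explicit Iwasawa decomposition of a row -/

section RowReduction

variable {p : ℕ} [Fact p.Prime] {n : ℕ}

theorem isMaxCompactMatrix_of_det {k : Matrix (Fin n) (Fin n) ℚ_[p]} (hk : HasIntegralEntries k)
    (hdet : ‖k.det‖ = 1) : IsMaxCompactMatrix k := by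
  let m : Matrix (Fin n) (Fin n) ℤ_[p] := Matrix.of fun i j => ⟨k i j, hk i j⟩
  have hmk : PadicInt.Coe.ringHom.mapMatrix m = k := by ext i j; rfl
  have hm : IsUnit m.det := by
    rw [PadicInt.isUnit_iff, PadicInt.norm_def]
    rw [← hmk, ← RingHom.map_det] at hdet
    exact hdet
  refine ⟨hk, PadicInt.Coe.ringHom.mapMatrix m⁻¹, fun i j => (m⁻¹ i j).norm_le_one, ?_⟩
  rw [← hmk, ← map_mul, Matrix.mul_nonsing_inv _ hm, map_one]

theorem det_of_triangular_key {ι R : Type*} [Fintype ι] [DecidableEq ι] [CommRing R]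
    {key : ι → ℕ} (hkey : Function.Injective key) {M : Matrix ι ι R}
    (h : ∀ a b, key b < key a → M a b = 0) : M.det = ∏ a, M a a := by
  let _ : LinearOrder ι := LinearOrder.lift' key hkey
  have hM : M.IsUpperTriangular := fun a b hab => h a b hab
  convert Matrix.det_of_isUpperTriangular hM

theorem det_bordered_zero_row (a : Matrix (Fin n) (Fin n) ℚ_[p]) (c : Fin n → ℚ_[p])
    (d : ℚ_[p]) : (bordered a c 0 d).det = a.det * d := by
  rw [Matrix.det_succ_row _ (Fin.last n), Fin.sum_univ_castSucc]
  have h : (bordered a c 0 d).submatrix (Fin.last n).succAbove (Fin.last n).succAbove = a := by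
    ext i j; simp
  rw [h]
  simp [← two_mul, mul_comm]

theorem det_bordered_zero_col (a : Matrix (Fin n) (Fin n) ℚ_[p]) (r : Fin n → ℚ_[p])
    (d : ℚ_[p]) : (bordered a 0 r d).det = a.det * d := by
  rw [Matrix.det_succ_column _ (Fin.last n), Fin.sum_univ_castSucc]
  have h : (bordered a 0 r d).submatrix (Fin.last n).succAbove (Fin.last n).succAbove = a := by
    ext i j; simp
  rw [h]
  simp [← two_mul, mul_comm]

/-- The factor by which the coordinate `a` increases the norm of the vector. -/
noncomputable def jump {ι : Type*} [Fintype ι] (key : ι → ℕ) (x : ι → ℚ_[p]) (a : ι) : ℝ≥0 :=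
  max (maxNorm (Finset.univ.filter fun c => key c < key a) x) ‖x a‖₊ /
    maxNorm (Finset.univ.filter fun c => key c < key a) x

theorem jump_pos {ι : Type*} [Fintype ι] (key : ι → ℕ) (x : ι → ℚ_[p]) (a : ι) :
    0 < jump key x a :=
  div_pos (lt_max_of_lt_left (maxNorm_pos _ _)) (maxNorm_pos _ _)

theorem jump_of_eq_zero {ι : Type*} [Fintype ι] (key : ι → ℕ) {x : ι → ℚ_[p]} {a : ι}
    (h : x a = 0) : jump key x a = 1 := by
  rw [jump, h, nnnorm_zero, max_eq_left (maxNorm_pos _ _).le, div_self (maxNorm_pos _ _).ne']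

/-- The product telescopes along the order of the keys; `hs` makes $s$ an initial segment. -/
theorem prod_jump {ι : Type*} [Fintype ι] {key : ι → ℕ} (hkey : Function.Injective key)
    (x : ι → ℚ_[p]) (s : Finset ι) (hs : ∀ a ∈ s, ∀ c, key c < key a → c ∈ s) :
    ∏ a ∈ s, jump key x a = maxNorm s x := by
  classical
  induction s using Finset.induction_on_max_value key with
  | empty => simp [maxNorm]
  | insert a s ha hmax ih =>
    have hlt : ∀ c ∈ s, key c < key a := fun c hc =>
      lt_of_le_of_ne (hmax c hc) fun h => ha (hkey h ▸ hc)
    have hsf : (Finset.univ.filter fun c => key c < key a) = s := by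
      ext c
      simp only [Finset.mem_filter, Finset.mem_univ, true_and]
      refine ⟨fun hc => ?_, hlt c⟩
      rcases Finset.mem_insert.mp (hs a (Finset.mem_insert_self a s) c hc) with rfl | h
      · exact absurd hc (lt_irrefl _)
      · exact h
    have h := ih fun b hb c hc => by
      rcases Finset.mem_insert.mp (hs b (Finset.mem_insert_of_mem hb) c hc) with rfl | h
      · exact absurd (hlt b hb) hc.not_gt
      · exact h
    rw [Finset.prod_insert ha, h, jump, hsf, maxNorm_insert, div_mul_cancel₀ _ (maxNorm_pos _ _).ne']

/-- Triangular reduction of the last row to a primitive row, by an explicit Iwasawa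
decomposition. -/
theorem exists_row_reduction {key : Fin n → ℕ} (hkey : Function.Injective key)
    (x : Fin n → ℚ_[p]) :
    ∃ (H : Matrix (Fin n) (Fin n) ℚ_[p]) (c : Fin n → ℚ_[p]) (t : ℚ_[p]),
      t ≠ 0 ∧ ‖t‖₊ = maxNorm Finset.univ x ∧
      (∀ a j, H a j ≠ 0 → a = j ∨ (key a < key j ∧ x a ≠ 0 ∧ x j ≠ 0)) ∧
      (∀ a, ‖H a a‖₊ = jump key x a) ∧
      IsMaxCompactMatrix (bordered (H + Matrix.vecMulVec c x) c (t⁻¹ • x) t⁻¹) := by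
  obtain ⟨t, ht0, ht⟩ := exists_nnnorm_eq_maxNorm Finset.univ x
  choose q hq0 hq using fun a : Fin n =>
    exists_nnnorm_eq_maxNorm (Finset.univ.filter fun c => key c < key a) x
  -- Where $x_a$ exceeds the running maximum $|q_a|$, row $a$ of $H+cx$ has the entries
  -- $q_a^{-1}x_j$ at smaller keys and $0$ from the key of $a$ on; elsewhere it is a row of the
  -- identity. In both cases it is integral, since $|x_j|\le|q_a|$ at smaller keys.
  let H : Matrix (Fin n) (Fin n) ℚ_[p] := Matrix.of fun a j =>
    if ‖q a‖₊ < ‖x a‖₊ then (if key a ≤ key j then -((q a)⁻¹ * x j) else 0)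
    else if a = j then 1 else 0
  let c : Fin n → ℚ_[p] := fun a => if ‖q a‖₊ < ‖x a‖₊ then (q a)⁻¹ else 0
  have hH : ∀ a j, H a j ≠ 0 → a = j ∨ (key a < key j ∧ x a ≠ 0 ∧ x j ≠ 0) := by
    intro a j h
    by_cases haj : a = j
    · exact Or.inl haj
    simp only [H, Matrix.of_apply] at h
    split_ifs at h with h1 h2
    · refine Or.inr ⟨lt_of_le_of_ne h2 fun h => haj (hkey h), ?_, ?_⟩
      · intro h0; simp [h0] at h1
      · intro h0; simp [h0] at h
    · exact absurd rfl h
    · exact absurd rfl h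
  have hHd : ∀ a, ‖H a a‖₊ = jump key x a := by
    intro a
    simp only [H, Matrix.of_apply, if_pos le_rfl, if_true, jump, ← hq]
    have h0 : ‖q a‖₊ ≠ 0 := by simpa using hq0 a
    split_ifs with h1
    · rw [nnnorm_neg, nnnorm_mul, nnnorm_inv, max_eq_right h1.le, div_eq_inv_mul]
    · rw [nnnorm_one, max_eq_left (not_lt.mp h1), div_self h0]
  have hq1 : ∀ a, ‖(q a)⁻¹‖ ≤ 1 := fun a => by
    rw [norm_inv]
    have : (1 : ℝ≥0) ≤ ‖q a‖₊ := hq a ▸ one_le_maxNorm _ _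
    exact inv_le_one_of_one_le₀ (by exact_mod_cast this)
  have ht1 : 1 ≤ ‖t‖ := by
    have : (1 : ℝ≥0) ≤ ‖t‖₊ := ht ▸ one_le_maxNorm _ _
    exact_mod_cast this
  refine ⟨H, c, t, ht0, ht, hH, hHd, isMaxCompactMatrix_of_det ?_ ?_⟩
  · intro i j
    refine Fin.lastCases ?_ (fun i => ?_) i <;> refine Fin.lastCases ?_ (fun j => ?_) j
    · rw [bordered_last_last, norm_inv]; exact inv_le_one_of_one_le₀ ht1
    · rw [bordered_last_castSucc, Pi.smul_apply, smul_eq_mul, norm_mul, norm_inv,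
        inv_mul_le_one₀ (by linarith)]
      have : ‖x j‖₊ ≤ ‖t‖₊ := ht ▸ nnnorm_le_maxNorm x (Finset.mem_univ j)
      exact_mod_cast this
    · rw [bordered_castSucc_last]
      simp only [c]
      split_ifs
      · exact hq1 i
      · simp
    · rw [bordered_castSucc_castSucc]
      simp only [Matrix.add_apply, Matrix.vecMulVec_apply, H, c, Matrix.of_apply]
      split_ifs with h1 h2 h2
      · simp
      · rw [zero_add, norm_mul, norm_inv]
        have hqp : 0 < ‖q i‖ := norm_pos_iff.mpr (hq0 i)
        rw [inv_mul_le_one₀ hqp]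
        have : ‖x j‖₊ ≤ ‖q i‖₊ := hq i ▸ nnnorm_le_maxNorm x
          (Finset.mem_filter.mpr ⟨Finset.mem_univ j, not_le.mp h2⟩)
        exact_mod_cast this
      · simp
      · simp
  -- The determinant is $t^{-1}\det H$, and $|\det H|$ is the product of the jumps, which telescopes
  -- to $|t|$.
  · have hfac : bordered (H + Matrix.vecMulVec c x) c (t⁻¹ • x) t⁻¹ =
        bordered H c 0 t⁻¹ * bordered 1 0 x 1 := by
      rw [bordered_mul]; simp
    have hdet : H.det = ∏ a, H a a := det_of_triangular_key hkey fun a b hab => by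
      by_contra h
      rcases hH a b h with rfl | h'
      · exact lt_irrefl _ hab
      · exact hab.not_gt h'.1
    have hprod : ‖H.det‖₊ = ‖t‖₊ := by
      rw [hdet, nnnorm_prod, ht, ← prod_jump hkey x Finset.univ fun _ _ c _ => Finset.mem_univ c]
      exact Finset.prod_congr rfl fun a _ => hHd a
    rw [hfac, Matrix.det_mul, det_bordered_zero_row, det_bordered_zero_col, Matrix.det_one,
      mul_one, mul_one, norm_mul, norm_inv, ← coe_nnnorm, hprod, coe_nnnorm,
      mul_inv_cancel₀ (norm_ne_zero_iff.mpr ht0)]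

/-- A vector that is close to a multiple of `(ρ, ρ₀)` satisfies the congruence. -/
theorem rowCongr_of_close {ι : Type*} {ρ : ι → ℚ_[p]} {ρ₀ c : ℚ_[p]} {s : Finset ι}
    {x : ι → ℚ_[p]} (hρ : ∀ i ∈ s, ‖ρ i‖ ≤ 1) (hρ₀ : ‖ρ₀‖ ≤ 1) (hc : ‖c‖₊ = maxNorm s x)
    (hx : ∀ i ∈ s, ‖x i - c * ρ i‖₊ < maxNorm s x) (hx₀ : ‖1 - c * ρ₀‖₊ < maxNorm s x) :
    RowCongr ρ ρ₀ s x := by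
  have hcM : ‖c‖ = maxNorm s x := by rw [← hc]; rfl
  have hM : (0 : ℝ) < maxNorm s x := maxNorm_pos s x
  have key : ∀ u v r r' : ℚ_[p], ‖r‖ ≤ 1 → ‖r'‖ ≤ 1 → ‖u - c * r‖₊ < maxNorm s x →
      ‖v - c * r'‖₊ < maxNorm s x → ‖u * r' - v * r‖₊ < maxNorm s x := by
    intro u v r r' hr hr' hu hv
    have : u * r' - v * r = (u - c * r) * r' + -((v - c * r') * r) := by ring
    have hu' : ‖u - c * r‖ < maxNorm s x := hu
    have hv' : ‖v - c * r'‖ < maxNorm s x := hv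
    rw [← NNReal.coe_lt_coe, coe_nnnorm, this]
    refine (Padic.nonarchimedean _ _).trans_lt (max_lt ?_ ?_)
    · rw [norm_mul]
      exact (mul_le_of_le_one_right (norm_nonneg _) hr').trans_lt hu'
    · rw [norm_neg, norm_mul]
      exact (mul_le_of_le_one_right (norm_nonneg _) hr).trans_lt hv'
  have key2 : ∀ u r : ℚ_[p], ‖r‖ ≤ 1 → ‖u - c * r‖₊ < maxNorm s x → ‖u‖₊ = maxNorm s x →
      ‖r‖₊ = 1 := by
    intro u r hr hu huM
    have hu' : ‖u - c * r‖ < maxNorm s x := hu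
    have huM' : ‖u‖ = maxNorm s x := by rw [← huM]; rfl
    have h1 : ‖c * r‖ = maxNorm s x := by
      have : c * r = u + -(u - c * r) := by ring
      rw [this, Padic.add_eq_max_of_ne, norm_neg, huM', max_eq_left hu'.le]
      rw [norm_neg, huM']; exact hu'.ne'
    rw [norm_mul, hcM] at h1
    ext
    exact mul_left_cancel₀ hM.ne' (h1.trans (mul_one _).symm)
  exact ⟨fun i hi j hj => key _ _ _ _ (hρ i hi) (hρ j hj) (hx i hi) (hx j hj),
    fun i hi => by simpa using key _ _ _ _ (hρ i hi) hρ₀ (hx i hi) hx₀,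
    fun i hi h => key2 _ _ (hρ i hi) (hx i hi) h,
    fun h => key2 1 ρ₀ hρ₀ hx₀ (by rw [h, nnnorm_one])⟩

end RowReduction

/-! ### Block unipotent matrices in coordinates -/

section BlockUnipotent

variable {p : ℕ} [Fact p.Prime] {n : ℕ}

/-- The positions below the block diagonal, for the blocks given by the fibres of `bl`. -/
abbrev LowerPos (bl : Fin n → ℕ) : Type := {a : Fin n × Fin n // bl a.2 < bl a.1}

/-- The block unipotent matrix with the entries `z` below the block diagonal. -/
noncomputable def lowerMatrix (bl : Fin n → ℕ) (z : LowerPos bl → ℚ_[p]) :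
    Matrix (Fin n) (Fin n) ℚ_[p] :=
  Matrix.of fun i j => if h : bl j < bl i then z ⟨(i, j), h⟩ else if i = j then 1 else 0

theorem lowerMatrix_of_lt {bl : Fin n → ℕ} (z : LowerPos bl → ℚ_[p]) {i j : Fin n}
    (h : bl j < bl i) : lowerMatrix bl z i j = z ⟨(i, j), h⟩ := by
  simp [lowerMatrix, h]

theorem lowerMatrix_of_not_lt {bl : Fin n → ℕ} (z : LowerPos bl → ℚ_[p]) {i j : Fin n}
    (h : ¬ bl j < bl i) :
    lowerMatrix bl z i j = (1 : Matrix (Fin n) (Fin n) ℚ_[p]) i j := by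
  simp [lowerMatrix, h, Matrix.one_apply]

theorem continuous_lowerMatrix (bl : Fin n → ℕ) :
    Continuous (lowerMatrix (p := p) bl) := by
  refine continuous_matrix fun i j => ?_
  by_cases h : bl j < bl i
  · simp only [lowerMatrix_of_lt _ h]; fun_prop
  · simp only [lowerMatrix_of_not_lt _ h]; fun_prop

theorem det_lowerMatrix {bl : Fin n → ℕ} (hbl : Monotone bl) (z : LowerPos bl → ℚ_[p]) :
    (lowerMatrix bl z).det = 1 := by
  have h : (lowerMatrix bl z).IsLowerTriangular := fun i j hij => by
    have hij' : i < j := hij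
    rw [lowerMatrix_of_not_lt z (not_lt.mpr (hbl hij'.le)), Matrix.one_apply_ne hij'.ne]
  rw [Matrix.det_of_isLowerTriangular _ h]
  exact Finset.prod_eq_one fun i _ => by rw [lowerMatrix_of_not_lt z (lt_irrefl _), Matrix.one_apply_eq]

theorem lowerMatrix_mul_adjugate {bl : Fin n → ℕ} (hbl : Monotone bl) (z : LowerPos bl → ℚ_[p]) :
    lowerMatrix bl z * (lowerMatrix bl z).adjugate = 1 := by
  rw [Matrix.mul_adjugate, det_lowerMatrix hbl, one_smul]

/-- Invariance under the Iwahori subgroup makes the function locally constant, so no formula for it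
is needed. -/
theorem measurable_absVector_lowerMatrix {bl : Fin n → ℕ} (hbl : Monotone bl) (e : Fin n → ℝ)
    {k : Matrix (Fin n) (Fin n) ℚ_[p]} (hk : IsMaxCompactMatrix k) :
    Measurable fun z : LowerPos bl → ℚ_[p] => absVector e (lowerMatrix bl z * k) := by
  obtain ⟨-, k', -, hkk⟩ := hk
  have hv := continuous_lowerMatrix (p := p) bl
  refine (isLocallyConstant_of_iwahori_invariant (F := absVector e)
    (v := fun z => lowerMatrix bl z * k) (v' := fun z => k' * (lowerMatrix bl z).adjugate)
    (fun x m hm => absVector_mul_right e _ hm) (hv.mul continuous_const)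
    (continuous_const.mul hv.matrix_adjugate) fun z => ?_).continuous.measurable
  rw [mul_assoc, ← mul_assoc k, hkk, one_mul, lowerMatrix_mul_adjugate hbl]

end BlockUnipotent

/-! ### The substitution on block unipotent matrices -/

section BlockChange

variable {p : ℕ} [Fact p.Prime] {n : ℕ}

/-- The key order makes $H$ block lower triangular with upper triangular diagonal blocks. $D$
consists of these diagonal blocks and $G=D^{-1}$. Thus $v\mapsto GvH$ preserves block unipotent
matrices, while $G$ is upper triangular and can be pulled out of `absVector` on the left. -/
theorem exists_block_inverse {bl key : Fin n → ℕ} (hbl : Monotone bl)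
    (hkl : ∀ a c, key a < key c ↔ bl c < bl a ∨ (bl c = bl a ∧ a < c))
    {H : Matrix (Fin n) (Fin n) ℚ_[p]} (hH : ∀ a j, H a j ≠ 0 → a = j ∨ key a < key j)
    (hd : ∀ a, H a a ≠ 0) :
    ∃ G D : Matrix (Fin n) (Fin n) ℚ_[p], D * G = 1 ∧ G.IsUpperTriangular ∧
      D.IsUpperTriangular ∧ (∀ a, G a a = (H a a)⁻¹) ∧
      (∀ a c, G a c ≠ 0 → bl a = bl c ∧ a ≤ c) ∧
      ∀ a b, bl a = bl b → (G * H) a b = (1 : Matrix (Fin n) (Fin n) ℚ_[p]) a b := by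
  let D : Matrix (Fin n) (Fin n) ℚ_[p] := Matrix.of fun a b => if bl a = bl b then H a b else 0
  have hD0 : ∀ a b, D a b ≠ 0 → bl a = bl b ∧ (a = b ∨ (key a < key b ∧ a < b)) := by
    intro a b h
    simp only [D, Matrix.of_apply] at h
    split_ifs at h with hab
    · refine ⟨hab, (hH a b h).imp id fun hk => ⟨hk, ?_⟩⟩
      rcases (hkl a b).mp hk with h1 | h1
      · exact absurd h1 (by omega)
      · exact h1.2
    · exact absurd rfl h
  have hDu : D.IsUpperTriangular := fun a b hab => by
    by_contra h
    have hab' : b < a := hab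
    rcases (hD0 a b h).2 with h1 | h1
    · exact absurd h1 hab'.ne'
    · exact absurd h1.2 hab'.not_gt
  have hDk : D.BlockTriangular key := fun a b hab => by
    by_contra h
    rcases (hD0 a b h).2 with h1 | h1
    · exact absurd hab (by rw [h1]; exact lt_irrefl _)
    · exact absurd h1.1 hab.not_gt
  have hDd : ∀ a, D a a = H a a := fun a => by simp [D]
  have hdet : IsUnit D.det := by
    rw [Matrix.det_of_isUpperTriangular hDu, isUnit_iff_ne_zero, Finset.prod_ne_zero_iff]
    exact fun a _ => by rw [hDd]; exact hd a
  let _ := D.invertibleOfIsUnitDet hdet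
  have hGu : (D⁻¹).IsUpperTriangular := Matrix.blockTriangular_inv_of_blockTriangular hDu
  have hGk : (D⁻¹).BlockTriangular key := Matrix.blockTriangular_inv_of_blockTriangular hDk
  have hGb : ∀ a c, D⁻¹ a c ≠ 0 → bl a = bl c ∧ a ≤ c := by
    intro a c h
    have h1 : a ≤ c := by
      by_contra h'
      exact h (hGu (not_le.mp h'))
    have h2 : ¬ key c < key a := fun h' => h (hGk h')
    rw [hkl] at h2
    push Not at h2
    exact ⟨le_antisymm (hbl h1) h2.1, h1⟩
  refine ⟨D⁻¹, D, Matrix.mul_nonsing_inv _ hdet, hGu, hDu, fun a => ?_, hGb, fun a b hab => ?_⟩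
  · have h := isUpperTriangular_mul_diag hGu hDu a
    rw [Matrix.nonsing_inv_mul _ hdet, Matrix.one_apply_eq, hDd] at h
    exact eq_inv_of_mul_eq_one_left h.symm
  · rw [← Matrix.nonsing_inv_mul _ hdet, Matrix.mul_apply, Matrix.mul_apply]
    refine Finset.sum_congr rfl fun c _ => ?_
    by_cases h : D⁻¹ a c = 0
    · rw [h, zero_mul, zero_mul]
    · have : bl c = bl b := (hGb a c h).1.symm.trans hab
      simp [D, this]

/-- The change of variables `v ↦ G v H` on block unipotent matrices. -/
theorem lintegral_lowerMatrix_change {bl key : Fin n → ℕ}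
    (hkl : ∀ a c, key a < key c ↔ bl c < bl a ∨ (bl c = bl a ∧ a < c))
    {H G : Matrix (Fin n) (Fin n) ℚ_[p]} (hH : ∀ a j, H a j ≠ 0 → a = j ∨ key a < key j)
    (hHd : ∀ a, H a a ≠ 0) (hGd : ∀ a, G a a ≠ 0)
    (hGb : ∀ a c, G a c ≠ 0 → bl a = bl c ∧ a ≤ c)
    (hGH : ∀ a b, bl a = bl b → (G * H) a b = (1 : Matrix (Fin n) (Fin n) ℚ_[p]) a b)
    {F : Matrix (Fin n) (Fin n) ℚ_[p] → ℝ≥0∞}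
    (hF : Measurable fun z : LowerPos bl → ℚ_[p] => F (lowerMatrix bl z)) :
    ∫⁻ z, F (lowerMatrix bl z) ∂Measure.pi (fun _ => padicHaar p) =
      ((∏ a : LowerPos bl, ‖G a.1.1 a.1.1 * H a.1.2 a.1.2‖₊ : ℝ≥0) : ℝ≥0∞) *
        ∫⁻ z, F (G * lowerMatrix bl z * H) ∂Measure.pi (fun _ => padicHaar p) := by
  have hHbl : ∀ a j, H a j ≠ 0 → bl j ≤ bl a := by
    intro a j h
    rcases hH a j h with rfl | h'
    · exact le_rfl
    · rcases (hkl a j).mp h' with h1 | h1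
      · exact h1.le
      · exact h1.1.le
  have hkle : ∀ a j, H a j ≠ 0 → key a ≤ key j := fun a j h => by
    rcases hH a j h with rfl | h'
    · exact le_rfl
    · exact h'.le
  let c : LowerPos bl → ℚ_[p] := fun a => G a.1.1 a.1.1 * H a.1.2 a.1.2
  let f : LowerPos bl → (LowerPos bl → ℚ_[p]) → ℚ_[p] := fun a z =>
    (G * lowerMatrix bl z * H) a.1.1 a.1.2 - c a * z a
  -- The entry $(i,j)$ of $GvH$ involves only entries $v_{bd}$ with $b\ge i$ and $d=j$ or $d$ of
  -- smaller key than $j$. Apart from $(i,j)$ itself, all of these have smaller rank.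
  let rank : LowerPos bl → ℕ := fun a => (n - a.1.1) + key a.1.2
  have hc : ∀ a, c a ≠ 0 := fun a => mul_ne_zero (hGd _) (hHd _)
  have hcont := continuous_lowerMatrix (p := p) bl
  have hf : ∀ a, Measurable (f a) := by
    intro a
    refine Continuous.measurable ?_
    exact (((continuous_const.mul hcont).mul continuous_const).matrix_elem _ _).sub
      (continuous_const.mul (continuous_apply a))
  have hT : ∀ z, lowerMatrix bl (fun a => c a * z a + f a z) = G * lowerMatrix bl z * H := by
    intro z
    have hexp : ∀ i j, (G * lowerMatrix bl z * H) i j =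
        ∑ d, ∑ b, G i b * lowerMatrix bl z b d * H d j := fun i j => by
      rw [Matrix.mul_apply]
      exact Finset.sum_congr rfl fun d _ => by rw [Matrix.mul_apply, Finset.sum_mul]
    ext i j
    by_cases h : bl j < bl i
    · rw [lowerMatrix_of_lt _ h]; simp [f]
    · rw [lowerMatrix_of_not_lt _ h, hexp]
      have hsimp : ∀ d b, G i b * lowerMatrix bl z b d * H d j =
          G i b * (1 : Matrix (Fin n) (Fin n) ℚ_[p]) b d * H d j := by
        intro d b
        by_cases hG : G i b = 0
        · simp [hG]
        by_cases hHd : H d j = 0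
        · simp [hHd]
        rw [lowerMatrix_of_not_lt]
        have := hHbl d j hHd
        have := (hGb i b hG).1
        omega
      have hsum : ∑ d, ∑ b, G i b * lowerMatrix bl z b d * H d j = (G * H) i j := by
        simp_rw [hsimp, Matrix.one_apply]
        simp [Matrix.mul_apply]
      rw [hsum]
      symm
      rcases (not_lt.mp h).lt_or_eq with h1 | h1
      · rw [Matrix.one_apply_ne (by rintro rfl; exact lt_irrefl _ h1), Matrix.mul_apply]
        refine Finset.sum_eq_zero fun d _ => ?_
        by_contra h2
        have := hHbl d j (right_ne_zero_of_mul h2)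
        have := (hGb i d (left_ne_zero_of_mul h2)).1
        omega
      · exact hGH i j h1
  have hdep : ∀ a z z', (∀ b, rank b < rank a → z b = z' b) → f a z = f a z' := by
    intro a z z' hzz
    have hexp : ∀ z : LowerPos bl → ℚ_[p], (G * lowerMatrix bl z * H) a.1.1 a.1.2 =
        ∑ x : Fin n × Fin n, G a.1.1 x.1 * lowerMatrix bl z x.1 x.2 * H x.2 a.1.2 := fun z => by
      rw [Matrix.mul_apply, Fintype.sum_prod_type_right]
      exact Finset.sum_congr rfl fun d _ => by rw [Matrix.mul_apply, Finset.sum_mul]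
    have hlow : ∀ z : LowerPos bl → ℚ_[p], f a z = ∑ x ∈ Finset.univ.erase a.1,
        G a.1.1 x.1 * lowerMatrix bl z x.1 x.2 * H x.2 a.1.2 := fun z => by
      simp only [f, c]
      rw [hexp, ← Finset.add_sum_erase _ _ (Finset.mem_univ a.1), lowerMatrix_of_lt z a.2]
      simp only [Prod.mk.eta, Subtype.coe_eta]
      ring
    rw [hlow, hlow]
    refine Finset.sum_congr rfl fun x hx => ?_
    by_cases hG : G a.1.1 x.1 = 0
    · simp [hG]
    by_cases hHx : H x.2 a.1.2 = 0
    · simp [hHx]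
    by_cases hlt : bl x.2 < bl x.1
    · rw [lowerMatrix_of_lt z hlt, lowerMatrix_of_lt z' hlt]
      have hr : rank ⟨(x.1, x.2), hlt⟩ < rank a := by
        have h1 := (hGb _ _ hG).2
        have h1' : (a.1.1 : ℕ) ≤ x.1 := h1
        have h2 := x.1.isLt
        change (n - x.1) + key x.2 < (n - a.1.1) + key a.1.2
        rcases hH _ _ hHx with h3 | h3
        · have h4 : a.1.1 ≠ x.1 := fun h4 =>
            Finset.ne_of_mem_erase hx (Prod.ext h4.symm h3)
          have h5 : (a.1.1 : ℕ) ≠ x.1 := fun h => h4 (Fin.ext h)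
          rw [h3]
          omega
        · omega
      rw [hzz _ hr]
    · rw [lowerMatrix_of_not_lt z hlt, lowerMatrix_of_not_lt z' hlt]
  have h := lintegral_triangular rank hc hf hdep hF
  simp only [hT] at h
  rw [h, ← mul_assoc, ← ENNReal.coe_mul, mul_inv_cancel₀, ENNReal.coe_one, one_mul]
  exact Finset.prod_ne_zero_iff.mpr fun a _ => nnnorm_ne_zero_iff.mpr (hc a)

end BlockChange

/-! ### Bookkeeping of the exponents -/

section Weights

theorem NNReal.rpow_sum' {ι : Type*} {x : ℝ≥0} (hx : x ≠ 0) (s : Finset ι) (f : ι → ℝ) :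
    x ^ (∑ i ∈ s, f i) = ∏ i ∈ s, x ^ f i := by
  classical
  induction s using Finset.induction_on with
  | empty => simp
  | insert a s ha ih => rw [Finset.sum_insert ha, Finset.prod_insert ha, NNReal.rpow_add hx, ih]

variable {p : ℕ} [Fact p.Prime] {n : ℕ}

/-- The exponents of the jumps in the reduction of the last row. -/
theorem row_weight_identity {bl key : Fin n → ℕ} (hbl : Monotone bl)
    (hkl : ∀ a c, key a < key c ↔ bl c < bl a ∨ (bl c = bl a ∧ a < c)) {L : ℕ}
    {ζ : Fin n → ℝ≥0} (hζ : ∀ a, ζ a ≠ 0) (hζ1 : ∀ a, ¬ bl a < L → ζ a = 1)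
    (e : Fin n → ℝ) (e₀ : ℝ) :
    (∏ a, ζ a) ^ e₀ * (∏ a : LowerPos bl, (ζ a.1.1)⁻¹ * ζ a.1.2) * ∏ a, (ζ a)⁻¹ ^ e a =
      ∏ a : {a : Fin n // bl a < L}, (ζ a ^ (-(1 + (e a - e₀ - (n - a)))) *
        (∏ c ∈ Finset.univ.filter fun c => key c < key a, ζ c)⁻¹) := by
  have hprod : ∏ a : LowerPos bl, (ζ a.1.1)⁻¹ * ζ a.1.2 =
      ∏ a, ζ a ^ (∑ b, ((if bl a < bl b then (1 : ℝ) else 0) - if bl b < bl a then 1 else 0)) := by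
    have h1 : ∏ a : LowerPos bl, (ζ a.1.1)⁻¹ * ζ a.1.2 =
        ∏ x : Fin n × Fin n, if bl x.2 < bl x.1 then (ζ x.1)⁻¹ * ζ x.2 else 1 := by
      rw [← Finset.prod_filter]
      exact (Finset.prod_subtype (Finset.univ.filter fun x : Fin n × Fin n => bl x.2 < bl x.1)
        (fun x => by simp) fun x => (ζ x.1)⁻¹ * ζ x.2).symm
    have h2 : ∀ a b : Fin n, (if bl b < bl a then (ζ a)⁻¹ * ζ b else 1) =
        ζ a ^ (-(if bl b < bl a then (1 : ℝ) else 0)) * ζ b ^ (if bl b < bl a then (1 : ℝ) else 0) := by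
      intro a b
      split_ifs <;> simp [NNReal.rpow_neg_one]
    rw [h1, Fintype.prod_prod_type]
    simp only [h2, Finset.prod_mul_distrib]
    rw [Finset.prod_comm (f := fun a b => ζ b ^ (if bl b < bl a then (1 : ℝ) else 0)),
      ← Finset.prod_mul_distrib]
    refine Finset.prod_congr rfl fun a _ => ?_
    rw [← NNReal.rpow_sum' (hζ a), ← NNReal.rpow_sum' (hζ a), ← NNReal.rpow_add (hζ a),
      ← Finset.sum_add_distrib]
    congr 1
    exact Finset.sum_congr rfl fun b _ => by ring
  have hR : ∏ a : {a : Fin n // bl a < L}, (ζ a ^ (-(1 + (e a - e₀ - (n - a)))) *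
        (∏ c ∈ Finset.univ.filter fun c => key c < key a, ζ c)⁻¹) =
      ∏ a, ζ a ^ (-(1 + (e a - e₀ - (n - a))) - ∑ b, if key a < key b then (1 : ℝ) else 0) := by
    have h1 : ∀ a : Fin n, (∏ c ∈ Finset.univ.filter fun c => key c < key a, ζ c)⁻¹ =
        ∏ c, ζ c ^ (-(if key c < key a then (1 : ℝ) else 0)) := by
      intro a
      rw [Finset.prod_filter, ← Finset.prod_inv_distrib]
      refine Finset.prod_congr rfl fun c _ => ?_
      split_ifs <;> simp [NNReal.rpow_neg_one]
    have h2 : ∏ a : {a : Fin n // bl a < L}, (ζ a ^ (-(1 + (e a - e₀ - (n - a)))) *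
        (∏ c ∈ Finset.univ.filter fun c => key c < key a, ζ c)⁻¹) =
        ∏ a : Fin n, if bl a < L then (ζ a ^ (-(1 + (e a - e₀ - (n - a)))) *
        (∏ c ∈ Finset.univ.filter fun c => key c < key a, ζ c)⁻¹) else 1 := by
      rw [← Finset.prod_filter]
      exact (Finset.prod_subtype (Finset.univ.filter fun a : Fin n => bl a < L)
        (fun x => by simp) fun a => ζ a ^ (-(1 + (e a - e₀ - (n - a)))) *
          (∏ c ∈ Finset.univ.filter fun c => key c < key a, ζ c)⁻¹).symm
    have h3 : ∀ a : Fin n, (if bl a < L then (ζ a ^ (-(1 + (e a - e₀ - (n - a)))) *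
        (∏ c ∈ Finset.univ.filter fun c => key c < key a, ζ c)⁻¹) else 1) =
        ζ a ^ (-(1 + (e a - e₀ - (n - a)))) * ∏ c, ζ c ^ (-(if key c < key a then (1 : ℝ) else 0)) := by
      intro a
      split_ifs with h
      · rw [h1]
      -- An index of smaller key lies in the same or a later block, so its jump is $1$ as well.
      · rw [hζ1 a h, NNReal.one_rpow, one_mul]
        refine (Finset.prod_eq_one fun c _ => ?_).symm
        split_ifs with hc
        · rw [hζ1 c, NNReal.one_rpow]
          rcases (hkl c a).mp hc with h1 | h1 <;> omega
        · simp
    rw [h2, Finset.prod_congr rfl fun a _ => h3 a, Finset.prod_mul_distrib, Finset.prod_comm,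
      ← Finset.prod_mul_distrib]
    refine Finset.prod_congr rfl fun a _ => ?_
    rw [← NNReal.rpow_sum' (hζ a), ← NNReal.rpow_add (hζ a), Finset.sum_neg_distrib]
    congr 1
  rw [hprod, hR, ← NNReal.finsetProd_rpow, ← Finset.prod_mul_distrib, ← Finset.prod_mul_distrib]
  refine Finset.prod_congr rfl fun a _ => ?_
  rw [NNReal.inv_rpow, ← NNReal.rpow_neg, ← NNReal.rpow_add (hζ a), ← NNReal.rpow_add (hζ a)]
  congr 1
  -- Earlier blocks cancel between the Jacobian and the key order, later blocks count once, and
  -- inside the block of $a$ the key order counts the $b>a$. What remains is the number of all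
  -- $b>a$.
  have hcount : ∑ b : Fin n, (((if bl a < bl b then (1 : ℝ) else 0) - if bl b < bl a then 1 else 0) +
      if key a < key b then (1 : ℝ) else 0) = n - 1 - a := by
    have h1 : ∀ b : Fin n, (((if bl a < bl b then (1 : ℝ) else 0) - if bl b < bl a then 1 else 0) +
        if key a < key b then (1 : ℝ) else 0) = if a < b then 1 else 0 := by
      intro b
      have hk := hkl a b
      by_cases hab : a < b
      · have := hbl hab.le
        rcases this.lt_or_eq with h | h
        · have hk' : ¬ key a < key b := by rw [hk]; omega
          simp [h, hk', hab, h.not_gt]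
        · have hk' : key a < key b := hk.mpr (Or.inr ⟨h.symm, hab⟩)
          simp [h, hk', hab]
      · have := hbl (not_lt.mp hab)
        rcases this.lt_or_eq with h | h
        · have hk' : key a < key b := hk.mpr (Or.inl h)
          simp [h, hk', hab, h.not_gt]
        · have hk' : ¬ key a < key b := by
            rw [hk]; rintro (h' | h')
            · omega
            · exact hab h'.2
          simp [h, hk', hab]
    rw [Finset.sum_congr rfl fun b _ => h1 b, ← Finset.sum_filter, Finset.sum_const, nsmul_eq_mul,
      mul_one]
    have : (Finset.univ.filter fun b => a < b) = Finset.Ioi a := by ext; simp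
    rw [this, Fin.card_Ioi, Nat.sub_sub, Nat.cast_sub (by omega)]
    push_cast; ring
  rw [Finset.sum_add_distrib] at hcount
  linarith

end Weights

/-! ### The integral over the other rows for a fixed last row -/

section LastRow

variable {p : ℕ} [Fact p.Prime] {n : ℕ}

/-- Later blocks come first, and each block keeps its order. This gives $H$ its block triangular
shape and places all coordinates of earlier blocks after $a$, which the count of saved factors
needs. -/
theorem exists_block_key (bl : Fin n → ℕ) : ∃ key : Fin n → ℕ, Function.Injective key ∧
    ∀ a c, key a < key c ↔ bl c < bl a ∨ (bl c = bl a ∧ a < c) := by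
  set L := Finset.univ.sup bl with hL
  have hle : ∀ a, bl a ≤ L := fun a => Finset.le_sup (f := bl) (Finset.mem_univ a)
  have hlt : ∀ a c : Fin n, bl c < bl a →
      (L - bl a) * n + a < (L - bl c) * n + c := by
    intro a c h
    have h1 : L - bl a + 1 ≤ L - bl c := by have := hle a; omega
    have h2 := a.isLt
    have h3 : (L - bl a + 1) * n ≤ (L - bl c) * n := Nat.mul_le_mul_right _ h1
    rw [add_mul, one_mul] at h3
    omega
  have heq : ∀ a c : Fin n, bl c = bl a →
      ((L - bl a) * n + a < (L - bl c) * n + c ↔ a < c) := by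
    intro a c h
    rw [h, Nat.add_lt_add_iff_left]
    exact Fin.lt_def.symm
  have hkl : ∀ a c : Fin n, (L - bl a) * n + a < (L - bl c) * n + c ↔
      bl c < bl a ∨ (bl c = bl a ∧ a < c) := by
    intro a c
    rcases lt_trichotomy (bl c) (bl a) with h | h | h
    · exact ⟨fun _ => Or.inl h, fun _ => hlt a c h⟩
    · rw [heq a c h]
      exact ⟨fun h' => Or.inr ⟨h, h'⟩, fun h' => h'.elim (fun h' => absurd h h'.ne) And.right⟩
    · have := hlt c a h
      exact ⟨fun h' => by omega, fun h' => by omega⟩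
  refine ⟨fun a => (L - bl a) * n + a, fun a c h => ?_, hkl⟩
  have h' : (L - bl a) * n + (a : ℕ) = (L - bl c) * n + c := h
  have h1 := hkl a c
  have h2 := hkl c a
  rw [h'] at h1 h2
  simp only [lt_irrefl, false_iff, not_or, not_and, not_lt] at h1 h2
  have hb : bl c = bl a := le_antisymm h2.1 h1.1
  exact le_antisymm (h2.2 hb.symm) (h1.2 hb)

theorem continuous_bordered {X : Type*} [TopologicalSpace X]
    {v : X → Matrix (Fin n) (Fin n) ℚ_[p]} (hv : Continuous v) (c r : Fin n → ℚ_[p])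
    (d : ℚ_[p]) : Continuous fun x => bordered (v x) c r d := by
  refine continuous_matrix fun i j => ?_
  refine Fin.lastCases ?_ (fun i => ?_) i <;> refine Fin.lastCases ?_ (fun j => ?_) j
  · simpa using continuous_const
  · simpa using continuous_const
  · simpa using continuous_const
  · simpa using hv.matrix_elem i j

theorem measurable_absVector_bordered {bl : Fin n → ℕ} (hbl : Monotone bl) (e : Fin (n + 1) → ℝ)
    (x : Fin n → ℚ_[p]) {k : Matrix (Fin (n + 1)) (Fin (n + 1)) ℚ_[p]}
    (hk : IsMaxCompactMatrix k) :
    Measurable fun z : LowerPos bl → ℚ_[p] =>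
      absVector e (bordered (lowerMatrix bl z) 0 x 1 * k) := by
  obtain ⟨-, k', -, hkk⟩ := hk
  have hv := continuous_bordered (continuous_lowerMatrix (p := p) bl) 0 x 1
  refine (isLocallyConstant_of_iwahori_invariant (F := absVector e)
    (v := fun z => bordered (lowerMatrix bl z) 0 x 1 * k)
    (v' := fun z => k' * (bordered (lowerMatrix bl z) 0 x 1).adjugate)
    (fun x m hm => absVector_mul_right e _ hm) (hv.mul continuous_const)
    (continuous_const.mul hv.matrix_adjugate) fun z => ?_).continuous.measurable
  rw [mul_assoc, ← mul_assoc k, hkk, one_mul, Matrix.mul_adjugate, det_bordered_zero_col,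
    det_lowerMatrix hbl, one_mul, one_smul]

open Classical in
/-- The integral over the first rows, for a fixed last row. -/
theorem lintegral_bordered_le {bl key : Fin n → ℕ} (hbl : Monotone bl)
    (hkey : Function.Injective key)
    (hkl : ∀ a c, key a < key c ↔ bl c < bl a ∨ (bl c = bl a ∧ a < c))
    (e : Fin (n + 1) → ℝ) {S : ℝ≥0∞}
    (hS : ∀ k : Matrix (Fin n) (Fin n) ℚ_[p], IsMaxCompactMatrix k →
      ∫⁻ z, absVector (fun i => e i.castSucc) (lowerMatrix bl z * k)
        ∂Measure.pi (fun _ => padicHaar p) ≤ S)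
    {k k' : Matrix (Fin (n + 1)) (Fin (n + 1)) ℚ_[p]} (hk : IsMaxCompactMatrix k)
    (hk' : HasIntegralEntries k') (hkk : k * k' = 1) (x : Fin n → ℚ_[p]) :
    ∫⁻ z, absVector e (bordered (lowerMatrix bl z) 0 x 1 * k)
        ∂Measure.pi (fun _ => padicHaar p) ≤
      if RowCongr (fun i => k' (Fin.last n) i.castSucc) (k' (Fin.last n) (Fin.last n))
        Finset.univ x then
      (((∏ a, jump key x a) ^ e (Fin.last n) *
        (∏ a : LowerPos bl, (jump key x a.1.1)⁻¹ * jump key x a.1.2) *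
        ∏ a, (jump key x a)⁻¹ ^ e a.castSucc : ℝ≥0) : ℝ≥0∞) * S else 0 := by
  obtain ⟨H, c, t, ht0, htM, hH, hHd, hκ⟩ := exists_row_reduction hkey x
  have hH' : ∀ a j, H a j ≠ 0 → a = j ∨ key a < key j := fun a j h => (hH a j h).imp id And.left
  have hHd0 : ∀ a, H a a ≠ 0 := fun a => by
    rw [← nnnorm_ne_zero_iff, hHd]; exact (jump_pos key x a).ne'
  obtain ⟨G, D, hDG, hGu, hDu, hGd, hGb, hGH⟩ := exists_block_inverse hbl hkl hH' hHd0
  have hGn : ∀ a, ‖G a a‖₊ = (jump key x a)⁻¹ := fun a => by rw [hGd, nnnorm_inv, hHd]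
  set κ := bordered (H + Matrix.vecMulVec c x) c (t⁻¹ • x) t⁻¹ with hκdef
  have hm := hκ.mul hk
  rw [lintegral_lowerMatrix_change (F := fun M => absVector e (bordered M 0 x 1 * k)) hkl hH' hHd0
    (fun a => by rw [hGd]; exact inv_ne_zero (hHd0 a)) hGb hGH
    (measurable_absVector_bordered hbl e x hk)]
  -- The row $(x,1)$ is $t$ times the last row of $\kappa$, and the column $-t\,GMc$ removes the
  -- term $cx$ from $H+cx$.
  have hfac : ∀ M : Matrix (Fin n) (Fin n) ℚ_[p], bordered (G * M * H) 0 x 1 =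
      bordered (G * M) (-(t • (G * M).mulVec c)) 0 t * κ := by
    intro M
    rw [hκdef, bordered_mul]
    congr 1
    · rw [mul_add, Matrix.vecMulVec_smul, Matrix.neg_vecMulVec, Matrix.smul_vecMulVec,
        Matrix.mul_vecMulVec, smul_neg, smul_smul, inv_mul_cancel₀ ht0, one_smul,
        add_neg_cancel_right]
    · rw [smul_neg, smul_smul, inv_mul_cancel₀ ht0, one_smul, add_neg_cancel]
    · rw [Matrix.zero_vecMul, zero_add, smul_smul, mul_inv_cancel₀ ht0, one_smul]
    · rw [zero_dotProduct, zero_add, mul_inv_cancel₀ ht0]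
  have hpt : ∀ z : LowerPos bl → ℚ_[p],
      absVector e (bordered (G * lowerMatrix bl z * H) 0 x 1 * k) ≤
      if (∀ j : Fin n, ‖(κ * k) (Fin.last n) j.castSucc‖ < 1) ∧
          ‖(κ * k) (Fin.last n) (Fin.last n)‖ = 1
      then ((‖t‖₊ ^ e (Fin.last n) * ∏ i, ‖G i i‖₊ ^ e i.castSucc : ℝ≥0) : ℝ≥0∞) *
        absVector (fun i => e i.castSucc) (lowerMatrix bl z * schur (κ * k)) else 0 := by
    intro z
    rw [hfac, mul_assoc]
    refine (absVector_bordered_le e _ _ ht0 hm).trans ?_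
    split_ifs with h
    · rw [ENNReal.coe_mul, mul_assoc (_ : ℝ≥0∞), mul_assoc G]
      gcongr
      exact absVector_mul_left _ hGu hDu hDG _
    · exact le_rfl
  by_cases hcond : (∀ j : Fin n, ‖(κ * k) (Fin.last n) j.castSucc‖ < 1) ∧
      ‖(κ * k) (Fin.last n) (Fin.last n)‖ = 1
  swap
  · simp only [hcond, if_false] at hpt
    have h0 : ∀ z : LowerPos bl → ℚ_[p],
      absVector e (bordered (G * lowerMatrix bl z * H) 0 x 1 * k) = 0 := fun z =>
        le_antisymm (hpt z) zero_le
    simp only [h0, lintegral_zero, mul_zero]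
    exact zero_le
  -- Since $\kappa=(\kappa k)k'$ and the last row of $\kappa k$ is $(0,\dots,0,\text{unit})$ modulo
  -- $p$, the last row $t^{-1}(x,1)$ of $\kappa$ is modulo $p$ a unit multiple of the last row of
  -- $k'=k^{-1}$.
  · have hrow : ∀ i, κ (Fin.last n) i = ∑ j : Fin n, (κ * k) (Fin.last n) j.castSucc *
        k' j.castSucc i + (κ * k) (Fin.last n) (Fin.last n) * k' (Fin.last n) i := by
      intro i
      rw [← Fin.sum_univ_castSucc (f := fun j => (κ * k) (Fin.last n) j * k' j i),
        ← Matrix.mul_apply, mul_assoc, hkk, mul_one]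
    have hsmall : ∀ i, ‖κ (Fin.last n) i -
        (κ * k) (Fin.last n) (Fin.last n) * k' (Fin.last n) i‖ < 1 := by
      intro i
      rw [hrow, add_sub_cancel_right]
      refine norm_sum_lt_of_forall_lt _ _ one_pos fun j _ => ?_
      rw [norm_mul]
      exact mul_lt_one_of_nonneg_of_lt_one_left (norm_nonneg _) (hcond.1 j) (hk' _ _)
    have htn : 0 < ‖t‖ := norm_pos_iff.mpr ht0
    have hscale : ∀ i y, κ (Fin.last n) i = t⁻¹ * y →
        ‖y - t * (κ * k) (Fin.last n) (Fin.last n) * k' (Fin.last n) i‖₊ < ‖t‖₊ := by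
      intro i y h
      have h1 := hsmall i
      rw [h] at h1
      have h2 : y - t * (κ * k) (Fin.last n) (Fin.last n) * k' (Fin.last n) i =
          t * (t⁻¹ * y - (κ * k) (Fin.last n) (Fin.last n) * k' (Fin.last n) i) := by
        rw [mul_sub, mul_inv_cancel_left₀ ht0]; ring
      rw [← NNReal.coe_lt_coe, coe_nnnorm, coe_nnnorm, h2, norm_mul]
      exact mul_lt_of_lt_one_right htn h1
    have hcongr : RowCongr (fun i => k' (Fin.last n) i.castSucc) (k' (Fin.last n) (Fin.last n))
        Finset.univ x := by
      refine rowCongr_of_close (c := t * (κ * k) (Fin.last n) (Fin.last n))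
        (fun i _ => hk' _ _) (hk' _ _) ?_ (fun i _ => ?_) ?_
      · rw [nnnorm_mul, ← htM]
        have : ‖(κ * k) (Fin.last n) (Fin.last n)‖₊ = 1 := by ext; exact hcond.2
        rw [this, mul_one]
      · rw [← htM]
        exact hscale i.castSucc (x i) (by rw [hκdef, bordered_last_castSucc]; rfl)
      · rw [← htM]
        exact hscale (Fin.last n) 1 (by rw [hκdef, bordered_last_last, mul_one])
    have hll : (κ * k) (Fin.last n) (Fin.last n) ≠ 0 := by
      rw [← norm_ne_zero_iff, hcond.2]; exact one_ne_zero
    have hsch := hm.schur hcond.2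
    rw [if_pos hcongr]
    simp only [hcond] at hpt
    calc _ ≤ ((∏ a : LowerPos bl, ‖G a.1.1 a.1.1 * H a.1.2 a.1.2‖₊ : ℝ≥0) : ℝ≥0∞) *
          ∫⁻ z, ((‖t‖₊ ^ e (Fin.last n) * ∏ i, ‖G i i‖₊ ^ e i.castSucc : ℝ≥0) : ℝ≥0∞) *
            absVector (fun i => e i.castSucc) (lowerMatrix bl z * schur (κ * k))
            ∂Measure.pi (fun _ => padicHaar p) := by
          gcongr with z
          simpa using hpt z
      _ ≤ ((∏ a : LowerPos bl, ‖G a.1.1 a.1.1 * H a.1.2 a.1.2‖₊ : ℝ≥0) : ℝ≥0∞) *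
          (((‖t‖₊ ^ e (Fin.last n) * ∏ i, ‖G i i‖₊ ^ e i.castSucc : ℝ≥0) : ℝ≥0∞) * S) := by
          rw [lintegral_const_mul _ (measurable_absVector_lowerMatrix hbl _ hsch)]
          gcongr
          exact hS _ hsch
      _ = _ := by
          rw [← mul_assoc, ← ENNReal.coe_mul]
          congr 2
          simp only [nnnorm_mul, hGn, hHd]
          rw [prod_jump hkey x Finset.univ (fun _ _ _ _ => Finset.mem_univ _), ← htM]
          ring

end LastRow

/-! ### Rows supported on the earlier blocks -/

section RowExtension

variable {p : ℕ} [Fact p.Prime] {ι : Type*}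

open Classical in
/-- The extension by zero of a family that is indexed by a subtype. -/
noncomputable def extendZero {P : ι → Prop} (x : {a // P a} → ℚ_[p]) (a : ι) : ℚ_[p] :=
  if h : P a then x ⟨a, h⟩ else 0

theorem extendZero_of_mem {P : ι → Prop} (x : {a // P a} → ℚ_[p]) (a : {a // P a}) :
    extendZero x a.1 = x a := by
  simp [extendZero, a.2]

theorem extendZero_of_not {P : ι → Prop} (x : {a // P a} → ℚ_[p]) {a : ι} (h : ¬ P a) :
    extendZero x a = 0 := by
  simp [extendZero, h]

theorem maxNorm_extendZero {P : ι → Prop} (x : {a // P a} → ℚ_[p]) {s : Finset ι}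
    {s' : Finset {a // P a}} (h : ∀ a : {a // P a}, a ∈ s' ↔ a.1 ∈ s) :
    maxNorm s (extendZero x) = maxNorm s' x := by
  refine le_antisymm (sup_le (one_le_maxNorm _ _) (Finset.sup_le fun a ha => ?_))
    (sup_le (one_le_maxNorm _ _) (Finset.sup_le fun a ha => ?_))
  · by_cases hP : P a
    · rw [extendZero_of_mem x ⟨a, hP⟩]
      exact nnnorm_le_maxNorm x ((h _).mpr ha)
    · rw [extendZero_of_not x hP, nnnorm_zero]
      exact zero_le
  · rw [← extendZero_of_mem x a]
    exact nnnorm_le_maxNorm _ ((h _).mp ha)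

theorem RowCongr.of_extendZero [Fintype ι] {P : ι → Prop} [Fintype {a // P a}] {ρ : ι → ℚ_[p]}
    {ρ₀ : ℚ_[p]} {x : {a // P a} → ℚ_[p]} (h : RowCongr ρ ρ₀ Finset.univ (extendZero x)) :
    RowCongr (fun a => ρ a.1) ρ₀ Finset.univ x := by
  have hM : maxNorm Finset.univ (extendZero x) = maxNorm Finset.univ x :=
    maxNorm_extendZero x (by simp)
  obtain ⟨h1, h2, h3, h4⟩ := h
  rw [hM] at h1 h2 h3 h4
  refine ⟨fun i _ j _ => ?_, fun i _ => ?_, fun i _ hi => ?_, h4⟩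
  · simpa only [extendZero_of_mem] using h1 i.1 (Finset.mem_univ _) j.1 (Finset.mem_univ _)
  · simpa only [extendZero_of_mem] using h2 i.1 (Finset.mem_univ _)
  · exact h3 i.1 (Finset.mem_univ _) (by rw [extendZero_of_mem, hi])

/-- The earlier jumps multiply to the running maximum $M$, and the jump at $a$ is $\max(M,|x_a|)/M$.
The powers of $M$ combine to $M^\beta$. -/
theorem jump_extendZero_mul [Fintype ι] {P : ι → Prop} [Fintype {a // P a}] {key : ι → ℕ}
    (hkey : Function.Injective key) (x : {a // P a} → ℚ_[p]) (β : ℝ) (a : {a // P a}) :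
    jump key (extendZero x) a.1 ^ (-(1 + β)) *
        (∏ c ∈ Finset.univ.filter fun c => key c < key a.1, jump key (extendZero x) c)⁻¹ =
      rowKernel (maxNorm (Finset.univ.filter fun c : {a // P a} => key c.1 < key a.1) x) β
        (x a) := by
  have hM : maxNorm (Finset.univ.filter fun c => key c < key a.1) (extendZero x) =
      maxNorm (Finset.univ.filter fun c : {a // P a} => key c.1 < key a.1) x :=
    maxNorm_extendZero x (by simp)
  rw [prod_jump hkey _ _ (fun b hb c hc => by
    simp only [Finset.mem_filter, Finset.mem_univ, true_and] at hb ⊢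
    exact hc.trans hb), jump, hM, extendZero_of_mem, rowKernel]
  have h0 := maxNorm_pos (Finset.univ.filter fun c : {a // P a} => key c.1 < key a.1) x
  generalize maxNorm (Finset.univ.filter fun c : {a // P a} => key c.1 < key a.1) x = M at h0
  rw [NNReal.div_rpow, NNReal.rpow_neg M, div_inv_eq_mul, mul_assoc, mul_comm,
    NNReal.rpow_add h0.ne', NNReal.rpow_one]
  congr 1
  field_simp

end RowExtension

/-! ### Induction on the size of the matrix -/

section SplitLastRow

variable {p : ℕ} [Fact p.Prime] {n : ℕ}

/-- As an inequality, Tonelli's theorem needs no measurability of `F`. -/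
theorem lintegral_pi_sum_le {α β γ : Type*} [Fintype α] [Fintype β] [Fintype γ] (σ : α ⊕ β ≃ γ)
    (F : (γ → ℚ_[p]) → ℝ≥0∞) :
    ∫⁻ z, F z ∂Measure.pi (fun _ => padicHaar p) ≤
      ∫⁻ x : α → ℚ_[p], ∫⁻ y : β → ℚ_[p], F (fun c => Sum.elim x y (σ.symm c))
        ∂Measure.pi (fun _ => padicHaar p) ∂Measure.pi (fun _ => padicHaar p) := by
  have h1 := measurePreserving_piCongrLeft (fun _ : γ => padicHaar p) σ
  have h2 := measurePreserving_sumPiEquivProdPi_symm (fun _ : α ⊕ β => padicHaar p)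
  rw [h1.lintegral_map_equiv, h2.lintegral_map_equiv]
  refine (lintegral_prod_le _).trans (le_of_eq ?_)
  congr 1; funext x; congr 1; funext y; congr 1; funext c
  obtain ⟨c, rfl⟩ := σ.surjective c
  rw [σ.symm_apply_apply]
  refine (Equiv.piCongrLeft_apply_apply _ σ _ c).trans ?_
  cases c <;> rfl

/-- The positions of a block unipotent matrix, sorted into those in the last row and the others. -/
noncomputable def lowerPosEquiv {bl : Fin (n + 1) → ℕ} (hbl : Monotone bl) :
    {a : Fin n // bl a.castSucc < bl (Fin.last n)} ⊕ LowerPos (fun i : Fin n => bl i.castSucc) ≃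
      LowerPos bl :=
  Equiv.ofBijective
    (Sum.elim (fun a => ⟨(Fin.last n, a.1.castSucc), a.2⟩)
      fun a => ⟨(a.1.1.castSucc, a.1.2.castSucc), a.2⟩) <| by
    constructor
    · rintro (⟨a, ha⟩ | ⟨⟨a, b⟩, ha⟩) (⟨c, hc⟩ | ⟨⟨c, d⟩, hc⟩) h <;>
        simp only [Sum.elim_inl, Sum.elim_inr, Subtype.mk.injEq, Prod.mk.injEq] at h
      · simpa using h
      · exact absurd h.1.symm (Fin.castSucc_ne_last _)
      · exact absurd h.1 (Fin.castSucc_ne_last _)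
      · simpa using h
    · rintro ⟨⟨i, j⟩, h⟩
      have hj : j ≠ Fin.last n := by
        rintro rfl
        exact absurd h (not_lt.mpr (hbl (Fin.le_last i)))
      obtain ⟨j, rfl⟩ := Fin.exists_castSucc_eq.mpr hj
      rcases Fin.eq_castSucc_or_eq_last i with ⟨i, rfl⟩ | rfl
      · exact ⟨Sum.inr ⟨(i, j), h⟩, rfl⟩
      · exact ⟨Sum.inl ⟨j, h⟩, rfl⟩

theorem lowerMatrix_lowerPosEquiv {bl : Fin (n + 1) → ℕ} (hbl : Monotone bl)
    (x : {a : Fin n // bl a.castSucc < bl (Fin.last n)} → ℚ_[p])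
    (y : LowerPos (fun i : Fin n => bl i.castSucc) → ℚ_[p]) :
    lowerMatrix bl (fun c => Sum.elim x y ((lowerPosEquiv hbl).symm c)) =
      bordered (lowerMatrix _ y) 0 (extendZero x) 1 := by
  have hr : ∀ (a) (h : bl (Fin.castSucc a) < bl (Fin.last n)),
      (lowerPosEquiv hbl).symm ⟨(Fin.last n, a.castSucc), h⟩ = Sum.inl ⟨a, h⟩ := fun a h =>
    (Equiv.symm_apply_eq _).mpr rfl
  have ht : ∀ (a b : Fin n) (h : bl b.castSucc < bl a.castSucc),
      (lowerPosEquiv hbl).symm ⟨(a.castSucc, b.castSucc), h⟩ = Sum.inr ⟨(a, b), h⟩ := fun a b h =>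
    (Equiv.symm_apply_eq _).mpr rfl
  ext i j
  refine Fin.lastCases ?_ (fun i => ?_) i <;> refine Fin.lastCases ?_ (fun j => ?_) j
  · rw [lowerMatrix_of_not_lt _ (lt_irrefl _)]; simp
  · rw [bordered_last_castSucc]
    by_cases h : bl j.castSucc < bl (Fin.last n)
    · rw [lowerMatrix_of_lt _ h, hr, Sum.elim_inl, ← extendZero_of_mem x ⟨j, h⟩]
    · rw [lowerMatrix_of_not_lt _ h, extendZero_of_not x h,
        Matrix.one_apply_ne (Fin.castSucc_ne_last j).symm]
  · rw [lowerMatrix_of_not_lt _ (not_lt.mpr (hbl (Fin.le_last _))), bordered_castSucc_last,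
      Matrix.one_apply_ne (Fin.castSucc_ne_last i), Pi.zero_apply]
  · rw [bordered_castSucc_castSucc]
    by_cases h : bl j.castSucc < bl i.castSucc
    · rw [lowerMatrix_of_lt _ h, ht, Sum.elim_inr,
        lowerMatrix_of_lt (bl := fun i => bl i.castSucc) y h]
    · rw [lowerMatrix_of_not_lt _ h, lowerMatrix_of_not_lt (bl := fun i => bl i.castSucc) y h]
      simp [Matrix.one_apply]

theorem le_card_of_forall_exists {ι : Type*} (s : Finset ι) (f : ι → ℕ) (m : ℕ)
    (h : ∀ j < m, ∃ b ∈ s, f b = j) : m ≤ s.card := by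
  rw [← Finset.card_range m]
  refine Finset.card_le_card_of_surjOn f fun j hj => ?_
  obtain ⟨b, hb, hbj⟩ := h j (by simpa using hj)
  exact ⟨b, hb, hbj⟩

/-- The bound for the integral of `absVector` over block unipotent matrices. -/
theorem lintegral_absVector_le {bl : Fin n → ℕ} (hbl : Monotone bl)
    (hlab : ∀ a, ∀ j < bl a, ∃ b, bl b = j) {e : Fin n → ℝ}
    (he : ∀ a b, bl a < bl b → ((b : ℝ) - a) + ((bl b : ℝ) - bl a) ≤ e a - e b)
    {k : Matrix (Fin n) (Fin n) ℚ_[p]} (hk : IsMaxCompactMatrix k) :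
    ∫⁻ z, absVector e (lowerMatrix bl z * k) ∂Measure.pi (fun _ => padicHaar p) ≤
      3 ^ (n * n) * ((p : ℝ≥0∞)⁻¹) ^ ∑ a, bl a := by
  classical
  induction n with
  | zero =>
    have h1 : ∀ g : Matrix (Fin 0) (Fin 0) ℚ_[p], absVector e g ≤ 1 := fun g =>
      absVector_le fun b k _ _ _ _ => by simp
    calc _ ≤ ∫⁻ z : LowerPos bl → ℚ_[p], 1 ∂Measure.pi (fun _ => padicHaar p) :=
          lintegral_mono fun z => h1 _
      _ ≤ _ := by simp
  | succ n ih =>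
    set bl' : Fin n → ℕ := fun i => bl i.castSucc with hbl'
    have hmono : Monotone bl' := fun a b h => hbl (Fin.castSucc_le_castSucc_iff.mpr h)
    have hlab' : ∀ a : Fin (n + 1), ∀ j < bl a, ∃ b : Fin n, bl' b = j := by
      intro a j hj
      obtain ⟨b, hb⟩ := hlab a j hj
      have hbn : b ≠ Fin.last n := by
        rintro rfl
        have := hbl (Fin.le_last a)
        omega
      obtain ⟨b, rfl⟩ := Fin.exists_castSucc_eq.mpr hbn
      exact ⟨b, hb⟩
    obtain ⟨key, hkey, hkl⟩ := exists_block_key bl'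
    set S : ℝ≥0∞ := 3 ^ (n * n) * ((p : ℝ≥0∞)⁻¹) ^ ∑ a, bl' a with hS
    have hSb : ∀ k : Matrix (Fin n) (Fin n) ℚ_[p], IsMaxCompactMatrix k →
        ∫⁻ z, absVector (fun i => e i.castSucc) (lowerMatrix bl' z * k)
          ∂Measure.pi (fun _ => padicHaar p) ≤ S := fun k hk =>
      ih hmono (fun a j hj => hlab' a.castSucc j hj)
        (fun a b h => by simpa using he a.castSucc b.castSucc h) hk
    obtain ⟨k', hk', hkk⟩ := hk.2
    set P : Fin n → Prop := fun a => bl a.castSucc < bl (Fin.last n) with hP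
    set β : {a // P a} → ℝ := fun a =>
      e a.1.castSucc - e (Fin.last n) - ((n : ℝ) - (a.1 : ℕ)) with hβ
    -- In `he` for $a$ and the last index, the distance $n-a$ is exactly what $\beta$ subtracts; the
    -- difference of the block labels is left.
    have hβL : ∀ a, (bl (Fin.last n) : ℝ) - bl' a.1 ≤ β a := fun a => by
      have h := he a.1.castSucc (Fin.last n) a.2
      simp only [Fin.val_last, Fin.val_castSucc] at h
      simp only [hβ, hbl']
      linarith
    have hβ1 : ∀ a, 1 ≤ β a := fun a => by
      have h1 : (bl' a.1 : ℝ) + 1 ≤ bl (Fin.last n) := by exact_mod_cast a.2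
      linarith [hβL a]
    -- Every label below that of the last row occurs, so the row has at least that many free
    -- entries. This covers the case in which no coordinate raises the maximum.
    have hcard : bl (Fin.last n) ≤ Fintype.card {a // P a} := by
      rw [← Finset.card_univ]
      refine le_card_of_forall_exists _ (fun a => bl' a.1) _ fun j hj => ?_
      obtain ⟨b, hb⟩ := hlab' (Fin.last n) j hj
      have hPb : P b := by simp only [hP]; simp only [hbl'] at hb; omega
      exact ⟨⟨b, hPb⟩, Finset.mem_univ _, hb⟩
    have hkβ : ∀ a, ((bl (Fin.last n) : ℕ) : ℝ) ≤
        β a + (Finset.univ.filter fun c : {a // P a} => key a.1 < key c.1).card := by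
      intro a
      -- All earlier blocks follow $a$ in the key order, and each of their labels is attained.
      have h1 : bl' a.1 ≤ (Finset.univ.filter fun c : {a // P a} => key a.1 < key c.1).card := by
        refine le_card_of_forall_exists _ (fun a => bl' a.1) _ fun j hj => ?_
        obtain ⟨b, hb⟩ := hlab' a.1.castSucc j hj
        have hPa := a.2
        have hPb : P b := by simp only [hP, hbl'] at *; omega
        refine ⟨⟨b, hPb⟩, ?_, hb⟩
        simp only [Finset.mem_filter, Finset.mem_univ, true_and]
        exact (hkl _ _).mpr (Or.inl (by omega))
      have h2 : (bl' a.1 : ℝ) ≤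
        (Finset.univ.filter fun c : {a // P a} => key a.1 < key c.1).card := by exact_mod_cast h1
      linarith [hβL a]
    have hrow := lintegral_rowCongr_le (p := p) (key := fun a : {a // P a} => key a.1)
      (fun a b h => Subtype.ext (hkey h)) hβ1
      (fun a => k' (Fin.last n) a.1.castSucc) (k' (Fin.last n) (Fin.last n)) _ hcard hkβ
    have hin : ∀ x : {a // P a} → ℚ_[p],
        ∫⁻ y, absVector e (bordered (lowerMatrix bl' y) 0 (extendZero x) 1 * k)
          ∂Measure.pi (fun _ => padicHaar p) ≤
        (if RowCongr (fun a : {a // P a} => k' (Fin.last n) a.1.castSucc)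
            (k' (Fin.last n) (Fin.last n)) Finset.univ x then
          (rowWeight (fun a : {a // P a} => key a.1) β Finset.univ x : ℝ≥0∞) else 0) * S := by
      intro x
      refine (lintegral_bordered_le hmono hkey hkl e hSb hk hk' hkk _).trans ?_
      by_cases h : RowCongr (fun i : Fin n => k' (Fin.last n) i.castSucc)
        (k' (Fin.last n) (Fin.last n)) Finset.univ (extendZero x)
      · rw [if_pos h, if_pos h.of_extendZero,
          row_weight_identity hmono hkl (L := bl (Fin.last n))
            (fun a => (jump_pos key (extendZero x) a).ne')
            (fun a ha => jump_of_eq_zero key (extendZero_of_not x ha))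
            (fun a => e a.castSucc) (e (Fin.last n)),
          rowWeight]
        refine le_of_eq ?_
        congr 2
        exact Finset.prod_congr rfl fun a _ => jump_extendZero_mul hkey x (β a) a
      · rw [if_neg h]
        exact zero_le
    calc _ ≤ ∫⁻ x : {a // P a} → ℚ_[p], ∫⁻ y,
          absVector e (bordered (lowerMatrix bl' y) 0 (extendZero x) 1 * k)
          ∂Measure.pi (fun _ => padicHaar p) ∂Measure.pi (fun _ => padicHaar p) := by
          refine (lintegral_pi_sum_le (lowerPosEquiv hbl) _).trans (le_of_eq ?_)
          simp only [lowerMatrix_lowerPosEquiv]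
          rfl
      _ ≤ _ := lintegral_mono hin
      _ ≤ (3 ^ Fintype.card {a // P a} * ((p : ℝ≥0∞)⁻¹) ^ bl (Fin.last n)) * S := by
          rw [lintegral_mul_const _ (Measurable.ite (measurableSet_rowCongr _ _ _)
            (measurable_rowWeight _ _ _).coe_nnreal_ennreal measurable_const)]
          gcongr
      _ = 3 ^ (Fintype.card {a // P a} + n * n) * ((p : ℝ≥0∞)⁻¹) ^ ∑ a, bl a := by
          rw [hS, Fin.sum_univ_castSucc, pow_add, pow_add]
          ring
      _ ≤ _ := by
          gcongr
          · norm_num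
          -- The last row has at most $n$ free entries, and $n+n^2\le(n+1)^2$.
          · have := Fintype.card_subtype_le P
            simp only [Fintype.card_fin] at this
            nlinarith

end SplitLastRow

/-! ### The contragredient and the second bound -/

section Duality

variable {p : ℕ} [Fact p.Prime] {n : ℕ}

/-- The reflection of a matrix in the antidiagonal. -/
def antitranspose {R : Type*} (M : Matrix (Fin n) (Fin n) R) : Matrix (Fin n) (Fin n) R :=
  Matrix.of fun i j => M j.rev i.rev

@[simp] theorem antitranspose_apply {R : Type*} (M : Matrix (Fin n) (Fin n) R) (i j : Fin n) :
    antitranspose M i j = M j.rev i.rev := rfl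

theorem antitranspose_mul {R : Type*} [CommRing R] (A B : Matrix (Fin n) (Fin n) R) :
    antitranspose (A * B) = antitranspose B * antitranspose A := by
  ext i j
  simp only [antitranspose_apply, Matrix.mul_apply]
  rw [← Equiv.sum_comp Fin.revPerm]
  exact Finset.sum_congr rfl fun c _ => mul_comm _ _

theorem antitranspose_one {R : Type*} [CommRing R] :
    antitranspose (1 : Matrix (Fin n) (Fin n) R) = 1 := by
  ext i j
  simp [Matrix.one_apply, Fin.rev_inj, eq_comm]

theorem IsMaxCompactMatrix.antitranspose {k k' : Matrix (Fin n) (Fin n) ℚ_[p]}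
    (hk : HasIntegralEntries k) (hk' : HasIntegralEntries k') (h : k * k' = 1) :
    IsMaxCompactMatrix (IwahoriGL.antitranspose k') :=
  ⟨fun _ _ => hk' _ _, IwahoriGL.antitranspose k, fun _ _ => hk _ _, by
    rw [← antitranspose_mul, h, antitranspose_one]⟩

/-- The values of `absVector` at a matrix and at its contragredient. -/
theorem absVector_le_antitranspose (e : Fin n → ℝ) {g g' : Matrix (Fin n) (Fin n) ℚ_[p]}
    (hg : g' * g = 1) :
    absVector e g ≤ absVector (fun i => -e i.rev) (antitranspose g') := by
  refine absVector_le fun b k hb hb0 hk hbk => ?_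
  obtain ⟨hk1, k', hk', hkk⟩ := hk
  have hdet : IsUnit b.det := by
    rw [Matrix.det_of_isUpperTriangular hb, isUnit_iff_ne_zero, Finset.prod_ne_zero_iff]
    exact fun a _ => hb0 a
  let _ := b.invertibleOfIsUnitDet hdet
  have hbi : (b⁻¹).IsUpperTriangular := Matrix.blockTriangular_inv_of_blockTriangular hb
  have hbd : ∀ i, b⁻¹ i i = (b i i)⁻¹ := fun i => by
    have h := isUpperTriangular_mul_diag hbi hb i
    rw [Matrix.nonsing_inv_mul _ hdet, Matrix.one_apply_eq] at h
    exact eq_inv_of_mul_eq_one_left h.symm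
  have hg' : g' = k' * b⁻¹ := by
    have h1 : g * (k' * b⁻¹) = 1 := by
      rw [hbk, mul_assoc, ← mul_assoc k, hkk, one_mul, Matrix.mul_nonsing_inv _ hdet]
    calc g' = g' * (g * (k' * b⁻¹)) := by rw [h1, mul_one]
      _ = _ := by rw [← mul_assoc, hg, one_mul]
  rw [hg', antitranspose_mul]
  refine le_trans (le_of_eq ?_) (le_absVector (b := antitranspose b⁻¹) (k := antitranspose k')
    (fun i => -e i.rev) ?_ ?_ ?_)
  · rw [← Equiv.prod_comp Fin.revPerm]
    congr 1
    refine Finset.prod_congr rfl fun i _ => ?_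
    rw [antitranspose_apply, hbd, nnnorm_inv, NNReal.rpow_neg, NNReal.inv_rpow, inv_inv]
    rfl
  · intro i j hij
    exact hbi (Fin.rev_lt_rev.mpr hij)
  · intro i
    rw [antitranspose_apply, hbd]
    exact inv_ne_zero (hb0 _)
  · refine ⟨⟨fun i j => hk'.1 _ _, fun i j hij => hk'.2 _ _ (Fin.rev_lt_rev.mpr hij)⟩,
      antitranspose k, ⟨fun i j => hk1.1 _ _, fun i j hij => hk1.2 _ _ (Fin.rev_lt_rev.mpr hij)⟩, ?_⟩
    rw [← antitranspose_mul, hkk, antitranspose_one]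

/-- The block structure of the inverse of a block unipotent matrix. -/
theorem adjugate_lowerMatrix_of_le {bl : Fin n → ℕ} (hbl : Monotone bl)
    (z : LowerPos bl → ℚ_[p]) {i j : Fin n} (h : bl i ≤ bl j) :
    (lowerMatrix bl z).adjugate i j = (1 : Matrix (Fin n) (Fin n) ℚ_[p]) i j := by
  set v := lowerMatrix bl z with hv
  have hvw : v * v.adjugate = 1 := lowerMatrix_mul_adjugate hbl z
  have hdet : IsUnit v.det := by rw [hv, det_lowerMatrix hbl]; exact isUnit_one
  let _ := v.invertibleOfIsUnitDet hdet
  have hlow : v.BlockTriangular (fun i => OrderDual.toDual (bl i)) := by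
    intro a b hab
    have hab' : bl a < bl b := hab
    rw [hv, lowerMatrix_of_not_lt _ hab'.not_gt,
      Matrix.one_apply_ne (by rintro rfl; exact lt_irrefl _ hab')]
  have hinv : v⁻¹ = v.adjugate := Matrix.inv_eq_right_inv hvw
  have hw0 : ∀ a b, bl a < bl b → v.adjugate a b = 0 := fun a b hab => by
    rw [← hinv]
    exact Matrix.blockTriangular_inv_of_blockTriangular hlow hab
  rcases h.lt_or_eq with h | h
  · rw [hw0 _ _ h, Matrix.one_apply_ne (by rintro rfl; exact lt_irrefl _ h)]
  · rw [← hvw, Matrix.mul_apply, Finset.sum_eq_single i]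
    · rw [hv, lowerMatrix_of_not_lt _ (lt_irrefl _), Matrix.one_apply_eq, one_mul]
    · intro c _ hc
      by_cases hci : bl c < bl i
      · rw [hw0 c j (h ▸ hci), mul_zero]
      · rw [hv, lowerMatrix_of_not_lt _ hci, Matrix.one_apply_ne hc.symm, zero_mul]
    · simp

/-- Inversion is triangular for the block distance: an entry of $v^{-1}$ is minus the entry of $v$
plus an expression in entries of smaller block distance. This is read off from
$v^{-1}-v'^{-1}=v^{-1}(v'-v)v'^{-1}$, in which only the term at the given position survives. -/
theorem adjugate_lowerMatrix_add_congr {bl : Fin n → ℕ} (hbl : Monotone bl) (a : LowerPos bl)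
    {z z' : LowerPos bl → ℚ_[p]} (h : ∀ c : LowerPos bl,
      bl c.1.1 - bl c.1.2 < bl a.1.1 - bl a.1.2 → z c = z' c) :
    (lowerMatrix bl z).adjugate a.1.1 a.1.2 + z a =
      (lowerMatrix bl z').adjugate a.1.1 a.1.2 + z' a := by
  set v := lowerMatrix bl z with hv
  set v' := lowerMatrix bl z' with hv'
  have hwv : v.adjugate * v = 1 := by
    rw [Matrix.adjugate_mul, hv, det_lowerMatrix hbl, one_smul]
  have hvw : v' * v'.adjugate = 1 := lowerMatrix_mul_adjugate hbl z'
  have hdiff : v.adjugate - v'.adjugate = v.adjugate * (v' - v) * v'.adjugate := by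
    rw [mul_sub, sub_mul, mul_assoc, hvw, mul_one, hwv, one_mul]
  have hent := congrFun (congrFun hdiff a.1.1) a.1.2
  have ha := a.2
  have hterm : ∀ d c, v.adjugate a.1.1 c * (v' - v) c d * v'.adjugate d a.1.2 =
      if c = a.1.1 ∧ d = a.1.2 then z' a - z a else 0 := by
    intro d c
    split_ifs with hcd
    · obtain ⟨rfl, rfl⟩ := hcd
      rw [adjugate_lowerMatrix_of_le hbl z le_rfl, adjugate_lowerMatrix_of_le hbl z' le_rfl,
        Matrix.one_apply_eq, Matrix.one_apply_eq, one_mul, mul_one, Matrix.sub_apply, hv, hv',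
        lowerMatrix_of_lt _ ha, lowerMatrix_of_lt _ ha]
    · by_cases h1 : bl a.1.1 ≤ bl c ∧ c ≠ a.1.1
      · rw [adjugate_lowerMatrix_of_le hbl z h1.1, Matrix.one_apply_ne h1.2.symm, zero_mul, zero_mul]
      by_cases h2 : bl d ≤ bl a.1.2 ∧ d ≠ a.1.2
      · rw [adjugate_lowerMatrix_of_le hbl z' h2.1, Matrix.one_apply_ne h2.2, mul_zero]
      have h3 : (v' - v) c d = 0 := by
        rw [Matrix.sub_apply, sub_eq_zero, hv, hv']
        by_cases hlt : bl d < bl c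
        · rw [lowerMatrix_of_lt _ hlt, lowerMatrix_of_lt _ hlt]
          refine (h ⟨(c, d), hlt⟩ ?_).symm
          have h4 : bl c ≤ bl a.1.1 ∧ bl a.1.2 ≤ bl d := by
            constructor
            · by_contra h5
              exact h1 ⟨(not_le.mp h5).le, by rintro rfl; exact h5 le_rfl⟩
            · by_contra h5
              exact h2 ⟨(not_le.mp h5).le, by rintro rfl; exact h5 le_rfl⟩
          have h5 : bl c < bl a.1.1 ∨ bl a.1.2 < bl d := by
            by_contra h6
            push Not at h6
            refine hcd ⟨?_, ?_⟩
            · by_contra h7; exact h1 ⟨h6.1, h7⟩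
            · by_contra h7; exact h2 ⟨h6.2, h7⟩
          change bl c - bl d < _
          omega
        · rw [lowerMatrix_of_not_lt _ hlt, lowerMatrix_of_not_lt _ hlt]
      rw [h3, mul_zero, zero_mul]
  have hsum : (v.adjugate * (v' - v) * v'.adjugate) a.1.1 a.1.2 = z' a - z a := by
    rw [Matrix.mul_apply]
    simp only [Matrix.mul_apply (M := v.adjugate), Finset.sum_mul, hterm]
    rw [Finset.sum_eq_single a.1.2, Finset.sum_eq_single a.1.1]
    · simp
    · intro c _ hc; simp [hc]
    · simp
    · intro d _ hd; simp [hd]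
    · simp
  rw [hsum, Matrix.sub_apply] at hent
  linear_combination hent

/-- The positions of the contragredient of a block unipotent matrix. -/
def lowerPosRev {bl : Fin n → ℕ} {B : ℕ} (hB : ∀ a, bl a ≤ B) :
    LowerPos (fun a : Fin n => B - bl a.rev) ≃ LowerPos bl where
  toFun a := ⟨(a.1.2.rev, a.1.1.rev), by have := a.2; have := hB a.1.2.rev; dsimp only at *; omega⟩
  invFun a := ⟨(a.1.2.rev, a.1.1.rev), by
    have := a.2; have := hB a.1.1; simp only [Fin.rev_rev]; omega⟩
  left_inv a := by simp
  right_inv a := by simp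

theorem antitranspose_adjugate_lowerMatrix {bl : Fin n → ℕ} (hbl : Monotone bl) {B : ℕ}
    (hB : ∀ a, bl a ≤ B) (z : LowerPos bl → ℚ_[p]) :
    antitranspose (lowerMatrix bl z).adjugate =
      lowerMatrix (fun a : Fin n => B - bl a.rev) fun a =>
        (lowerMatrix bl z).adjugate (lowerPosRev hB a).1.1 (lowerPosRev hB a).1.2 := by
  ext i j
  rw [antitranspose_apply]
  by_cases h : B - bl j.rev < B - bl i.rev
  · rw [lowerMatrix_of_lt (bl := fun a : Fin n => B - bl a.rev) _ h]
    rfl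
  · rw [lowerMatrix_of_not_lt (bl := fun a : Fin n => B - bl a.rev) _ h,
      adjugate_lowerMatrix_of_le hbl]
    · simp [Matrix.one_apply, Fin.rev_inj, eq_comm]
    · have := hB j.rev; have := hB i.rev; omega

theorem lintegral_pi_reindex {α β : Type*} [Fintype α] [Fintype β] (σ : α ≃ β)
    (F : (α → ℚ_[p]) → ℝ≥0∞) :
    ∫⁻ z : β → ℚ_[p], F (fun a => z (σ a)) ∂Measure.pi (fun _ => padicHaar p) =
      ∫⁻ z, F z ∂Measure.pi (fun _ => padicHaar p) :=
  ((measurePreserving_piCongrLeft (fun _ : β => padicHaar p) σ).symm.lintegral_map_equiv F).symm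

/-- The bound for the integral of `absVector` that comes from the contragredient. -/
theorem lintegral_absVector_le_rev {bl : Fin n → ℕ} (hbl : Monotone bl) {B : ℕ}
    (hB : ∀ a, bl a ≤ B) (hlab : ∀ j ≤ B, ∃ b, bl b = j) {e : Fin n → ℝ}
    (he : ∀ a b, bl a < bl b → ((b : ℝ) - a) + ((bl b : ℝ) - bl a) ≤ e a - e b)
    {k : Matrix (Fin n) (Fin n) ℚ_[p]} (hk : IsMaxCompactMatrix k) :
    ∫⁻ z, absVector e (lowerMatrix bl z * k) ∂Measure.pi (fun _ => padicHaar p) ≤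
      3 ^ (n * n) * ((p : ℝ≥0∞)⁻¹) ^ ∑ a, (B - bl a) := by
  obtain ⟨hk0, k', hk', hkk⟩ := hk
  set bl' : Fin n → ℕ := fun a => B - bl a.rev with hbl'
  have hm := IsMaxCompactMatrix.antitranspose hk0 hk' hkk
  have hmono : Monotone bl' := fun a b h => by
    have := hbl (Fin.rev_le_rev.mpr h)
    simp only [hbl']; omega
  have hbound := lintegral_absVector_le (p := p) hmono (e := fun i => -e i.rev)
    (fun a j hj => by
      obtain ⟨b, hb⟩ := hlab (B - j) (by omega)
      refine ⟨b.rev, ?_⟩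
      simp only [hbl', Fin.rev_rev] at *
      omega)
    (fun a b h => by
      have h1 := hB a.rev
      have h2 := hB b.rev
      simp only [hbl'] at h
      have h3 := he b.rev a.rev (by omega)
      simp only [hbl', Nat.cast_sub h1, Nat.cast_sub h2]
      have h4 : ((a.rev : ℕ) : ℝ) - (b.rev : ℕ) = (b : ℝ) - a := by
        have h5 : (a.rev : ℕ) + (a : ℕ) = (b.rev : ℕ) + b := by
          simp only [Fin.val_rev]; omega
        have h6 : ((a.rev : ℕ) : ℝ) + (a : ℕ) = (b.rev : ℕ) + (b : ℕ) := by exact_mod_cast h5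
        linarith
      linarith) hm
  have hsum : ∑ a, bl' a = ∑ a, (B - bl a) := Equiv.sum_comp Fin.revPerm fun a => B - bl a
  rw [hsum] at hbound
  refine le_trans ?_ hbound
  let G : (LowerPos bl' → ℚ_[p]) → ℝ≥0∞ := fun y =>
    absVector (fun i => -e i.rev) (lowerMatrix bl' y * antitranspose k')
  have hG : Measurable G := measurable_absVector_lowerMatrix hmono _ hm
  let f : LowerPos bl → (LowerPos bl → ℚ_[p]) → ℚ_[p] := fun a z =>
    (lowerMatrix bl z).adjugate a.1.1 a.1.2 + z a
  have hf : ∀ a, Measurable (f a) := fun a =>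
    (((continuous_lowerMatrix (p := p) bl).matrix_adjugate.matrix_elem _ _).add
      (continuous_apply a)).measurable
  -- The coefficients $-1$ have norm $1$, so $v\mapsto v^{-1}$ preserves the measure.
  have htri := lintegral_triangular (p := p) (fun a : LowerPos bl => bl a.1.1 - bl a.1.2)
    (c := fun _ => -1) (fun _ => neg_ne_zero.mpr one_ne_zero) hf
    (fun a z z' h => adjugate_lowerMatrix_add_congr hbl a h)
    (F := fun z => G fun a => z (lowerPosRev hB a))
    (hG.comp (measurable_pi_lambda _ fun a => measurable_pi_apply _))
  rw [lintegral_pi_reindex (lowerPosRev hB) G] at htri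
  calc _ ≤ ∫⁻ z, G fun a => -1 * z (lowerPosRev hB a) + f (lowerPosRev hB a) z
        ∂Measure.pi (fun _ => padicHaar p) := by
        refine lintegral_mono fun z => ?_
        refine (absVector_le_antitranspose e (g' := k' * (lowerMatrix bl z).adjugate) ?_).trans
          (le_of_eq ?_)
        · rw [mul_assoc, ← mul_assoc _ (lowerMatrix bl z), Matrix.adjugate_mul,
            det_lowerMatrix hbl, one_smul, one_mul]
          exact mul_eq_one_comm.mp hkk
        · rw [antitranspose_mul, antitranspose_adjugate_lowerMatrix hbl hB]
          simp only [G, f, neg_one_mul, neg_add_cancel_comm_assoc]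
          rfl
    _ = _ := by
        rw [htri]
        simp only [nnnorm_neg, nnnorm_one, Finset.prod_const_one, inv_one, ENNReal.coe_one, one_mul]
        rfl

end Duality

/-! ### From subgroups of the general linear group to matrices -/

section Transfer

variable {p : ℕ} [Fact p.Prime] {n : ℕ}

theorem isMaxCompactMatrix_of_mem_maxCompact {g : GL (Fin n) ℚ_[p]} (hg : g ∈ maxCompact n p) :
    IsMaxCompactMatrix (g : Matrix (Fin n) (Fin n) ℚ_[p]) := by
  have hint : ∀ g ∈ maxCompact n p, HasIntegralEntries (g : Matrix (Fin n) (Fin n) ℚ_[p]) := by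
    rintro _ ⟨k, rfl⟩ i j
    exact (k.val i j).norm_le_one
  exact ⟨hint g hg, (g⁻¹ : GL (Fin n) ℚ_[p]), hint _ (inv_mem hg), g.mul_inv⟩

/-- The inverse must be upper triangular modulo $p$ too: it reduces to the inverse of an invertible
upper triangular matrix over $\mathbb{F}_p$. -/
theorem isIwahoriMatrix_of_mem_iwahori {g : GL (Fin n) ℚ_[p]} (hg : g ∈ iwahori n p) :
    IsIwahoriMatrix (g : Matrix (Fin n) (Fin n) ℚ_[p]) := by
  obtain ⟨k, rfl, hk⟩ := hg
  have hz : ∀ x : ℤ_[p], PadicInt.toZMod x = 0 ↔ ‖x‖ < 1 := fun x => by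
    rw [← RingHom.mem_ker, PadicInt.ker_toZMod, IsLocalRing.mem_maximalIdeal,
      PadicInt.mem_nonunits]
  set K : Matrix (Fin n) (Fin n) (ZMod p) := PadicInt.toZMod.mapMatrix k.val with hK
  set K' : Matrix (Fin n) (Fin n) (ZMod p) :=
    PadicInt.toZMod.mapMatrix (k⁻¹ : GL (Fin n) ℤ_[p]).val with hK'
  have hKK : K * K' = 1 := by
    rw [hK, hK', ← map_mul, Units.mul_inv, map_one]
  have hup : K.IsUpperTriangular := fun i j hij =>
    (hz _).mpr ((PadicInt.norm_lt_one_iff_dvd _).mpr (hk i j hij))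
  let _ := K.invertibleOfIsUnitDet (Matrix.isUnit_det_of_right_inverse hKK)
  have hup' : K'.IsUpperTriangular := by
    rw [← Matrix.inv_eq_right_inv hKK]
    exact Matrix.blockTriangular_inv_of_blockTriangular hup
  refine ⟨⟨fun i j => (k.val i j).norm_le_one, fun i j hij =>
      (PadicInt.norm_lt_one_iff_dvd _).mpr (hk i j hij)⟩,
    (Matrix.GeneralLinearGroup.map PadicInt.Coe.ringHom k⁻¹ : GL (Fin n) ℚ_[p]),
    ⟨fun i j => ((k⁻¹ : GL (Fin n) ℤ_[p]).val i j).norm_le_one, fun i j hij =>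
      (hz ((k⁻¹ : GL (Fin n) ℤ_[p]).val i j)).mp (hup' hij)⟩, ?_⟩
  rw [map_inv]
  exact Units.mul_inv _

theorem mem_iwahori_of_isIwahoriMatrix {g : GL (Fin n) ℚ_[p]}
    (hg : IsIwahoriMatrix (g : Matrix (Fin n) (Fin n) ℚ_[p])) : g ∈ iwahori n p := by
  obtain ⟨hg, g', hg', hgg⟩ := hg
  have hinj : Function.Injective
      ((PadicInt.Coe.ringHom (p := p)).mapMatrix : Matrix (Fin n) (Fin n) ℤ_[p] →+* _) :=
    fun A B h => Matrix.ext fun i j => Subtype.ext (congrFun (congrFun h i) j)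
  let A : Matrix (Fin n) (Fin n) ℤ_[p] := Matrix.of fun i j => ⟨g.val i j, hg.1 i j⟩
  let A' : Matrix (Fin n) (Fin n) ℤ_[p] := Matrix.of fun i j => ⟨g' i j, hg'.1 i j⟩
  have hAA : A * A' = 1 := hinj (by rw [map_mul, map_one]; exact hgg)
  refine ⟨⟨A, A', hAA, mul_eq_one_comm.mp hAA⟩, Units.ext rfl, fun i j hij => ?_⟩
  exact (PadicInt.norm_lt_one_iff_dvd _).mp (hg.2 i j hij)

theorem norm_det_of_mem_maxCompact {g : GL (Fin n) ℚ_[p]} (hg : g ∈ maxCompact n p) :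
    ‖(g : Matrix (Fin n) (Fin n) ℚ_[p]).det‖ = 1 := by
  obtain ⟨k, rfl⟩ := hg
  have h : (Matrix.GeneralLinearGroup.map (n := Fin n) (PadicInt.Coe.ringHom (p := p)) k).val.det =
      ((k.val.det : ℤ_[p]) : ℚ_[p]) := (RingHom.map_det PadicInt.Coe.ringHom k.val).symm
  rw [h, ← PadicInt.norm_def, ← PadicInt.isUnit_iff]
  exact (Matrix.isUnit_iff_isUnit_det _).mp k.isUnit

theorem weylElt_one : weylElt p (1 : Equiv.Perm (Fin n)) = 1 := map_one _

/-- Right invariance serves to make the integrand locally constant, hence measurable. -/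
theorem basisVector_one_mul (χ : Torus n p →* ℂˣ) (hχ : IsUnramified χ) (g : GL (Fin n) ℚ_[p])
    {k : GL (Fin n) ℚ_[p]} (hk : k ∈ iwahori n p) :
    basisVector χ 1 (g * k) = basisVector χ 1 g := by
  have hmul : ∀ k₁ ∈ iwahori n p, ∀ k₂ ∈ iwahori n p, k₁ * k₂ ∈ iwahori n p :=
    fun k₁ h₁ k₂ h₂ => mem_iwahori_of_isIwahoriMatrix
      ((isIwahoriMatrix_of_mem_iwahori h₁).mul (isIwahoriMatrix_of_mem_iwahori h₂))
  have hinv : k⁻¹ ∈ iwahori n p := by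
    obtain ⟨k', hk', hkk⟩ := (isIwahoriMatrix_of_mem_iwahori hk).inv
    refine mem_iwahori_of_isIwahoriMatrix ?_
    have h : (k⁻¹ : GL (Fin n) ℚ_[p]).val = k' := by
      rw [Matrix.coe_units_inv]
      exact Matrix.inv_eq_right_inv hkk
    rwa [h]
  by_cases hex : ∃ t : Torus n p, ∃ u ∈ unipotent n p, ∃ k ∈ iwahori n p,
      g = torusElt t * u * weylElt p 1 * k
  · obtain ⟨t, u, hu, k₀, hk₀, rfl⟩ := hex
    rw [mul_assoc _ k₀ k, basisVector_apply χ hχ 1 t hu (hmul _ hk₀ _ hk),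
      basisVector_apply χ hχ 1 t hu hk₀]
  · have hex' : ¬ ∃ t : Torus n p, ∃ u ∈ unipotent n p, ∃ k₁ ∈ iwahori n p,
        g * k = torusElt t * u * weylElt p 1 * k₁ := by
      rintro ⟨t, u, hu, k₁, hk₁, h⟩
      exact hex ⟨t, u, hu, k₁ * k⁻¹, hmul _ hk₁ _ hinv, by rw [← mul_assoc, ← h]; group⟩
    rw [basisVector, basisVector, dif_neg hex, dif_neg hex']

/-- A bound for the vector `φ_1^χ` on the elements with determinant of absolute value `1`. -/
theorem enorm_basisVector_one_le (χ : Torus n p →* ℂˣ) {e : Fin n → ℝ}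
    (he : ∀ t : Torus n p, ∏ i, ‖(t i : ℚ_[p])‖ = 1 →
      ‖twist χ t‖ = ∏ i, ‖(t i : ℚ_[p])‖ ^ e i)
    {g : GL (Fin n) ℚ_[p]} (hg : ‖(g : Matrix (Fin n) (Fin n) ℚ_[p]).det‖ = 1) :
    ‖basisVector χ 1 g‖ₑ ≤ absVector e (g : Matrix (Fin n) (Fin n) ℚ_[p]) := by
  rw [basisVector]
  split_ifs with hex
  swap
  · simp
  obtain ⟨u, hu, k, hk, h⟩ := hex.choose_spec
  generalize hex.choose = t at h
  rw [weylElt_one, mul_one] at h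
  set b : Matrix (Fin n) (Fin n) ℚ_[p] := (torusElt t * u : GL (Fin n) ℚ_[p]).val with hb
  have hent : ∀ i j, b i j = (t i : ℚ_[p]) * (u : Matrix (Fin n) (Fin n) ℚ_[p]) i j := by
    intro i j
    change ((torusElt t).val * u.val) i j = _
    simp [Matrix.mul_apply, torusElt_apply]
  have hup : b.IsUpperTriangular := fun i j hij => by rw [hent, hu.1 hij, mul_zero]
  have hdiag : ∀ i, b i i = t i := fun i => by rw [hent, hu.2, mul_one]
  have hgb : g.val = b * k.val := congrArg Units.val h
  -- The torus part has determinant of norm $1$; there $\chi_{\mathbf s}^{\mathrm{ad}}$ determines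
  -- $|\chi|$, whatever extension is chosen.
  have hdet : ∏ i, ‖(t i : ℚ_[p])‖ = 1 := by
    rw [hgb, Matrix.det_mul, norm_mul, norm_det_of_mem_maxCompact (hk.imp fun _ h => h.1), mul_one,
      Matrix.det_of_isUpperTriangular hup, norm_prod] at hg
    simpa only [hdiag] using hg
  rw [hgb]
  refine le_trans (le_of_eq ?_) (le_absVector e hup (fun i => by rw [hdiag]; exact (t i).ne_zero)
    (isIwahoriMatrix_of_mem_iwahori hk))
  rw [enorm_eq_nnnorm]
  congr 1
  ext
  rw [coe_nnnorm, he t hdet]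
  simp [hdiag]

end Transfer

/-! ### Exponents of the admissible characters -/

section Characters

variable {p : ℕ} [Fact p.Prime] {n : ℕ}

/-- The index $a$ occurs $n-1-a$ times in a numerator and $a$ times in a denominator. -/
theorem modulus_eq (t : Torus n p) :
    modulus t = ∏ a : Fin n, ‖(t a : ℚ_[p])‖ ^ ((n : ℝ) - 1 - 2 * a) := by
  have hpos : ∀ a, 0 < ‖(t a : ℚ_[p])‖ := fun a => norm_pos_iff.mpr (t a).ne_zero
  have h1 : modulus t = ∏ x : Fin n × Fin n,
      if x.1 < x.2 then ‖(t x.1 : ℚ_[p])‖ / ‖(t x.2 : ℚ_[p])‖ else 1 := by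
    rw [modulus, ← Finset.prod_filter]
    exact (Finset.prod_subtype (Finset.univ.filter fun x : Fin n × Fin n => x.1 < x.2)
      (fun x => by simp) fun x => ‖(t x.1 : ℚ_[p])‖ / ‖(t x.2 : ℚ_[p])‖).symm
  have h2 : ∀ a b : Fin n, (if a < b then ‖(t a : ℚ_[p])‖ / ‖(t b : ℚ_[p])‖ else 1) =
      ‖(t a : ℚ_[p])‖ ^ (if a < b then (1 : ℝ) else 0) *
        ‖(t b : ℚ_[p])‖ ^ (-(if a < b then (1 : ℝ) else 0)) := by
    intro a b
    split_ifs <;> simp [Real.rpow_neg_one, div_eq_mul_inv]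
  rw [h1, Fintype.prod_prod_type]
  simp only [h2, Finset.prod_mul_distrib]
  rw [Finset.prod_comm (f := fun a b => ‖(t b : ℚ_[p])‖ ^ (-(if a < b then (1 : ℝ) else 0))),
    ← Finset.prod_mul_distrib]
  refine Finset.prod_congr rfl fun a _ => ?_
  rw [← Real.rpow_sum_of_pos (hpos a), ← Real.rpow_sum_of_pos (hpos a), ← Real.rpow_add (hpos a)]
  congr 1
  have h3 : ∑ b : Fin n, (if a < b then (1 : ℝ) else 0) = (n : ℝ) - 1 - a := by
    rw [Finset.sum_boole, Finset.filter_lt_eq_Ioi, Fin.card_Ioi]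
    have := a.isLt
    rw [Nat.cast_sub (by omega), Nat.cast_sub (by omega), Nat.cast_one]
  have h4 : ∑ b : Fin n, (if b < a then (1 : ℝ) else 0) = a := by
    rw [Finset.sum_boole, Finset.filter_gt_eq_Iio, Fin.card_Iio]
  rw [Finset.sum_neg_distrib, h3, h4]
  ring

/-- Take for $c_k$ the product of the last $k$ entries of $t$. Ratios of consecutive products
recover the entries, and $\prod_i|t_i|=1$ is what the convention $c_n=1$ requires. -/
theorem exists_norm_starTorus (hn : 0 < n) (t : Torus n p) (ht : ∏ i, ‖(t i : ℚ_[p])‖ = 1) :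
    ∃ c : Fin (n - 1) → ℚ_[p]ˣ, ∀ a, ‖(starTorus c a : ℚ_[p])‖ = ‖(t a : ℚ_[p])‖ := by
  let tail : ℕ → ℚ_[p]ˣ := fun m => ∏ a : Fin n, if m ≤ (a : ℕ) then t a else 1
  have htail : ∀ a : Fin n, tail a = t a * tail (a + 1) := by
    intro a
    simp only [tail]
    rw [← Finset.mul_prod_erase _ _ (Finset.mem_univ a), if_pos le_rfl,
      ← Finset.mul_prod_erase _ (fun b : Fin n => if (a : ℕ) + 1 ≤ b then t b else 1)
        (Finset.mem_univ a), if_neg (by omega), one_mul]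
    congr 1
    refine Finset.prod_congr rfl fun b hb => ?_
    have : (b : ℕ) ≠ a := fun h => Finset.ne_of_mem_erase hb (Fin.ext h)
    by_cases h : (a : ℕ) ≤ b
    · rw [if_pos h, if_pos (by omega)]
    · rw [if_neg h, if_neg (by omega)]
  have htail0 : ‖(tail 0 : ℚ_[p])‖ = 1 := by
    simp only [tail, zero_le, if_true]
    rw [Units.coe_prod, norm_prod, ht]
  have htailn : tail n = 1 := Finset.prod_eq_one fun a _ => if_neg (by omega)
  have hme : ∀ m ≤ n, ‖(modulusEntry (fun i : Fin (n - 1) => tail (n - (i + 1))) (n - m) : ℚ_[p])‖ =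
      ‖(tail m : ℚ_[p])‖ := by
    intro m hm
    rw [modulusEntry]
    split_ifs with h
    · have : n - (n - m - 1 + 1) = m := by omega
      rw [this]
    · rcases Nat.eq_zero_or_pos m with rfl | h0
      · rw [htail0]; simp
      · obtain rfl : m = n := by omega
        rw [htailn]
  refine ⟨fun i => tail (n - (i + 1)), fun a => ?_⟩
  have ha := a.isLt
  rw [starTorus, Units.val_div_eq_div_val, norm_div, hme a ha.le, Nat.sub_sub, hme _ (by omega),
    htail a, Units.val_mul, norm_mul, mul_div_cancel_right₀]
  exact norm_ne_zero_iff.mpr (Units.ne_zero _)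

theorem le_index_iff (d : Composition n) (a : Fin n) (m : ℕ) :
    m ≤ (d.index a : ℕ) ↔ d.sizeUpTo m ≤ a := by
  have h1 := d.lt_sizeUpTo_index_succ a
  have h2 := d.sizeUpTo_index_le a
  constructor
  · exact fun h => (d.monotone_sizeUpTo h).trans h2
  · intro h
    by_contra h3
    have := d.monotone_sizeUpTo (show ((d.index a).succ : ℕ) ≤ m by simp only [Fin.val_succ]; omega)
    omega

/-- The exponents of the absolute value of `χ_s^{ad} δ^{1/2}`. -/
noncomputable def admissibleExponent (d : Composition n) (s : Fin (d.length - 1) → ℂ)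
    (a : Fin n) : ℝ :=
  ((n : ℝ) - 1 - 2 * a) / 2 -
    ∑ i : Fin (d.length - 1), if (i : ℕ) < d.index a then (s i).re else 0

/-- An unramified character depends only on the norms of the entries, so $t$ may be replaced by some
$c^*$. The norm of $c_{n-d_1-\dots-d_i}$ is that of the product of the entries of $t$ behind the
first $i$ blocks, so $s_i$ contributes to the exponent at $a$ exactly when $a$ lies behind them. -/
theorem norm_twist_of_isAdmissibleCharacter (d : Composition n) {s : Fin (d.length - 1) → ℂ}
    {χ : Torus n p →* ℂˣ} (hχ : IsUnramified χ) (hs : IsAdmissibleCharacter d s χ)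
    (t : Torus n p) (ht : ∏ i, ‖(t i : ℚ_[p])‖ = 1) :
    ‖twist χ t‖ = ∏ i, ‖(t i : ℚ_[p])‖ ^ admissibleExponent d s i := by
  rcases Nat.eq_zero_or_pos n with rfl | hn
  · have h1 : χ t = 1 := hχ t fun i => i.elim0
    simp [twist, h1, modulus_eq]
  have hpos : ∀ a, 0 < ‖(t a : ℚ_[p])‖ := fun a => norm_pos_iff.mpr (t a).ne_zero
  obtain ⟨c, hc⟩ := exists_norm_starTorus hn t ht
  have hχt : χ t = χ (starTorus c) := by
    rw [← div_eq_one, ← map_div]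
    refine hχ _ fun i => ?_
    simp [Pi.div_apply, hc, (hpos i).ne']
  have hent : ∀ m ≤ n, ‖(modulusEntry c (n - m) : ℚ_[p])‖ =
      ∏ a : Fin n, ‖(t a : ℚ_[p])‖ ^ (if m ≤ (a : ℕ) then (1 : ℝ) else 0) := by
    intro m hm
    rw [← prod_starTorus c (n - m) (Nat.sub_le _ _), Units.coe_prod, norm_prod]
    refine Finset.prod_congr rfl fun a _ => ?_
    rw [Nat.sub_sub_self hm]
    split_ifs
    · rw [hc, Real.rpow_one]
    · simp
  have hχn : ‖(χ t : ℂ)‖ = ∏ a : Fin n, ‖(t a : ℚ_[p])‖ ^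
      (-∑ i : Fin (d.length - 1), if (i : ℕ) < d.index a then (s i).re else 0) := by
    rw [hχt, hs c, norm_prod]
    have h1 : ∀ i : Fin (d.length - 1),
        ‖((‖(modulusEntry c (n - d.sizeUpTo (i + 1)) : ℚ_[p])‖ : ℝ) : ℂ) ^ (-s i)‖ =
        ∏ a : Fin n, ‖(t a : ℚ_[p])‖ ^ (-(if (i : ℕ) < d.index a then (s i).re else 0)) := by
      intro i
      rw [Complex.norm_cpow_eq_rpow_re_of_pos (norm_pos_iff.mpr (Units.ne_zero _)),
        hent _ (d.sizeUpTo_le _), ← Real.finsetProd_rpow _ _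
          (fun a _ => Real.rpow_nonneg (norm_nonneg _) _)]
      refine Finset.prod_congr rfl fun a _ => ?_
      rw [← Real.rpow_mul (norm_nonneg _)]
      congr 1
      have h2 : (i : ℕ) < d.index a ↔ _ := le_index_iff d a (i + 1)
      by_cases h : d.sizeUpTo (i + 1) ≤ a
      · rw [if_pos h, if_pos (h2.mpr h)]; simp
      · rw [if_neg h, if_neg (fun h' => h (h2.mp h'))]; simp
    rw [Finset.prod_congr rfl fun i _ => h1 i, Finset.prod_comm]
    refine Finset.prod_congr rfl fun a _ => ?_
    rw [← Real.rpow_sum_of_pos (hpos a), Finset.sum_neg_distrib]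
  have hm : ‖((modulus t ^ (1 / 2 : ℝ) : ℝ) : ℂ)‖ =
      ∏ a : Fin n, ‖(t a : ℚ_[p])‖ ^ (((n : ℝ) - 1 - 2 * a) / 2) := by
    have h0 : ∀ a : Fin n, 0 ≤ ‖(t a : ℚ_[p])‖ ^ ((n : ℝ) - 1 - 2 * a) := fun a =>
      Real.rpow_nonneg (norm_nonneg _) _
    rw [modulus_eq, Complex.norm_real, Real.norm_of_nonneg
      (Real.rpow_nonneg (Finset.prod_nonneg fun a _ => h0 a) _),
      ← Real.finsetProd_rpow _ _ (fun a _ => h0 a)]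
    refine Finset.prod_congr rfl fun a _ => ?_
    rw [← Real.rpow_mul (norm_nonneg _)]
    congr 1; ring
  rw [twist, norm_mul, hχn, hm, ← Finset.prod_mul_distrib]
  refine Finset.prod_congr rfl fun a _ => ?_
  rw [← Real.rpow_add (hpos a), admissibleExponent]
  congr 1; ring

theorem monotone_index (d : Composition n) : Monotone fun a : Fin n => (d.index a : ℕ) :=
  fun a b h => (le_index_iff d b _).mpr ((d.sizeUpTo_index_le a).trans h)

theorem exists_index_eq (d : Composition n) {j : ℕ} (hj : j < d.length) :
    ∃ a, (d.index a : ℕ) = j :=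
  ⟨d.embedding ⟨j, hj⟩ ⟨0, d.blocks_pos' _ hj⟩, by rw [d.index_embedding]⟩

/-- The factor $\delta^{1/2}$ contributes $b-a$, and every block boundary between $a$ and $b$
contributes some $\mathrm{Re}(s_i)\ge1$. -/
theorem admissibleExponent_sub_ge (d : Composition n) {s : Fin (d.length - 1) → ℂ}
    (hs : ∀ i, 1 ≤ (s i).re) {a b : Fin n} (hab : (d.index a : ℕ) < d.index b) :
    ((b : ℝ) - a) + (((d.index b : ℕ) : ℝ) - (d.index a : ℕ)) ≤
      admissibleExponent d s a - admissibleExponent d s b := by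
  have hcount : ∀ c : Fin n,
      ∑ i : Fin (d.length - 1), (if (i : ℕ) < d.index c then (1 : ℝ) else 0) = (d.index c : ℕ) := by
    intro c
    rw [Finset.sum_boole, Fin.card_filter_val_lt, min_eq_right (by omega)]
  have hle : ∑ i : Fin (d.length - 1), ((if (i : ℕ) < d.index b then (1 : ℝ) else 0) -
        if (i : ℕ) < d.index a then 1 else 0) ≤
      ∑ i : Fin (d.length - 1), ((if (i : ℕ) < d.index b then (s i).re else 0) -
        if (i : ℕ) < d.index a then (s i).re else 0) := by
    refine Finset.sum_le_sum fun i _ => ?_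
    have := hs i
    split_ifs <;> first | omega | linarith
  rw [Finset.sum_sub_distrib, Finset.sum_sub_distrib, hcount, hcount] at hle
  rw [admissibleExponent, admissibleExponent]
  linarith

end Characters

/-! ### The intertwining integral at the identity -/

section Intertwining

variable {p : ℕ} [Fact p.Prime] {n : ℕ}

theorem admissibleWeyl_symm_apply (d : Composition n) (a : Fin n) :
    (admissibleWeyl d).symm a = admissibleCol d a := rfl

/-- $w^{-1}$ reverses the order of the blocks and keeps the order inside each, so its inversions are
the pairs of indices from different blocks. -/
theorem admissibleCol_lt_and_lt_iff (d : Composition n) (a b : Fin n) :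
    admissibleCol d a < admissibleCol d b ∧ b < a ↔ (d.index b : ℕ) < d.index a := by
  have ha1 := d.lt_sizeUpTo_index_succ a
  have ha2 := d.sizeUpTo_index_le a
  have ha3 := d.sizeUpTo_le (d.index a + 1)
  have hb1 := d.lt_sizeUpTo_index_succ b
  have hb2 := d.sizeUpTo_index_le b
  have hb3 := d.sizeUpTo_le (d.index b + 1)
  simp only [Fin.val_succ] at ha1 hb1
  simp only [Fin.lt_def, admissibleCol]
  rcases lt_trichotomy (d.index b : ℕ) (d.index a) with h | h | h
  · have := d.monotone_sizeUpTo (show (d.index b : ℕ) + 1 ≤ d.index a from h)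
    omega
  · rw [h] at hb1 hb2 ⊢
    omega
  · have := d.monotone_sizeUpTo (show (d.index a : ℕ) + 1 ≤ d.index b from h)
    omega

/-- The coordinates of `U_w` as positions in block unipotent matrices, by conjugation with `w`. -/
noncomputable def lowerPosEquivPosToNeg (d : Composition n) :
    LowerPos (fun a : Fin n => (d.index a : ℕ)) ≃ PosToNeg (admissibleWeyl d) :=
  ((admissibleWeyl d).symm.prodCongr (admissibleWeyl d).symm).subtypeEquiv fun a => by
    rw [← admissibleCol_lt_and_lt_iff]
    simp [← admissibleWeyl_symm_apply]

/-- Conjugation by $w$ only relabels the matrix entries, so the product measure is unchanged in the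
new coordinates. -/
theorem weylElt_mul_unipotentCoord (d : Composition n) (z : PosToNeg (admissibleWeyl d) → ℚ_[p]) :
    (weylElt p (admissibleWeyl d) * unipotentCoord (admissibleWeyl d) z : GL (Fin n) ℚ_[p]).val =
      lowerMatrix _ (fun a => z (lowerPosEquivPosToNeg d a)) *
        (weylElt p (admissibleWeyl d)).val := by
  have hconj : (weylElt p (admissibleWeyl d) * unipotentCoord (admissibleWeyl d) z *
      (weylElt p (admissibleWeyl d))⁻¹ : GL (Fin n) ℚ_[p]).val =
      lowerMatrix _ (fun a => z (lowerPosEquivPosToNeg d a)) := by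
    ext i j
    rw [conj_weylElt_apply]
    change unipotentMatrix _ z _ _ = _
    by_cases h : (d.index j : ℕ) < d.index i
    · have h' := (admissibleCol_lt_and_lt_iff d i j).mpr h
      rw [lowerMatrix_of_lt (bl := fun a : Fin n => (d.index a : ℕ)) _ h, unipotentMatrix,
        Matrix.of_apply, dif_pos ⟨h'.1, by simpa using h'.2⟩]
      rfl
    · rw [lowerMatrix_of_not_lt (bl := fun a : Fin n => (d.index a : ℕ)) _ h, unipotentMatrix,
        Matrix.of_apply, dif_neg]
      · simp [Matrix.one_apply]
      · intro h'
        exact h ((admissibleCol_lt_and_lt_iff d i j).mp ⟨h'.1, by simpa using h'.2⟩)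
  rw [← hconj, ← Units.val_mul, inv_mul_cancel_right]

-- Supplies the measurability for absolute convergence. The vector is extended by $0$ to singular
-- matrices, so that local constancy along matrix families applies.
open Classical in
theorem continuous_intertwiningIntegrand (d : Composition n) (χ : Torus n p →* ℂˣ)
    (hχ : IsUnramified χ) :
    Continuous (intertwiningIntegrand (admissibleWeyl d) (basisVector χ 1) 1) := by
  let F : Matrix (Fin n) (Fin n) ℚ_[p] → ℂ := fun M =>
    if h : IsUnit M then basisVector χ 1 h.unit else 0
  have hFv : ∀ g : GL (Fin n) ℚ_[p], F g.val = basisVector χ 1 g := fun g => by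
    simp only [F]
    rw [dif_pos g.isUnit, IsUnit.unit_of_val_units]
  let v : (PosToNeg (admissibleWeyl d) → ℚ_[p]) → Matrix (Fin n) (Fin n) ℚ_[p] := fun z =>
    lowerMatrix _ (fun a => z (lowerPosEquivPosToNeg d a))
  have hv : Continuous v :=
    (continuous_lowerMatrix (fun a : Fin n => (d.index a : ℕ))).comp
      (continuous_pi fun a => continuous_apply (lowerPosEquivPosToNeg d a))
  have hvg : ∀ z, v z * (weylElt p (admissibleWeyl d)).val =
      (weylElt p (admissibleWeyl d) * unipotentCoord (admissibleWeyl d) z :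
        GL (Fin n) ℚ_[p]).val := fun z => (weylElt_mul_unipotentCoord d z).symm
  have hvi : ∀ z, v z * (v z).adjugate = 1 := fun z =>
    lowerMatrix_mul_adjugate (monotone_index d) _
  clear_value v F
  have hF : ∀ z m, IsIwahoriMatrix m → F (v z * (weylElt p (admissibleWeyl d)).val * m) =
      F (v z * (weylElt p (admissibleWeyl d)).val) := by
    intro z m hm
    obtain ⟨-, m', -, hmm⟩ := id hm
    have h := basisVector_one_mul χ hχ (weylElt p (admissibleWeyl d) *
      unipotentCoord (admissibleWeyl d) z)
      (k := ⟨m, m', hmm, mul_eq_one_comm.mp hmm⟩) (mem_iwahori_of_isIwahoriMatrix hm)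
    rw [← hFv, ← hFv, Units.val_mul _ (Units.mk _ _ _ _), ← hvg] at h
    exact h
  have hcont := (isLocallyConstant_of_iwahori_invariant
    (v' := fun z => (weylElt p (admissibleWeyl d))⁻¹.val * (v z).adjugate) hF
    (hv.mul continuous_const) (continuous_const.mul hv.matrix_adjugate) fun z => by
      rw [mul_assoc, ← mul_assoc (weylElt p (admissibleWeyl d)).val, Units.mul_inv, one_mul,
        hvi]).continuous
  refine hcont.congr fun z => ?_
  rw [intertwiningIntegrand, mul_one, hvg, hFv]

theorem enorm_intertwiningIntegrand_le (d : Composition n) {s : Fin (d.length - 1) → ℂ}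
    {χ : Torus n p →* ℂˣ} (hχ : IsUnramified χ) (hs : IsAdmissibleCharacter d s χ)
    (z : PosToNeg (admissibleWeyl d) → ℚ_[p]) :
    ‖intertwiningIntegrand (admissibleWeyl d) (basisVector χ 1) 1 z‖ₑ ≤
      absVector (admissibleExponent d s)
        (lowerMatrix _ (fun a => z (lowerPosEquivPosToNeg d a)) *
          (weylElt p (admissibleWeyl d)).val) := by
  rw [intertwiningIntegrand, mul_one, ← weylElt_mul_unipotentCoord]
  refine enorm_basisVector_one_le χ (norm_twist_of_isAdmissibleCharacter d hχ hs) ?_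
  rw [weylElt_mul_unipotentCoord, Matrix.det_mul, det_lowerMatrix (monotone_index d), one_mul]
  exact norm_det_of_mem_maxCompact (weylElt_mem_maxCompact _)

/-- The exponents of the direct bound and of the contragredient bound add up to $n(r-1)$; $m$ is the
larger of the two. -/
theorem lintegral_enorm_intertwiningIntegrand_le (hn : 0 < n) (d : Composition n)
    {s : Fin (d.length - 1) → ℂ} (hre : ∀ i, 1 ≤ (s i).re) {χ : Torus n p →* ℂˣ}
    (hχ : IsUnramified χ) (hs : IsAdmissibleCharacter d s χ) :
    ∃ m : ℕ, (n : ℝ) * ((d.length : ℝ) - 1) / 2 ≤ m ∧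
      ∫⁻ z, ‖intertwiningIntegrand (admissibleWeyl d) (basisVector χ 1) 1 z‖ₑ
        ∂unipotentMeasure p (admissibleWeyl d) ≤ 3 ^ (n * n) * ((p : ℝ≥0∞)⁻¹) ^ m := by
  have hlen : 0 < d.length := d.length_pos_of_pos hn
  have hW := isMaxCompactMatrix_of_mem_maxCompact
    (weylElt_mem_maxCompact (p := p) (admissibleWeyl d))
  have hint : ∫⁻ z, ‖intertwiningIntegrand (admissibleWeyl d) (basisVector χ 1) 1 z‖ₑ
        ∂unipotentMeasure p (admissibleWeyl d) ≤
      ∫⁻ z : LowerPos (fun a : Fin n => (d.index a : ℕ)) → ℚ_[p],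
        absVector (admissibleExponent d s) (lowerMatrix _ z *
          (weylElt p (admissibleWeyl d)).val) ∂Measure.pi (fun _ => padicHaar p) := by
    rw [← lintegral_pi_reindex (lowerPosEquivPosToNeg d)]
    exact lintegral_mono fun z => enorm_intertwiningIntegrand_le d hχ hs z
  have hle : ∀ a : Fin n, (d.index a : ℕ) ≤ d.length - 1 := fun a => by omega
  have he : ∀ a b : Fin n, (d.index a : ℕ) < d.index b → _ := fun a b h =>
    admissibleExponent_sub_ge d hre h
  have h1 := lintegral_absVector_le (p := p) (monotone_index d)
    (fun a j hj => exists_index_eq d (hj.trans (d.index a).isLt)) he hW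
  have h2 := lintegral_absVector_le_rev (p := p) (monotone_index d) hle
    (fun j hj => exists_index_eq d (by omega)) he hW
  have hsum : ∑ a : Fin n, (d.index a : ℕ) + ∑ a : Fin n, (d.length - 1 - (d.index a : ℕ)) =
      n * (d.length - 1) := by
    rw [← Finset.sum_add_distrib, Finset.sum_congr rfl fun a _ => Nat.add_sub_of_le (hle a)]
    simp
  have hsum' : ((∑ a : Fin n, (d.index a : ℕ) : ℕ) : ℝ) +
      (∑ a : Fin n, (d.length - 1 - (d.index a : ℕ)) : ℕ) = n * ((d.length : ℝ) - 1) := by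
    rw [← Nat.cast_add, hsum, Nat.cast_mul, Nat.cast_sub (by omega), Nat.cast_one]
  rcases le_total (∑ a : Fin n, (d.index a : ℕ))
    (∑ a : Fin n, (d.length - 1 - (d.index a : ℕ))) with h | h
  · refine ⟨_, ?_, hint.trans h2⟩
    have : ((∑ a : Fin n, (d.index a : ℕ) : ℕ) : ℝ) ≤
      (∑ a : Fin n, (d.length - 1 - (d.index a : ℕ)) : ℕ) := by exact_mod_cast h
    linarith
  · refine ⟨_, ?_, hint.trans h1⟩
    have : ((∑ a : Fin n, (d.length - 1 - (d.index a : ℕ)) : ℕ) : ℝ) ≤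
      (∑ a : Fin n, (d.index a : ℕ) : ℕ) := by exact_mod_cast h
    linarith

end Intertwining

end IwahoriGL

/-! ### The main theorem -/

theorem mainTheorem2 (n : ℕ) (hn : 3 ≤ n) :
    ∃ C : ℝ, ∀ (l : ℕ) [Fact l.Prime] (d : Composition n)
      (ε : Fin (d.length - 1) → ℝ) (_ : ∀ i, 0 < ε i)
      (s : Fin (d.length - 1) → ℂ) (_ : ∀ i, (s i).re = 1 + ε i)
      (χ : IwahoriGL.Torus n l →* ℂˣ) (_ : IwahoriGL.IsUnramified χ)
      (_ : IwahoriGL.IsAdmissibleCharacter d s χ),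
      MeasureTheory.Integrable
          (IwahoriGL.intertwiningIntegrand (IwahoriGL.admissibleWeyl d)
            (IwahoriGL.basisVector χ 1) 1)
          (IwahoriGL.unipotentMeasure l (IwahoriGL.admissibleWeyl d)) ∧
        ‖IwahoriGL.intertwining (IwahoriGL.admissibleWeyl d) (IwahoriGL.basisVector χ 1) 1‖ ≤
          C * (l : ℝ) ^ (-((n : ℝ) * ((d.length : ℝ) - 1) / 2)) := by
  -- Each integration over a matrix entry costs a factor of at most $3$, and there are fewer than
  -- $n^2$ of them.
  refine ⟨3 ^ (n * n), fun l _ d ε hε s hs χ hχ hχs => ?_⟩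
  obtain ⟨m, hm, hint⟩ := IwahoriGL.lintegral_enorm_intertwiningIntegrand_le (by omega) d
    (fun i => by rw [hs]; linarith [hε i]) hχ hχs
  have hl : (l : ENNReal) ≠ 0 := by exact_mod_cast (Fact.out : l.Prime).ne_zero
  have hl1 : (1 : ℝ) ≤ l := by exact_mod_cast (Fact.out : l.Prime).one_le
  have htop : (3 : ENNReal) ^ (n * n) * ((l : ENNReal)⁻¹) ^ m ≠ ⊤ :=
    ENNReal.mul_ne_top (ENNReal.pow_ne_top (by simp)) (ENNReal.pow_ne_top (by simp [hl]))
  refine ⟨⟨(IwahoriGL.continuous_intertwiningIntegrand d χ hχ).aestronglyMeasurable,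
    hint.trans_lt htop.lt_top⟩, ?_⟩
  have h1 := ENNReal.toReal_mono htop
    ((enorm_integral_le_lintegral_enorm (μ := IwahoriGL.unipotentMeasure l
      (IwahoriGL.admissibleWeyl d)) _).trans hint)
  rw [toReal_enorm, ENNReal.toReal_mul, ENNReal.toReal_pow, ENNReal.toReal_pow,
    ENNReal.toReal_inv, ENNReal.toReal_natCast, ENNReal.toReal_ofNat] at h1
  refine h1.trans ?_
  gcongr
  rw [inv_pow, ← Real.rpow_natCast, ← Real.rpow_neg (by positivity)]
  exact Real.rpow_le_rpow_of_exponent_le hl1 (neg_le_neg hm)
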